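/- Let $1\le k\le n-1$. Write $x\in\mathbb R^n$ as $x=(x',x'')$ with $x'\in\mathbb R^{k+1}$ (the first $k+1$ coordinates) and $x''\in\mathbb R^{n-k-1}$, and let $\tilde Z_{n,k}=S^k\times\mathbb R\times\mathbb R^{n-k-1}$, where $S^k$ is the unit sphere in $\mathbb R^{k+1}$. For $f$ in the Schwartz space $S(\mathbb R^n)$ of complex-valued functions, the restricted $k$-plane transform is $$(\tilde R_kf)(\theta,s;x'')=\int_{\theta^\perp\cap\mathbb R^{k+1}}f(s\theta+u,x'')\,d_\theta u,\qquad(\theta,s;x'')\in\tilde Z_{n,k},$$ where $d_\theta u$ is the Euclidean volume element of $\theta^\perp\cap\mathbb R^{k+1}$; this is the integral of $f$ over the $k$-plane $\{(x',x''):\theta\cdot x'=s\}$ ($x''$ fixed), and these are exactly the $k$-planes parallel to $\mathbb R^{k+1}$. Derivatives in $\theta$ of a function on $S^k$ are the restrictions to $S^k$ of the derivatives of its extension to $\mathbb R^{k+1}\setminus\{0\}$ that is homogeneous of degree $0$. Let $S_e(\tilde Z_{n,k})$ be the space of complex-valued functions $\varphi(\theta,s;x'')$ on $\tilde Z_{n,k}$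 that are infinitely differentiable in $(\theta,s,x'')$, rapidly decreasing as $|s|+|x''|\to\infty$ together with all derivatives, and even: $\varphi(-\theta,-s;x'')=\varphi(\theta,s;x'')$. Its topology is defined by the norms $$\|\varphi\|_m=\sup_{|\mu|+j+|\gamma|\le m}\ \sup_{\theta,s,x''}(1+|s|+|x''|)^m\,|(\partial_\theta^\mu\partial_s^j\partial_{x''}^\gamma\varphi)(\theta,s;x'')|,\qquad m=0,1,2,\dots$$ Let $S_H(\tilde Z_{n,k})$ be the subspace, with the induced topology, of all $\varphi\in S_e(\tilde Z_{n,k})$ such that for every $m\in\{0,1,2,\dots\}$ there are functions $c_\alpha\in S(\mathbb R^{n-k-1})$, $\alpha\in\mathbb Z_+^{k+1}$, $|\alpha|=m$, with $$\int_{\mathbb R}\varphi(\theta,s;x'')\,s^m\,ds=\sum_{|\alpha|=m}c_\alpha(x'')\,\theta^\alpha\qquad\text{for all }\theta\in S^k,\ x''\in\mathbb R^{n-k-1}.$$ **Theorem.** For every $f\in S(\mathbb R^n)$ the integral defining $\tilde R_kf$ converges absolutely at every point of $\tilde Z_{n,k}$, and $\tilde R_k$ is a linear topological isomorphism from $S(\mathbb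 R^n)$ onto $S_H(\tilde Z_{n,k})$: it is a linear bijection, and both $\tilde R_k$ and its inverse are continuous. (For $k=n-1$, where $\mathbb R^{n-k-1}$ is a point, this is Helgason's range theorem for the Radon transform.) -/

import Mathlib

open MeasureTheory
open scoped ContDiff SchwartzMap

noncomputable section

/-- The parameter space `Z̃_{n,k} = S^k × ℝ × ℝ^{n-k-1}`, where `S^k` is the unit sphere of
`ℝ^{k+1}`. (It is used for `1 ≤ k < n`, so that the subtraction does not truncate.) -/
abbrev ParamSpace (n k : ℕ) : Type :=
  Metric.sphere (0 : EuclideanSpace ℝ (Fin (k + 1))) 1 × ℝ × EuclideanSpace ℝ (Fin (n - k - 1))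

/-- The point `(x', x'')` of `ℝⁿ`: the first `k + 1` coordinates are those of `x'`, the last
`n - k - 1` coordinates are those of `x''`. -/
def joinCoord (n k : ℕ) (x' : EuclideanSpace ℝ (Fin (k + 1)))
    (x'' : EuclideanSpace ℝ (Fin (n - k - 1))) : EuclideanSpace ℝ (Fin n) :=
  WithLp.toLp 2 fun i : Fin n =>
    if h : (i : ℕ) < k + 1 then x' ⟨i, h⟩ else x'' ⟨i - (k + 1), by omega⟩

/-- The Euclidean volume on the hyperplane `θ^⊥ ∩ ℝ^{k+1}` of `ℝ^{k+1}` (the Lebesgue measure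
for which the cube spanned by an orthonormal basis of `θ^⊥` has measure one). -/
def perpVolume {k : ℕ} (θ : EuclideanSpace ℝ (Fin (k + 1))) : Measure (ℝ ∙ θ)ᗮ :=
  @volume _ measureSpaceOfInnerProductSpace

/-- The restricted `k`-plane transform
`(R̃_k f)(θ, s; x'') = ∫_{θ^⊥ ∩ ℝ^{k+1}} f (s θ + u, x'') d_θ u`, that is, the integral of `f`
over the `k`-plane `{(x', x'') : θ ⬝ x' = s}`, which is parallel to `ℝ^{k+1}`. -/
def restrictedKPlane {n k : ℕ} (f : EuclideanSpace ℝ (Fin n) → ℂ) (z : ParamSpace n k) : ℂ :=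
  ∫ u : (ℝ ∙ (z.1 : EuclideanSpace ℝ (Fin (k + 1))))ᗮ,
    f (joinCoord n k (z.2.1 • (z.1 : EuclideanSpace ℝ (Fin (k + 1))) + u) z.2.2)
    ∂(perpVolume (z.1 : EuclideanSpace ℝ (Fin (k + 1))))

/-- The extension `φ (x' / |x'|, s; x'')` of `φ` that is homogeneous of degree zero in `x' ≠ 0`
(with the irrelevant value `0` at `x' = 0`). -/
def homExt {n k : ℕ} (φ : ParamSpace n k → ℂ)
    (p : EuclideanSpace ℝ (Fin (k + 1)) × ℝ × EuclideanSpace ℝ (Fin (n - k - 1))) : ℂ :=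
  open Classical in
  if h : p.1 = 0 then 0
  else φ (⟨‖p.1‖⁻¹ • p.1, by simp [norm_smul, h]⟩, p.2)

/-- `φ` is infinitely differentiable on `S^k × ℝ × ℝ^{n-k-1}`: its degree zero extension is
infinitely differentiable where `x' ≠ 0`. -/
def IsSmoothParam {n k : ℕ} (φ : ParamSpace n k → ℂ) : Prop :=
  ContDiffOn ℝ ∞ (homExt φ) {p | p.1 ≠ 0}

/-- The size of the derivatives of order `i` of `φ` in `(θ, s, x'')` at `z`. The derivatives in `θ`
are the restrictions to the sphere of the derivatives of the degree zero extension; the operator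
norm of the `i`-th derivative is comparable with the maximum of the partial derivatives
`∂_θ^μ ∂_s^j ∂_{x''}^γ φ` with `|μ| + j + |γ| = i`. -/
def derivNorm {n k : ℕ} (φ : ParamSpace n k → ℂ) (i : ℕ) (z : ParamSpace n k) : ℝ :=
  ‖iteratedFDeriv ℝ i (homExt φ) ((z.1 : EuclideanSpace ℝ (Fin (k + 1))), z.2)‖

/-- The weight `1 + |s| + |x''|`. -/
def weight {n k : ℕ} (z : ParamSpace n k) : ℝ := 1 + |z.2.1| + ‖z.2.2‖

/-- `φ` is rapidly decreasing as `|s| + |x''| → ∞`, together with all its derivatives. -/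
def IsRapidlyDecreasing {n k : ℕ} (φ : ParamSpace n k → ℂ) : Prop :=
  ∀ m i : ℕ, ∃ C : ℝ, ∀ z, weight z ^ m * derivNorm φ i z ≤ C

/-- `φ (-θ, -s; x'') = φ (θ, s; x'')`. -/
def IsEvenParam {n k : ℕ} (φ : ParamSpace n k → ℂ) : Prop :=
  ∀ θ s x'', φ (-θ, -s, x'') = φ (θ, s, x'')

/-! Auxiliary facts: the degree zero extension and its derivatives depend linearly on `φ`. -/

theorem homExt_add {n k : ℕ} (φ ψ : ParamSpace n k → ℂ) :
    homExt (φ + ψ) = homExt φ + homExt ψ := by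
  funext p
  by_cases h : p.1 = 0 <;> simp [homExt, h]

theorem homExt_smul {n k : ℕ} (c : ℂ) (φ : ParamSpace n k → ℂ) :
    homExt (c • φ) = c • homExt φ := by
  funext p
  by_cases h : p.1 = 0 <;> simp [homExt, h]

theorem homExt_zero {n k : ℕ} : homExt (0 : ParamSpace n k → ℂ) = 0 := by
  funext p
  by_cases h : p.1 = 0 <;> simp [homExt, h]

theorem IsSmoothParam.contDiffAt {n k : ℕ} {φ : ParamSpace n k → ℂ} (h : IsSmoothParam φ)
    (i : ℕ) (z : ParamSpace n k) :
    ContDiffAt ℝ i (homExt φ) ((z.1 : EuclideanSpace ℝ (Fin (k + 1))), z.2) := by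
  have hz : (z.1 : EuclideanSpace ℝ (Fin (k + 1))) ≠ 0 := by
    have := norm_eq_of_mem_sphere z.1
    intro h0
    rw [h0] at this
    simp at this
  have ho : IsOpen {p : EuclideanSpace ℝ (Fin (k + 1)) × ℝ × EuclideanSpace ℝ (Fin (n - k - 1)) |
      p.1 ≠ 0} := isOpen_ne_fun continuous_fst continuous_const
  exact (ContDiffOn.contDiffAt h (ho.mem_nhds hz)).of_le (by exact_mod_cast le_top)

theorem derivNorm_nonneg {n k : ℕ} (φ : ParamSpace n k → ℂ) (i : ℕ) (z : ParamSpace n k) :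
    0 ≤ derivNorm φ i z := norm_nonneg _

theorem weight_pos {n k : ℕ} (z : ParamSpace n k) : 0 < weight z := by
  unfold weight
  positivity

theorem derivNorm_add_le {n k : ℕ} {φ ψ : ParamSpace n k → ℂ} (hφ : IsSmoothParam φ)
    (hψ : IsSmoothParam ψ) (i : ℕ) (z : ParamSpace n k) :
    derivNorm (φ + ψ) i z ≤ derivNorm φ i z + derivNorm ψ i z := by
  unfold derivNorm
  rw [homExt_add, iteratedFDeriv_add_apply (hφ.contDiffAt i z) (hψ.contDiffAt i z)]
  exact norm_add_le _ _

theorem derivNorm_smul {n k : ℕ} (c : ℂ) {φ : ParamSpace n k → ℂ} (hφ : IsSmoothParam φ)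
    (i : ℕ) (z : ParamSpace n k) :
    derivNorm (c • φ) i z = ‖c‖ * derivNorm φ i z := by
  unfold derivNorm
  rw [homExt_smul, iteratedFDeriv_const_smul_apply (hφ.contDiffAt i z), norm_smul]

/-- The functions in `S_e(Z̃_{n,k})`, as a linear space: even, infinitely differentiable functions
that decrease rapidly together with all their derivatives. -/
def evenSchwartzSubmodule (n k : ℕ) : Submodule ℂ (ParamSpace n k → ℂ) where
  carrier := {φ | IsSmoothParam φ ∧ IsRapidlyDecreasing φ ∧ IsEvenParam φ}
  zero_mem' := by
    refine ⟨?_, fun m i => ⟨0, fun z => ?_⟩, fun _ _ _ => rfl⟩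
    · unfold IsSmoothParam
      rw [homExt_zero]
      exact contDiffOn_const
    · have : derivNorm (0 : ParamSpace n k → ℂ) i z = 0 := by
        unfold derivNorm
        rw [homExt_zero]
        have h0 : (0 : EuclideanSpace ℝ (Fin (k + 1)) × ℝ × EuclideanSpace ℝ (Fin (n - k - 1)) → ℂ)
            = fun _ => 0 := rfl
        rw [h0, iteratedFDeriv_fun_zero]
        simp
      rw [this, mul_zero]
  add_mem' := by
    rintro φ ψ ⟨hφ, dφ, eφ⟩ ⟨hψ, dψ, eψ⟩
    refine ⟨?_, fun m i => ?_, fun θ s x'' => ?_⟩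
    · unfold IsSmoothParam
      rw [homExt_add]
      exact ContDiffOn.add hφ hψ
    · obtain ⟨C, hC⟩ := dφ m i
      obtain ⟨D, hD⟩ := dψ m i
      refine ⟨C + D, fun z => ?_⟩
      calc weight z ^ m * derivNorm (φ + ψ) i z
          ≤ weight z ^ m * (derivNorm φ i z + derivNorm ψ i z) :=
            mul_le_mul_of_nonneg_left (derivNorm_add_le hφ hψ i z) (pow_nonneg (weight_pos z).le m)
        _ ≤ C + D := by rw [mul_add]; exact add_le_add (hC z) (hD z)
    · simp only [Pi.add_apply]
      rw [eφ, eψ]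
  smul_mem' := by
    rintro c φ ⟨hφ, dφ, eφ⟩
    refine ⟨?_, fun m i => ?_, fun θ s x'' => ?_⟩
    · unfold IsSmoothParam
      rw [homExt_smul]
      exact ContDiffOn.const_smul c hφ
    · obtain ⟨C, hC⟩ := dφ m i
      refine ⟨‖c‖ * C, fun z => ?_⟩
      rw [derivNorm_smul c hφ, mul_left_comm]
      exact mul_le_mul_of_nonneg_left (hC z) (norm_nonneg c)
    · simp only [Pi.smul_apply]
      rw [eφ]

/-- The space `S_e(Z̃_{n,k})`. It is a type of its own, so that it does not inherit the topology of
pointwise convergence; its topology is defined below. -/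
def EvenSchwartz (n k : ℕ) : Type := evenSchwartzSubmodule n k

instance (n k : ℕ) : AddCommGroup (EvenSchwartz n k) :=
  inferInstanceAs (AddCommGroup (evenSchwartzSubmodule n k))

instance (n k : ℕ) : Module ℂ (EvenSchwartz n k) :=
  inferInstanceAs (Module ℂ (evenSchwartzSubmodule n k))

instance (n k : ℕ) : CoeFun (EvenSchwartz n k) (fun _ => ParamSpace n k → ℂ) :=
  ⟨fun φ => φ.1⟩

theorem EvenSchwartz.bddAbove {n k : ℕ} (φ : EvenSchwartz n k) (m : ℕ) :
    BddAbove (Set.range fun q : Fin (m + 1) × ParamSpace n k =>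
      weight q.2 ^ m * derivNorm φ q.1 q.2) := by
  have h : ∀ i : ℕ, ∃ C : ℝ, ∀ z, weight z ^ m * derivNorm φ i z ≤ C := φ.2.2.1 m
  choose C hC using h
  refine ⟨∑ i : Fin (m + 1), |C i|, ?_⟩
  rintro _ ⟨q, rfl⟩
  exact ((hC q.1 q.2).trans (le_abs_self _)).trans
    (Finset.single_le_sum (f := fun i : Fin (m + 1) => |C i|) (fun _ _ => abs_nonneg _)
      (Finset.mem_univ q.1))

/-- The norm `‖φ‖_m`: the supremum of `(1 + |s| + |x''|)^m |D^i φ (θ, s; x'')|` over all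
`(θ, s, x'')` and all orders `i ≤ m` of differentiation. -/
def evenSchwartzSeminorm (n k m : ℕ) : Seminorm ℂ (EvenSchwartz n k) :=
  Seminorm.of
    (fun φ => ⨆ q : Fin (m + 1) × ParamSpace n k, weight q.2 ^ m * derivNorm φ q.1 q.2)
    (by
      intro φ ψ
      have hne : Nonempty (Fin (m + 1) × ParamSpace n k) := by
        have : Nonempty (Metric.sphere (0 : EuclideanSpace ℝ (Fin (k + 1))) 1) :=
          (NormedSpace.sphere_nonempty.mpr zero_le_one).to_subtype
        infer_instance
      refine ciSup_le fun q => ?_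
      have h := derivNorm_add_le φ.2.1 ψ.2.1 q.1 q.2
      calc weight q.2 ^ m * derivNorm (φ + ψ : EvenSchwartz n k) q.1 q.2
          ≤ weight q.2 ^ m * (derivNorm φ q.1 q.2 + derivNorm ψ q.1 q.2) :=
            mul_le_mul_of_nonneg_left h (pow_nonneg (weight_pos q.2).le m)
        _ = weight q.2 ^ m * derivNorm φ q.1 q.2 + weight q.2 ^ m * derivNorm ψ q.1 q.2 := by ring
        _ ≤ _ := add_le_add (le_ciSup (φ.bddAbove m) q) (le_ciSup (ψ.bddAbove m) q))
    (by
      intro c φ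
      rw [Real.mul_iSup_of_nonneg (norm_nonneg c)]
      refine iSup_congr fun q => ?_
      have h := derivNorm_smul c φ.2.1 q.1 q.2
      calc weight q.2 ^ m * derivNorm (c • φ : EvenSchwartz n k) q.1 q.2
          = weight q.2 ^ m * (‖c‖ * derivNorm φ q.1 q.2) := congrArg _ h
        _ = _ := by ring)

/-- The sequence of norms that defines the topology of `S_e(Z̃_{n,k})`. -/
def evenSchwartzSeminormFamily (n k : ℕ) : SeminormFamily ℂ (EvenSchwartz n k) ℕ :=
  fun m => evenSchwartzSeminorm n k m

instance (n k : ℕ) : TopologicalSpace (EvenSchwartz n k) :=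
  (evenSchwartzSeminormFamily n k).moduleFilterBasis.topology'

theorem evenSchwartz_withSeminorms (n k : ℕ) :
    WithSeminorms (evenSchwartzSeminormFamily n k) := ⟨rfl⟩

/-- The moment condition: for every `m` there are coefficients `c_α ∈ S(ℝ^{n-k-1})`, `|α| = m`, with
`∫ φ (θ, s; x'') s^m ds = ∑_{|α| = m} c_α(x'') θ^α`. -/
def MomentCondition {n k : ℕ} (φ : ParamSpace n k → ℂ) : Prop :=
  ∀ m : ℕ, ∃ c : (Fin (k + 1) → ℕ) → 𝓢(EuclideanSpace ℝ (Fin (n - k - 1)), ℂ),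
    ∀ (θ : Metric.sphere (0 : EuclideanSpace ℝ (Fin (k + 1))) 1)
      (x'' : EuclideanSpace ℝ (Fin (n - k - 1))),
      ∫ s : ℝ, φ (θ, s, x'') * (s : ℂ) ^ m =
        ∑ α ∈ Finset.piAntidiag (Finset.univ : Finset (Fin (k + 1))) m,
          c α x'' * ∏ i, (((θ : EuclideanSpace ℝ (Fin (k + 1))) i : ℝ) : ℂ) ^ α i

/-! Auxiliary facts: the moments converge absolutely, and the moment condition is linear. -/

theorem homExt_apply {n k : ℕ} (φ : ParamSpace n k → ℂ) (z : ParamSpace n k) :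
    homExt φ ((z.1 : EuclideanSpace ℝ (Fin (k + 1))), z.2) = φ z := by
  have h1 : ‖(z.1 : EuclideanSpace ℝ (Fin (k + 1)))‖ = 1 := norm_eq_of_mem_sphere z.1
  have hz : (z.1 : EuclideanSpace ℝ (Fin (k + 1))) ≠ 0 := by
    intro h0
    rw [h0] at h1
    simp at h1
  simp [homExt, hz]

theorem EvenSchwartz.moment_integrable {n k : ℕ} (φ : EvenSchwartz n k) (m : ℕ)
    (θ : Metric.sphere (0 : EuclideanSpace ℝ (Fin (k + 1))) 1)
    (x'' : EuclideanSpace ℝ (Fin (n - k - 1))) :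
    Integrable fun s : ℝ => φ (θ, s, x'') * (s : ℂ) ^ m := by
  have hcont : Continuous fun s : ℝ => φ (θ, s, x'') := by
    rw [continuous_iff_continuousAt]
    intro s
    have h := (φ.2.1.contDiffAt 0 (θ, s, x'')).continuousAt
    have hi : Continuous fun t : ℝ => ((θ : EuclideanSpace ℝ (Fin (k + 1))), t, x'') := by
      fun_prop
    have h2 := ContinuousAt.comp (f := fun t : ℝ =>
      ((θ : EuclideanSpace ℝ (Fin (k + 1))), t, x'')) (x := s) h hi.continuousAt
    refine h2.congr (Filter.Eventually.of_forall fun t => ?_)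
    exact homExt_apply φ (θ, t, x'')
  obtain ⟨C, hC⟩ := φ.2.2.1 (m + 2) 0
  refine Integrable.mono' (integrable_inv_one_add_sq.const_mul C)
    (hcont.mul ((Complex.continuous_ofReal).pow m)).aestronglyMeasurable
    (Filter.Eventually.of_forall fun s => ?_)
  have h := hC (θ, s, x'')
  unfold derivNorm at h
  rw [norm_iteratedFDeriv_zero, homExt_apply] at h
  have hw : weight ((θ, s, x'') : ParamSpace n k) = 1 + |s| + ‖x''‖ := rfl
  rw [hw] at h
  have hs := abs_nonneg s
  have hx := norm_nonneg x''
  have h1 : |s| ^ m * (1 + s ^ 2) ≤ (1 + |s| + ‖x''‖) ^ (m + 2) := by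
    rw [pow_add]
    refine mul_le_mul (pow_le_pow_left₀ hs (by linarith) m) ?_ (by positivity) (by positivity)
    rw [← sq_abs s]
    nlinarith
  rw [norm_mul, norm_pow, Complex.norm_real, Real.norm_eq_abs, ← div_eq_mul_inv,
    le_div_iff₀ (by positivity)]
  calc ‖φ (θ, s, x'')‖ * |s| ^ m * (1 + s ^ 2)
      = |s| ^ m * (1 + s ^ 2) * ‖φ (θ, s, x'')‖ := by ring
    _ ≤ (1 + |s| + ‖x''‖) ^ (m + 2) * ‖φ (θ, s, x'')‖ :=
        mul_le_mul_of_nonneg_right h1 (norm_nonneg _)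
    _ ≤ C := h

/-- The space `S_H(Z̃_{n,k})`: the functions in `S_e(Z̃_{n,k})` that satisfy the moment condition.
As a subspace of `S_e(Z̃_{n,k})` it carries the induced topology. -/
def momentSubspace (n k : ℕ) : Submodule ℂ (EvenSchwartz n k) where
  carrier := {φ | MomentCondition φ}
  zero_mem' := by
    intro m
    refine ⟨0, fun θ x'' => ?_⟩
    have h : ∀ s : ℝ, (0 : EvenSchwartz n k) (θ, s, x'') = 0 := fun _ => rfl
    simp [h]
  add_mem' := by
    intro φ ψ hφ hψ m
    obtain ⟨c, hc⟩ := hφ m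
    obtain ⟨d, hd⟩ := hψ m
    refine ⟨c + d, fun θ x'' => ?_⟩
    have h : ∀ s : ℝ, (φ + ψ : EvenSchwartz n k) (θ, s, x'') * (s : ℂ) ^ m =
        φ (θ, s, x'') * (s : ℂ) ^ m + ψ (θ, s, x'') * (s : ℂ) ^ m := fun _ => add_mul _ _ _
    simp_rw [h]
    rw [integral_add (φ.moment_integrable m θ x'') (ψ.moment_integrable m θ x''), hc, hd,
      ← Finset.sum_add_distrib]
    exact Finset.sum_congr rfl fun α _ => (add_mul _ _ _).symm
  smul_mem' := by
    intro a φ hφ m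
    obtain ⟨c, hc⟩ := hφ m
    refine ⟨a • c, fun θ x'' => ?_⟩
    have h : ∀ s : ℝ, (a • φ : EvenSchwartz n k) (θ, s, x'') * (s : ℂ) ^ m =
        a * (φ (θ, s, x'') * (s : ℂ) ^ m) := fun _ => mul_assoc _ _ _
    simp_rw [h]
    rw [integral_const_mul, hc, Finset.mul_sum]
    exact Finset.sum_congr rfl fun α _ => (mul_assoc _ _ _).symm

end

/-! Fubini in orthonormal coordinates adapted to `θ` gives the projection-slice identity
(`fourier_sliceIntegral`): the Fourier transform in `s` of the plane integrals, taken at `σ`, is the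
Fourier transform of `f` in `x'` at `ξ = σ θ`. The transform is therefore a composite of three maps:
the Fourier transform in `x'`, the pullback along `(θ, σ) ↦ σ θ`, and the inverse Fourier transform
in `s`. Each is continuous on Schwartz spaces (`kPlaneLift`); a cutoff near the sphere lets
functions of `θ` be treated as Schwartz functions on the ambient space. The moment condition holds
because the moment of order `m` is the integral of `⟪θ, x'⟫ ^ m f`, which is polynomial in `θ`.

Conversely, let `g` satisfy the moment condition and put `F_g(ξ, η) = (𝓕 g)((ξ / |ξ|, η), |ξ|)`,
with `𝓕` acting in `s`. The only difficulty is smoothness at `ξ = 0`. No Taylor expansion is used.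
Away from `ξ = 0` the chain rule gives `∂_v F_g = F_{D_v g}` (`polarInverseLM_fderiv`), where `D_v
g` is `2πi (I ∂_θ g - ⟪θ, v⟫ s g)` plus the derivative of `g` in `η`. Here `∂_θ` is the angular
derivative in the direction `v`, and `I` is the primitive in `s`, which absorbs the division by
`|ξ|`.

This works for three reasons. The moment of order zero does not depend on `θ`, so `∂_θ g` has mean
zero in `s` and `I ∂_θ g` is again Schwartz (`norm_schwartzPrimitive_le`,
`sphereDeriv_mem_zeroMeanSubmodule`). The operator `D_v` preserves the moment condition
(`polarLiftAux_mem`). Finally `F_g` and all `F_{D_v g}` are continuous, so the derivative formula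
extends across `ξ = 0` (`hasFDerivAt_of_fderiv_extends`). Iteration gives smoothness of every order,
and `exists_clm_schwartz_of_fderiv_lift` turns this, together with weighted sup bounds, into a
continuous operator `polarInverse`.

Evenness extends `F_g(σ θ) = (𝓕 g)(θ, σ)` to negative `σ` (`polarInverse_smul`), so that undoing the
Fourier transform in `x'` gives a two-sided continuous inverse. -/

open MeasureTheory
open scoped ContDiff SchwartzMap

noncomputable section

/-! ### Criteria for continuous linear maps into the Schwartz space -/

section SchwartzTarget

variable {X E : Type*} [AddCommGroup X] [Module ℂ X] [TopologicalSpace X]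
  [NormedAddCommGroup E] [NormedSpace ℝ E]

/-- A linear map into functions whose iterated derivatives satisfy weighted seminorm bounds is a
continuous linear map into the Schwartz space. -/
theorem exists_clm_schwartz_of_bound [IsTopologicalAddGroup X] (T : X →ₗ[ℂ] (E → ℂ))
    (hs : ∀ x, ContDiff ℝ ∞ (T x))
    (hb : ∀ k n : ℕ, ∃ q : Seminorm ℂ X, Continuous q ∧
      ∀ x e, ‖e‖ ^ k * ‖iteratedFDeriv ℝ n (T x) e‖ ≤ q x) :
    ∃ S : X →L[ℂ] 𝓢(E, ℂ), ∀ x e, S x e = T x e := by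
  let S₀ : X →ₗ[ℂ] 𝓢(E, ℂ) :=
    { toFun := fun x =>
        { toFun := T x
          smooth' := hs x
          decay' := fun k n => by
            obtain ⟨q, -, h⟩ := hb k n
            exact ⟨q x, h x⟩ }
      map_add' := fun x y => by
        ext e
        change T (x + y) e = T x e + T y e
        rw [map_add]
        rfl
      map_smul' := fun c x => by
        ext e
        change T (c • x) e = c • T x e
        rw [map_smul]
        rfl }
  refine ⟨⟨S₀, (schwartz_withSeminorms ℂ E ℂ).continuous_of_continuous_comp S₀ fun i => ?_⟩,
    fun x e => rfl⟩
  obtain ⟨q, hq, h⟩ := hb i.1 i.2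
  refine Seminorm.continuous_of_le hq fun x => ?_
  exact SchwartzMap.seminorm_le_bound ℂ i.1 i.2 (S₀ x) (apply_nonneg q x) (h x)

theorem norm_le_sum_abs_coord {ι : Type*} [Fintype ι] (b : Module.Basis ι ℝ E) (v : E) :
    ‖v‖ ≤ ∑ i, ‖b i‖ * |b.coord i v| := by
  conv_lhs => rw [← b.sum_repr v]
  refine (norm_sum_le _ _).trans (Finset.sum_le_sum fun i _ => ?_)
  rw [norm_smul, mul_comm]
  rfl

variable [FiniteDimensional ℝ E]

/-- Written this way, a derivative is a finite sum of fixed continuous linear maps applied to scalar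
functions, so its regularity and size reduce to those of the scalar functions. -/
theorem fderiv_eq_sum_of_forall_apply {ι : Type*} [Fintype ι] (b : Module.Basis ι ℝ E)
    {L : E →L[ℝ] ℂ} {c : ι → ℂ} (h : ∀ i, L (b i) = c i) :
    L = ∑ i, ContinuousLinearMap.smulRightL ℝ E ℂ (LinearMap.toContinuousLinearMap (b.coord i))
      (c i) := by
  ext v
  conv_lhs => rw [← b.sum_repr v, map_sum]
  simp [h, sum_apply, -Module.Basis.sum_repr]

/-- Polynomial weights can be absorbed if multiplication by coordinates lifts to the source. -/
theorem weighted_bound_of_coord_mul (T : X →ₗ[ℂ] (E → ℂ))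
    (hM : ∀ ℓ : E →L[ℝ] ℝ, ∃ M : X →L[ℂ] X, ∀ x e, T (M x) e = (ℓ e : ℂ) * T x e)
    (hb : ∃ q : Seminorm ℂ X, Continuous q ∧ ∀ x e, ‖T x e‖ ≤ q x) (k : ℕ) :
    ∃ q : Seminorm ℂ X, Continuous q ∧ ∀ x e, ‖e‖ ^ k * ‖T x e‖ ≤ q x := by
  induction k with
  | zero => simpa using hb
  | succ k ih =>
    obtain ⟨q, hq, hqb⟩ := ih
    let b := Module.finBasis ℝ E
    choose M hM using fun i => hM (LinearMap.toContinuousLinearMap (b.coord i))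
    refine ⟨∑ i, ‖b i‖₊ • q.comp (M i : X →ₗ[ℂ] X), ?_, fun x e => ?_⟩
    · have : ⇑(∑ i, ‖b i‖₊ • q.comp (M i : X →ₗ[ℂ] X)) = fun x => ∑ i, ‖b i‖ * q (M i x) := by
        ext x
        rw [sum_apply]
        rfl
      rw [this]
      exact continuous_finsetSum _ fun i _ => (hq.comp (M i).continuous).const_mul _
    · rw [sum_apply]
      calc ‖e‖ ^ (k + 1) * ‖T x e‖ = ‖e‖ * (‖e‖ ^ k * ‖T x e‖) := by ring
        _ ≤ (∑ i, ‖b i‖ * |b.coord i e|) * (‖e‖ ^ k * ‖T x e‖) := by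
          gcongr
          exact norm_le_sum_abs_coord b e
        _ = ∑ i, ‖b i‖ * (‖e‖ ^ k * ‖T (M i x) e‖) := by
          rw [Finset.sum_mul]
          refine Finset.sum_congr rfl fun i _ => ?_
          rw [hM]
          simp only [LinearMap.coe_toContinuousLinearMap', norm_mul, Complex.norm_real,
            Real.norm_eq_abs]
          ring
        _ ≤ ∑ i, ‖b i‖ * q (M i x) := by
          gcongr
          exact hqb _ _
        _ = _ := rfl

/-- Every directional derivative of a function in the range of `T` lies in the range again, so
differentiability of all of them bootstraps. The induction hypothesis has to cover all `x` at once.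
-/
theorem contDiff_of_fderiv_lift (T : X →ₗ[ℂ] (E → ℂ)) (D : E → X →L[ℂ] X)
    (hd : ∀ x, Differentiable ℝ (T x)) (hD : ∀ x e v, fderiv ℝ (T x) e v = T (D v x) e)
    (n : ℕ) : ∀ x, ContDiff ℝ n (T x) := by
  let b := Module.finBasis ℝ E
  induction n with
  | zero => exact fun x => contDiff_zero.2 (hd x).continuous
  | succ n ih =>
    intro x
    have : fderiv ℝ (T x) = fun e => ∑ i, ContinuousLinearMap.smulRightL ℝ E ℂ
        (LinearMap.toContinuousLinearMap (b.coord i)) (T (D (b i) x) e) :=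
      funext fun e => fderiv_eq_sum_of_forall_apply b fun i => hD x e (b i)
    rw [show ((n + 1 : ℕ) : ℕ∞ω) = (n : ℕ∞ω) + 1 by push_cast; rfl, contDiff_succ_iff_fderiv, this]
    exact ⟨hd x, by simp, ContDiff.sum fun i _ => (ContinuousLinearMap.contDiff _).comp (ih _)⟩

/-- A derivative of order `n + 1` of `T x` is built from derivatives of order `n` of the functions
`T (D (b i) x)`; the new seminorm is a combination of pullbacks of the old one under the continuous
maps `D (b i)`. -/
theorem iteratedFDeriv_bound_of_fderiv_lift (T : X →ₗ[ℂ] (E → ℂ)) (D : E → X →L[ℂ] X)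
    (hd : ∀ x, Differentiable ℝ (T x)) (hD : ∀ x e v, fderiv ℝ (T x) e v = T (D v x) e)
    (hb : ∀ k : ℕ, ∃ q : Seminorm ℂ X, Continuous q ∧ ∀ x e, ‖e‖ ^ k * ‖T x e‖ ≤ q x)
    (k n : ℕ) :
    ∃ q : Seminorm ℂ X, Continuous q ∧
      ∀ x e, ‖e‖ ^ k * ‖iteratedFDeriv ℝ n (T x) e‖ ≤ q x := by
  let b := Module.finBasis ℝ E
  induction n with
  | zero => simpa using hb k
  | succ n ih =>
    obtain ⟨q, hq, hqb⟩ := ih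
    let R := fun i => ContinuousLinearMap.smulRightL ℝ E ℂ
        (LinearMap.toContinuousLinearMap (b.coord i))
    refine ⟨∑ i, ‖R i‖₊ • q.comp (D (b i) : X →ₗ[ℂ] X), ?_, fun x e => ?_⟩
    · have : ⇑(∑ i, ‖R i‖₊ • q.comp (D (b i) : X →ₗ[ℂ] X)) =
          fun x => ∑ i, ‖R i‖ * q (D (b i) x) := by
        ext x
        rw [sum_apply]
        rfl
      rw [this]
      exact continuous_finsetSum _ fun i _ => (hq.comp (D (b i)).continuous).const_mul _
    · have hT : fderiv ℝ (T x) = fun e => ∑ i, R i (T (D (b i) x) e) :=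
        funext fun e => fderiv_eq_sum_of_forall_apply b fun i => hD x e (b i)
      have hcd : ∀ i, ContDiff ℝ n (T (D (b i) x)) :=
        fun i => contDiff_of_fderiv_lift T D hd hD n _
      have hsum := iteratedFDeriv_fun_sum_apply (u := Finset.univ) (x := e)
        fun i _ => ((R i).contDiff.comp (hcd i)).contDiffAt
      rw [← norm_iteratedFDeriv_fderiv, hT, sum_apply]
      refine (congrArg (fun L => ‖e‖ ^ k * ‖L‖) hsum).le.trans ?_
      calc ‖e‖ ^ k * ‖∑ i, iteratedFDeriv ℝ n (R i ∘ T (D (b i) x)) e‖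
          ≤ ‖e‖ ^ k * ∑ i, ‖R i‖ * ‖iteratedFDeriv ℝ n (T (D (b i) x)) e‖ := by
            gcongr
            refine (norm_sum_le _ _).trans (Finset.sum_le_sum fun i _ => ?_)
            exact (R i).norm_iteratedFDeriv_comp_left (hcd i).contDiffAt le_rfl
        _ = ∑ i, ‖R i‖ * (‖e‖ ^ k * ‖iteratedFDeriv ℝ n (T (D (b i) x)) e‖) := by
            rw [Finset.mul_sum]
            exact Finset.sum_congr rfl fun i _ => by ring
        _ ≤ ∑ i, ‖R i‖ * q (D (b i) x) := by
            gcongr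
            exact hqb _ _
        _ = _ := rfl

/-- The criterion behind the partial Fourier transform, the primitive and the polar inverse: once
derivatives lift to the source, only weighted bounds of order zero remain to be checked. -/
theorem exists_clm_schwartz_of_fderiv_lift [IsTopologicalAddGroup X]
    (T : X →ₗ[ℂ] (E → ℂ)) (D : E → X →L[ℂ] X)
    (hd : ∀ x, Differentiable ℝ (T x)) (hD : ∀ x e v, fderiv ℝ (T x) e v = T (D v x) e)
    (hb : ∀ k : ℕ, ∃ q : Seminorm ℂ X, Continuous q ∧ ∀ x e, ‖e‖ ^ k * ‖T x e‖ ≤ q x) :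
    ∃ S : X →L[ℂ] 𝓢(E, ℂ), ∀ x e, S x e = T x e :=
  exists_clm_schwartz_of_bound T
    (fun x => contDiff_infty.2 fun n => contDiff_of_fderiv_lift T D hd hD n x)
    (iteratedFDeriv_bound_of_fderiv_lift T D hd hD hb)

end SchwartzTarget

/-- A shortcut instance: without it the operator norm on `A × B →L[ℝ] F` is not found when `B` is
an inner product space. -/
local instance (priority := 5000) InnerProductSpace.toRealNormedSpace {B : Type*}
    [NormedAddCommGroup B] [InnerProductSpace ℝ B] : NormedSpace ℝ B := InnerProductSpace.toNormedSpace

/-! ### The partial Fourier transform on Schwartz functions of two variables -/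

section PartialFourier

open FourierTransform Real LineDeriv

variable {A B : Type*} [NormedAddCommGroup A] [NormedSpace ℝ A]
  [NormedAddCommGroup B]

section Slice

variable [NormedSpace ℝ B]

theorem hasTemperateGrowth_const_prodMk (a : A) :
    Function.HasTemperateGrowth fun b : B => (a, b) := by
  have : (fun b : B => (a, b)) =
      fun b => ((a, 0) : A × B) + ContinuousLinearMap.inr ℝ A B b := by
    ext b <;> simp
  rw [this]
  exact (Function.HasTemperateGrowth.const _).add (ContinuousLinearMap.hasTemperateGrowth _)

/-- The restriction of a Schwartz function on `A × B` to `{a} × B`. -/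
def schwartzSlice (a : A) : 𝓢(A × B, ℂ) →L[ℂ] 𝓢(B, ℂ) :=
  SchwartzMap.compCLM ℂ (hasTemperateGrowth_const_prodMk a)
    ⟨1, 1, fun b => by
      have : ‖b‖ ≤ ‖(a, b)‖ := le_max_right _ _
      simp only [pow_one, one_mul]
      linarith⟩

theorem schwartzSlice_apply (a : A) (f : 𝓢(A × B, ℂ)) (b : B) :
    schwartzSlice a f b = f (a, b) := rfl

theorem schwartzSlice_lineDeriv (a : A) (f : 𝓢(A × B, ℂ)) (v : B) :
    schwartzSlice a (∂_{((0, v) : A × B)} f) = ∂_{v} (schwartzSlice a f) := by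
  ext b
  rw [schwartzSlice_apply, SchwartzMap.lineDerivOp_apply_eq_fderiv,
    SchwartzMap.lineDerivOp_apply_eq_fderiv]
  have h : HasFDerivAt (fun b : B => f (a, b))
      ((fderiv ℝ f (a, b)).comp (ContinuousLinearMap.inr ℝ A B)) b :=
    (f.hasFDerivAt (a, b)).comp b (hasFDerivAt_prodMk_right a b)
  exact (congrArg (fun L => L v) h.fderiv.symm)

end Slice

variable [InnerProductSpace ℝ B] [FiniteDimensional ℝ B] [MeasurableSpace B] [BorelSpace B]

/-- The integrand of the partial Fourier transform. -/
def partialFourierKernel (f : A × B → ℂ) (p : A × B) (y : B) : ℂ :=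
  Complex.exp (-(2 * π * inner ℝ y p.2 : ℝ) * Complex.I) * f (p.1, y)

theorem fourier_slice_eq_integral (f : 𝓢(A × B, ℂ)) (p : A × B) :
    𝓕 (schwartzSlice p.1 f) p.2 = ∫ y, partialFourierKernel f p y := by
  rw [SchwartzMap.fourier_coe, Real.fourier_eq']
  refine integral_congr_ae (Filter.Eventually.of_forall fun y => ?_)
  simp [partialFourierKernel, schwartzSlice_apply]

omit [NormedAddCommGroup A] [NormedSpace ℝ A] [FiniteDimensional ℝ B] [MeasurableSpace B]
  [BorelSpace B] in
theorem norm_partialFourierKernel (f : A × B → ℂ) (p : A × B) (y : B) :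
    ‖partialFourierKernel f p y‖ = ‖f (p.1, y)‖ := by
  rw [partialFourierKernel, norm_mul, ← Complex.ofReal_neg, Complex.norm_exp_ofReal_mul_I, one_mul]

/-- The derivative of the integrand with respect to the parameters. -/
def partialFourierKernelDeriv (f : A × B → ℂ) (p : A × B) (y : B) : A × B →L[ℝ] ℂ :=
  Complex.exp (-(2 * π * inner ℝ y p.2 : ℝ) * Complex.I) •
    ((fderiv ℝ f (p.1, y)).comp
      ((ContinuousLinearMap.inl ℝ A B).comp (ContinuousLinearMap.fst ℝ A B))) +
  (partialFourierKernel f p y * (-(2 * π : ℝ) * Complex.I)) •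
    (Complex.ofRealCLM.comp ((innerSL ℝ y).comp (ContinuousLinearMap.snd ℝ A B)))

omit [FiniteDimensional ℝ B] [MeasurableSpace B] [BorelSpace B] in
theorem hasFDerivAt_partialFourierKernel (f : 𝓢(A × B, ℂ)) (p : A × B) (y : B) :
    HasFDerivAt (fun p => partialFourierKernel f p y) (partialFourierKernelDeriv f p y) p := by
  have h1 : HasFDerivAt (fun p : A × B => f (p.1, y))
      ((fderiv ℝ f (p.1, y)).comp
        ((ContinuousLinearMap.inl ℝ A B).comp (ContinuousLinearMap.fst ℝ A B))) p := by
    have := ((f.hasFDerivAt (p.1, y)).comp p.1 (hasFDerivAt_prodMk_left p.1 y)).comp p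
      (hasFDerivAt_fst (𝕜 := ℝ) (E := A) (F := B))
    exact this
  have h2 : HasFDerivAt (fun p : A × B => (inner ℝ y p.2 : ℝ))
      ((innerSL ℝ y).comp (ContinuousLinearMap.snd ℝ A B)) p :=
    ((innerSL ℝ y).comp (ContinuousLinearMap.snd ℝ A B)).hasFDerivAt
  have h3 : HasFDerivAt (fun p : A × B => -(2 * π * inner ℝ y p.2 : ℝ) * Complex.I)
      ((-(2 * π : ℝ) * Complex.I) • Complex.ofRealCLM.comp
        ((innerSL ℝ y).comp (ContinuousLinearMap.snd ℝ A B))) p := by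
    have := (Complex.ofRealCLM.hasFDerivAt.comp p h2).const_mul (-(2 * π : ℝ) * Complex.I)
    refine this.congr_of_eventuallyEq (Filter.Eventually.of_forall fun q => ?_)
    simp
    ring
  refine (h3.cexp.mul h1).congr_fderiv (ContinuousLinearMap.ext fun v => ?_)
  change Complex.exp (-(2 * π * inner ℝ y p.2 : ℝ) * Complex.I) * fderiv ℝ f (p.1, y) (v.1, 0) +
      f (p.1, y) * (Complex.exp (-(2 * π * inner ℝ y p.2 : ℝ) * Complex.I) *
        ((-(2 * π : ℝ) * Complex.I) * (inner ℝ y v.2 : ℝ))) =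
    Complex.exp (-(2 * π * inner ℝ y p.2 : ℝ) * Complex.I) * fderiv ℝ f (p.1, y) (v.1, 0) +
      Complex.exp (-(2 * π * inner ℝ y p.2 : ℝ) * Complex.I) * f (p.1, y) *
        (-(2 * π : ℝ) * Complex.I) * (inner ℝ y v.2 : ℝ)
  ring

omit [FiniteDimensional ℝ B] [MeasurableSpace B] [BorelSpace B] in
theorem norm_partialFourierKernelDeriv_le (f : A × B → ℂ) (p : A × B) (y : B) :
    ‖partialFourierKernelDeriv f p y‖ ≤
      ‖fderiv ℝ f (p.1, y)‖ + 2 * π * (‖y‖ * ‖f (p.1, y)‖) := by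
  refine ContinuousLinearMap.opNorm_le_bound _ (by positivity) fun v => ?_
  have hv1 : ‖((v.1, 0) : A × B)‖ ≤ ‖v‖ := by
    simp [Prod.norm_def]
  have hv2 : ‖v.2‖ ≤ ‖v‖ := le_max_right _ _
  have he : ‖Complex.exp (-(2 * π * inner ℝ y p.2 : ℝ) * Complex.I)‖ = 1 := by
    rw [← Complex.ofReal_neg, Complex.norm_exp_ofReal_mul_I]
  have hk := norm_partialFourierKernel f p y
  have hi := abs_real_inner_le_norm y v.2
  calc ‖partialFourierKernelDeriv f p y v‖
      = ‖Complex.exp (-(2 * π * inner ℝ y p.2 : ℝ) * Complex.I) * fderiv ℝ f (p.1, y) (v.1, 0) +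
        partialFourierKernel f p y * (-(2 * π : ℝ) * Complex.I) * (inner ℝ y v.2 : ℝ)‖ := rfl
    _ ≤ ‖fderiv ℝ f (p.1, y) (v.1, 0)‖ + ‖f (p.1, y)‖ * (2 * π) * |inner ℝ y v.2| := by
      refine (norm_add_le _ _).trans (le_of_eq ?_)
      rw [norm_mul, he, one_mul, norm_mul, norm_mul, hk, norm_mul, norm_neg, Complex.norm_I,
        Complex.norm_real, Complex.norm_real, Real.norm_eq_abs, Real.norm_eq_abs,
        abs_of_pos (by positivity : (0 : ℝ) < 2 * π), mul_one]
    _ ≤ ‖fderiv ℝ f (p.1, y)‖ * ‖v‖ + ‖f (p.1, y)‖ * (2 * π) * (‖y‖ * ‖v‖) := by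
      gcongr
      · exact ((fderiv ℝ f (p.1, y)).le_opNorm _).trans (by gcongr)
      · exact hi.trans (by gcongr)
    _ = _ := by ring

omit [FiniteDimensional ℝ B] [MeasurableSpace B] [BorelSpace B] in
theorem continuous_partialFourierKernel (f : 𝓢(A × B, ℂ)) (p : A × B) :
    Continuous (partialFourierKernel f p) := by
  unfold partialFourierKernel
  fun_prop

omit [FiniteDimensional ℝ B] [MeasurableSpace B] [BorelSpace B] in
theorem continuous_partialFourierKernelDeriv (f : 𝓢(A × B, ℂ)) (p : A × B) :
    Continuous (partialFourierKernelDeriv f p) := by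
  have h1 : Continuous fun y => fderiv ℝ f (p.1, y) :=
    (SchwartzMap.fderivCLM ℝ (A × B) ℂ f).continuous.comp (by fun_prop)
  have h2 := continuous_partialFourierKernel f p
  have h3 : Continuous fun y : B => Complex.exp (-(2 * π * inner ℝ y p.2 : ℝ) * Complex.I) := by
    fun_prop
  unfold partialFourierKernelDeriv
  refine (h3.smul (h1.clm_comp continuous_const)).add
    ((h2.mul continuous_const).smul (continuous_const.clm_comp ?_))
  exact (innerSL ℝ).continuous.clm_comp continuous_const

variable {F : Type*} [NormedAddCommGroup F] [NormedSpace ℝ F]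

omit [FiniteDimensional ℝ B] [MeasurableSpace B] [BorelSpace B] in
/-- Uniform decay in the second variable. -/
theorem schwartz_snd_decay (f : 𝓢(A × B, F)) (k l : ℕ) (a : A) (y : B) :
    ‖y‖ ^ k * ‖f (a, y)‖ ≤ 2 ^ l * (SchwartzMap.seminorm ℝ 0 0 f + SchwartzMap.seminorm ℝ (k + l) 0 f) *
      (1 + ‖y‖) ^ (-(l : ℝ)) := by
  refine pow_mul_le_of_le_of_pow_mul_le (norm_nonneg _) (norm_nonneg _)
    (SchwartzMap.norm_le_seminorm ℝ f _) ?_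
  refine le_trans ?_ (SchwartzMap.norm_pow_mul_le_seminorm ℝ f (k + l) (a, y))
  gcongr
  exact le_max_right _ _

theorem integrable_partialFourierKernel (f : 𝓢(A × B, ℂ)) (p : A × B) :
    Integrable (partialFourierKernel f p) := by
  let l := (volume : Measure B).integrablePower
  refine Integrable.mono' ((Measure.integrable_pow_neg_integrablePower (volume : Measure B)).const_mul
    (2 ^ l * (SchwartzMap.seminorm ℝ 0 0 f + SchwartzMap.seminorm ℝ (0 + l) 0 f)))
    (continuous_partialFourierKernel f p).aestronglyMeasurable
    (Filter.Eventually.of_forall fun y => ?_)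
  rw [norm_partialFourierKernel]
  simpa using schwartz_snd_decay f 0 l p.1 y

/-- An integrable majorant of the derivative of the integrand. -/
def partialFourierMajorant (f : 𝓢(A × B, ℂ)) (y : B) : ℝ :=
  let l := (volume : Measure B).integrablePower
  (2 ^ l * (SchwartzMap.seminorm ℝ 0 0 (SchwartzMap.fderivCLM ℝ (A × B) ℂ f) +
      SchwartzMap.seminorm ℝ (0 + l) 0 (SchwartzMap.fderivCLM ℝ (A × B) ℂ f)) +
    2 * π * (2 ^ l * (SchwartzMap.seminorm ℝ 0 0 f + SchwartzMap.seminorm ℝ (1 + l) 0 f))) *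
    (1 + ‖y‖) ^ (-(l : ℝ))

theorem integrable_partialFourierMajorant (f : 𝓢(A × B, ℂ)) :
    Integrable (partialFourierMajorant f) :=
  (Measure.integrable_pow_neg_integrablePower (volume : Measure B)).const_mul _

theorem norm_partialFourierKernelDeriv_le_majorant (f : 𝓢(A × B, ℂ)) (p : A × B) (y : B) :
    ‖partialFourierKernelDeriv f p y‖ ≤ partialFourierMajorant f y := by
  let l := (volume : Measure B).integrablePower
  refine (norm_partialFourierKernelDeriv_le f p y).trans ?_
  have h1 := schwartz_snd_decay (SchwartzMap.fderivCLM ℝ (A × B) ℂ f) 0 l p.1 y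
  have h2 := schwartz_snd_decay f 1 l p.1 y
  rw [pow_zero, one_mul, SchwartzMap.fderivCLM_apply] at h1
  rw [pow_one] at h2
  unfold partialFourierMajorant
  rw [add_mul, mul_assoc (2 * π)]
  gcongr

theorem hasFDerivAt_fourier_slice (f : 𝓢(A × B, ℂ)) (p : A × B) :
    HasFDerivAt (fun p : A × B => 𝓕 (schwartzSlice p.1 f) p.2)
      (∫ y, partialFourierKernelDeriv f p y) p := by
  simp_rw [fourier_slice_eq_integral]
  -- The majorant does not depend on the parameter, so the whole space serves as the neighbourhood.
  exact hasFDerivAt_integral_of_dominated_of_fderiv_le Filter.univ_mem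
    (Filter.Eventually.of_forall fun q => (continuous_partialFourierKernel f q).aestronglyMeasurable)
    (integrable_partialFourierKernel f p)
    (continuous_partialFourierKernelDeriv f p).aestronglyMeasurable
    (Filter.Eventually.of_forall fun y q _ => norm_partialFourierKernelDeriv_le_majorant f q y)
    (integrable_partialFourierMajorant f)
    (Filter.Eventually.of_forall fun y q _ => hasFDerivAt_partialFourierKernel f q y)

theorem integrable_partialFourierKernelDeriv (f : 𝓢(A × B, ℂ)) (p : A × B) :
    Integrable (partialFourierKernelDeriv f p) :=
  (integrable_partialFourierMajorant f).mono'
    (continuous_partialFourierKernelDeriv f p).aestronglyMeasurable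
    (Filter.Eventually.of_forall fun y => norm_partialFourierKernelDeriv_le_majorant f p y)

omit [FiniteDimensional ℝ B] [MeasurableSpace B] [BorelSpace B] in
variable (A) in
theorem hasTemperateGrowth_inner_snd (v : B) :
    Function.HasTemperateGrowth fun q : A × B =>
      -(2 * π : ℝ) * Complex.I * ((inner ℝ q.2 v : ℝ) : ℂ) := by
  have : (fun q : A × B => -(2 * π : ℝ) * Complex.I * ((inner ℝ q.2 v : ℝ) : ℂ)) =
      fun q => ((-(2 * π : ℝ) * Complex.I) • (Complex.ofRealCLM.comp
        ((innerSL ℝ v).comp (ContinuousLinearMap.snd ℝ A B)))) q := by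
    ext q
    simp [real_inner_comm]
  rw [this]
  exact ContinuousLinearMap.hasTemperateGrowth _

/-- The operator that corresponds, under the partial Fourier transform, to the derivative in the
direction `v`. -/
def partialFourierDeriv (v : A × B) : 𝓢(A × B, ℂ) →L[ℂ] 𝓢(A × B, ℂ) :=
  lineDerivOpCLM ℂ 𝓢(A × B, ℂ) ((v.1, 0) : A × B) +
    SchwartzMap.smulLeftCLM (𝕜 := ℂ) ℂ fun q : A × B =>
      -(2 * π : ℝ) * Complex.I * ((inner ℝ q.2 v.2 : ℝ) : ℂ)

omit [FiniteDimensional ℝ B] [MeasurableSpace B] [BorelSpace B] in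
theorem partialFourierDeriv_apply (v : A × B) (f : 𝓢(A × B, ℂ)) (q : A × B) :
    partialFourierDeriv v f q = fderiv ℝ f q (v.1, 0) +
      -(2 * π : ℝ) * Complex.I * ((inner ℝ q.2 v.2 : ℝ) : ℂ) * f q := by
  change (∂_{((v.1, 0) : A × B)} f) q + SchwartzMap.smulLeftCLM (𝕜 := ℂ) ℂ _ f q = _
  rw [SchwartzMap.lineDerivOp_apply_eq_fderiv,
    SchwartzMap.smulLeftCLM_apply_apply (hasTemperateGrowth_inner_snd A v.2)]
  rfl

theorem fderiv_fourier_slice (f : 𝓢(A × B, ℂ)) (p v : A × B) :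
    fderiv ℝ (fun p : A × B => 𝓕 (schwartzSlice p.1 f) p.2) p v =
      𝓕 (schwartzSlice p.1 (partialFourierDeriv v f)) p.2 := by
  rw [(hasFDerivAt_fourier_slice f p).fderiv,
    ContinuousLinearMap.integral_apply (integrable_partialFourierKernelDeriv f p),
    fourier_slice_eq_integral]
  refine integral_congr_ae (Filter.Eventually.of_forall fun y => ?_)
  change Complex.exp (-(2 * π * inner ℝ y p.2 : ℝ) * Complex.I) * fderiv ℝ f (p.1, y) (v.1, 0) +
        partialFourierKernel f p y * (-(2 * π : ℝ) * Complex.I) * (inner ℝ y v.2 : ℝ) =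
    Complex.exp (-(2 * π * inner ℝ y p.2 : ℝ) * Complex.I) * partialFourierDeriv v f (p.1, y)
  rw [partialFourierDeriv_apply, partialFourierKernel]
  ring

variable (A B) in
/-- The partial Fourier transform as a linear map into functions. -/
def partialFourierLM : 𝓢(A × B, ℂ) →ₗ[ℂ] (A × B → ℂ) where
  toFun f p := 𝓕 (schwartzSlice p.1 f) p.2
  map_add' f g := by
    ext p
    rw [map_add, FourierTransform.fourier_add]
    rfl
  map_smul' c f := by
    ext p
    rw [map_smul, FourierTransform.fourier_smul]
    rfl

theorem partialFourierLM_lineDeriv (w : B) (f : 𝓢(A × B, ℂ)) (p : A × B) :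
    partialFourierLM A B (∂_{((0, w) : A × B)} f) p =
      2 * π * Complex.I * ((inner ℝ p.2 w : ℝ) : ℂ) * partialFourierLM A B f p := by
  change 𝓕 (schwartzSlice p.1 (∂_{((0, w) : A × B)} f)) p.2 = _ * 𝓕 (schwartzSlice p.1 f) p.2
  rw [schwartzSlice_lineDeriv, SchwartzMap.fourier_lineDerivOp_eq, smul_apply,
    SchwartzMap.smulLeftCLM_apply_apply (by fun_prop)]
  simp only [smul_eq_mul, Complex.real_smul]
  ring

theorem partialFourierLM_fst_mul (ℓ : A →L[ℝ] ℝ) (f : 𝓢(A × B, ℂ)) (p : A × B) :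
    partialFourierLM A B (SchwartzMap.smulLeftCLM (𝕜 := ℂ) ℂ (fun q : A × B => (ℓ q.1 : ℂ)) f) p =
      (ℓ p.1 : ℂ) * partialFourierLM A B f p := by
  have : schwartzSlice p.1 (SchwartzMap.smulLeftCLM (𝕜 := ℂ) ℂ (fun q : A × B => (ℓ q.1 : ℂ)) f) =
      (ℓ p.1 : ℂ) • schwartzSlice p.1 f := by
    ext y
    have h : Function.HasTemperateGrowth fun q : A × B => (ℓ q.1 : ℂ) :=
      (Complex.ofRealCLM.comp (ℓ.comp (ContinuousLinearMap.fst ℝ A B))).hasTemperateGrowth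
    rw [schwartzSlice_apply, SchwartzMap.smulLeftCLM_apply_apply h]
    rfl
  change 𝓕 (schwartzSlice p.1
    (SchwartzMap.smulLeftCLM (𝕜 := ℂ) ℂ (fun q : A × B => (ℓ q.1 : ℂ)) f)) p.2 = _ *
      𝓕 (schwartzSlice p.1 f) p.2
  rw [this, FourierTransform.fourier_smul]
  rfl

/-- Split `ℓ` into its parts on `A` and `B`. Multiplication by the first commutes with the
transform. The second is the inner product with a Riesz vector `w`, which is what `(2πi)⁻¹ ∂_w`
becomes after the transform. -/
theorem partialFourierLM_coord_mul (ℓ : A × B →L[ℝ] ℝ) :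
    ∃ M : 𝓢(A × B, ℂ) →L[ℂ] 𝓢(A × B, ℂ), ∀ f p,
      partialFourierLM A B (M f) p = (ℓ p : ℂ) * partialFourierLM A B f p := by
  let w := (InnerProductSpace.toDual ℝ B).symm (ℓ.comp (ContinuousLinearMap.inr ℝ A B))
  refine ⟨SchwartzMap.smulLeftCLM (𝕜 := ℂ) ℂ
      (fun q : A × B => ((ℓ.comp (ContinuousLinearMap.inl ℝ A B)) q.1 : ℂ)) +
    (2 * π * Complex.I)⁻¹ • lineDerivOpCLM ℂ 𝓢(A × B, ℂ) ((0, w) : A × B), fun f p => ?_⟩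
  have hw : inner ℝ p.2 w = ℓ (0, p.2) := by
    rw [real_inner_comm]
    exact InnerProductSpace.toDual_symm_apply
  have hp : ℓ p = ℓ (p.1, 0) + ℓ (0, p.2) := by
    rw [← map_add]
    simp
  change partialFourierLM A B (SchwartzMap.smulLeftCLM (𝕜 := ℂ) ℂ
      (fun q : A × B => ((ℓ.comp (ContinuousLinearMap.inl ℝ A B)) q.1 : ℂ)) f + (2 * π * Complex.I)⁻¹ • (∂_{((0, w) : A × B)} f)) p = _
  rw [map_add, map_smul, Pi.add_apply, Pi.smul_apply, partialFourierLM_fst_mul,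
    partialFourierLM_lineDeriv, hw, hp]
  have : (2 * π * Complex.I : ℂ) ≠ 0 := Complex.two_pi_I_ne_zero
  simp only [smul_eq_mul, Complex.ofReal_add]
  change (ℓ (p.1, 0) : ℂ) * _ + _ = _
  field_simp

variable (A B) in
theorem partialFourierLM_bound :
    ∃ q : Seminorm ℂ 𝓢(A × B, ℂ), Continuous q ∧ ∀ f p, ‖partialFourierLM A B f p‖ ≤ q f := by
  let l := (volume : Measure B).integrablePower
  let I : ℝ := ∫ y : B, (1 + ‖y‖) ^ (-(l : ℝ))
  have hI : 0 ≤ I := integral_nonneg fun y => by positivity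
  obtain ⟨c, hc⟩ : ∃ c : NNReal, (c : ℝ) = 2 ^ l * I := ⟨⟨2 ^ l * I, by positivity⟩, rfl⟩
  refine ⟨c • ((SchwartzMap.seminorm ℂ 0 0 + SchwartzMap.seminorm ℂ (0 + l) 0 :
      Seminorm ℂ 𝓢(A × B, ℂ))), ?_, fun f p => ?_⟩
  · refine Continuous.const_smul ?_ c
    exact ((schwartz_withSeminorms ℂ (A × B) ℂ).continuous_seminorm (0, 0)).add
      ((schwartz_withSeminorms ℂ (A × B) ℂ).continuous_seminorm (0 + l, 0))
  · change ‖𝓕 (schwartzSlice p.1 f) p.2‖ ≤ (c : ℝ) * (_ + _)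
    rw [hc, fourier_slice_eq_integral]
    refine (norm_integral_le_integral_norm _).trans ?_
    simp_rw [norm_partialFourierKernel]
    have := integral_pow_mul_le_of_le_of_pow_mul_le (μ := (volume : Measure B)) (k := 0)
      (f := fun y => f (p.1, y)) (C₁ := SchwartzMap.seminorm ℂ 0 0 f)
      (C₂ := SchwartzMap.seminorm ℂ (0 + l) 0 f)
      (fun y => SchwartzMap.norm_le_seminorm ℂ f _) (fun y => by
        refine le_trans ?_ (SchwartzMap.norm_pow_mul_le_seminorm ℂ f (0 + l) (p.1, y))
        gcongr
        exact le_max_right _ _)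
    simp only [pow_zero, one_mul] at this
    exact this

variable [FiniteDimensional ℝ A]

variable (A B) in
theorem exists_partialFourier : ∃ S : 𝓢(A × B, ℂ) →L[ℂ] 𝓢(A × B, ℂ),
    ∀ f p, S f p = partialFourierLM A B f p :=
  exists_clm_schwartz_of_fderiv_lift (partialFourierLM A B) partialFourierDeriv
    (fun f p => (hasFDerivAt_fourier_slice f p).differentiableAt)
    (fun f p v => fderiv_fourier_slice f p v)
    (weighted_bound_of_coord_mul _ partialFourierLM_coord_mul (partialFourierLM_bound A B))

variable (A B) in
/-- The partial Fourier transform in the second variable, on the Schwartz space. -/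
def partialFourier : 𝓢(A × B, ℂ) →L[ℂ] 𝓢(A × B, ℂ) := (exists_partialFourier A B).choose

theorem partialFourier_apply (f : 𝓢(A × B, ℂ)) (p : A × B) :
    partialFourier A B f p = 𝓕 (schwartzSlice p.1 f) p.2 :=
  (exists_partialFourier A B).choose_spec f p

theorem schwartzSlice_partialFourier (f : 𝓢(A × B, ℂ)) (a : A) :
    schwartzSlice a (partialFourier A B f) = 𝓕 (schwartzSlice a f) := by
  ext b
  rw [schwartzSlice_apply, partialFourier_apply]

variable (A B) in
/-- The inverse partial Fourier transform in the second variable, on the Schwartz space. -/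
def partialFourierInv : 𝓢(A × B, ℂ) →L[ℂ] 𝓢(A × B, ℂ) :=
  (SchwartzMap.compCLMOfContinuousLinearEquiv ℂ
    ((ContinuousLinearEquiv.refl ℝ A).prodCongr (ContinuousLinearEquiv.neg ℝ (M := B)))).comp
    (partialFourier A B)

theorem schwartzSlice_partialFourierInv (f : 𝓢(A × B, ℂ)) (a : A) :
    schwartzSlice a (partialFourierInv A B f) = 𝓕⁻ (schwartzSlice a f) := by
  ext b
  rw [SchwartzMap.fourierInv_coe, Real.fourierInv_eq_fourier_neg, ← SchwartzMap.fourier_coe]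
  exact partialFourier_apply f (a, -b)

theorem partialFourierInv_partialFourier (f : 𝓢(A × B, ℂ)) :
    partialFourierInv A B (partialFourier A B f) = f := by
  ext p
  rw [← schwartzSlice_apply p.1 _ p.2, schwartzSlice_partialFourierInv,
    schwartzSlice_partialFourier, FourierPair.fourierInv_fourier_eq]
  rfl

theorem partialFourier_partialFourierInv (f : 𝓢(A × B, ℂ)) :
    partialFourier A B (partialFourierInv A B f) = f := by
  ext p
  rw [← schwartzSlice_apply p.1 _ p.2, schwartzSlice_partialFourier,
    schwartzSlice_partialFourierInv, FourierInvPair.fourier_fourierInv_eq]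
  rfl

theorem fderiv_partialFourier (f : 𝓢(A × B, ℂ)) (p v : A × B) :
    fderiv ℝ (partialFourier A B f) p v = partialFourier A B (partialFourierDeriv v f) p := by
  rw [partialFourier_apply, ← fderiv_fourier_slice]
  congr 2
  exact funext fun q => partialFourier_apply f q

theorem partialFourier_lineDeriv (w : B) (f : 𝓢(A × B, ℂ)) (p : A × B) :
    partialFourier A B (∂_{((0, w) : A × B)} f) p =
      2 * π * Complex.I * ((inner ℝ p.2 w : ℝ) : ℂ) * partialFourier A B f p := by
  rw [partialFourier_apply, partialFourier_apply]
  exact partialFourierLM_lineDeriv w f p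

end PartialFourier

/-! ### Primitives in the last variable -/

section Primitive

open LineDeriv

theorem partialFourier_apply_zero {A B : Type*} [NormedAddCommGroup A] [NormedSpace ℝ A]
    [NormedAddCommGroup B] [InnerProductSpace ℝ B] [FiniteDimensional ℝ B] [MeasurableSpace B]
    [BorelSpace B] [FiniteDimensional ℝ A] (f : 𝓢(A × B, ℂ)) (a : A) :
    partialFourier A B f (a, 0) = ∫ y, f (a, y) := by
  rw [partialFourier_apply, fourier_slice_eq_integral]
  simp [partialFourierKernel]

variable {A : Type*} [NormedAddCommGroup A] [NormedSpace ℝ A]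

/-- Two extra powers of the weight pay for `r ^ 2`; this dominates every slice by a multiple of `(1
+ r ^ 2)⁻¹`, uniformly in `a`. -/
theorem schwartz_one_add_sq_mul_le {F : Type*} [NormedAddCommGroup F] [NormedSpace ℝ F]
    (g : 𝓢(A × ℝ, F)) (k : ℕ) (a : A) (r : ℝ) :
    (1 + r ^ 2) * (‖(a, r)‖ ^ k * ‖g (a, r)‖) ≤
      SchwartzMap.seminorm ℝ k 0 g + SchwartzMap.seminorm ℝ (k + 2) 0 g := by
  rw [add_mul, one_mul]
  refine add_le_add (SchwartzMap.norm_pow_mul_le_seminorm ℝ g k _)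
    (le_trans ?_ (SchwartzMap.norm_pow_mul_le_seminorm ℝ g (k + 2) (a, r)))
  rw [pow_add, ← mul_assoc, mul_comm (r ^ 2), ← sq_abs r]
  gcongr
  exact le_max_right _ _

theorem schwartz_norm_le_div {F : Type*} [NormedAddCommGroup F] [NormedSpace ℝ F]
    (g : 𝓢(A × ℝ, F)) (k : ℕ) (a : A) (r : ℝ) :
    ‖(a, r)‖ ^ k * ‖g (a, r)‖ ≤
      (SchwartzMap.seminorm ℝ k 0 g + SchwartzMap.seminorm ℝ (k + 2) 0 g) * (1 + r ^ 2)⁻¹ := by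
  rw [← div_eq_mul_inv, le_div_iff₀ (by positivity), mul_comm]
  exact schwartz_one_add_sq_mul_le g k a r

theorem integrable_schwartz_weighted {F : Type*} [NormedAddCommGroup F] [NormedSpace ℝ F]
    (g : 𝓢(A × ℝ, F)) (k : ℕ) (a : A) :
    Integrable fun r : ℝ => ‖(a, r)‖ ^ k * ‖g (a, r)‖ := by
  refine (integrable_inv_one_add_sq.const_mul
    (SchwartzMap.seminorm ℝ k 0 g + SchwartzMap.seminorm ℝ (k + 2) 0 g)).mono'
    (by fun_prop) (Filter.Eventually.of_forall fun r => ?_)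
  rw [Real.norm_of_nonneg (by positivity)]
  exact schwartz_norm_le_div g k a r

theorem integrable_schwartz_snd {F : Type*} [NormedAddCommGroup F] [NormedSpace ℝ F]
    (g : 𝓢(A × ℝ, F)) (a : A) : Integrable fun r : ℝ => g (a, r) := by
  have h := integrable_schwartz_weighted g 0 a
  simp only [pow_zero, one_mul] at h
  exact (integrable_norm_iff (by fun_prop)).1 h

theorem integral_schwartz_weighted_le {F : Type*} [NormedAddCommGroup F] [NormedSpace ℝ F]
    (g : 𝓢(A × ℝ, F)) (k : ℕ) (a : A) :
    ∫ r : ℝ, ‖(a, r)‖ ^ k * ‖g (a, r)‖ ≤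
      Real.pi * (SchwartzMap.seminorm ℝ k 0 g + SchwartzMap.seminorm ℝ (k + 2) 0 g) := by
  rw [mul_comm, ← integral_univ_inv_one_add_sq, ← integral_const_mul]
  exact integral_mono (integrable_schwartz_weighted g k a)
    (integrable_inv_one_add_sq.const_mul _) fun r => schwartz_norm_le_div g k a r

/-- The primitive in the last variable that vanishes at `-∞`. -/
def schwartzPrimitive (g : 𝓢(A × ℝ, ℂ)) (p : A × ℝ) : ℂ :=
  ∫ t in Set.Iic (0 : ℝ), g (p.1, p.2 + t)

/-- The domination needed to differentiate under the integral: moving the base point by less than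
one changes `1 + s ^ 2` by a factor of at most 3. -/
theorem schwartzPrimitive_shift_bound (h : 𝓢(A × ℝ, A × ℝ →L[ℝ] ℂ)) (p₀ p : A × ℝ)
    (hp : p ∈ Metric.ball p₀ 1) (t : ℝ) :
    ‖h (p.1, p.2 + t)‖ ≤ 3 * (SchwartzMap.seminorm ℝ 0 0 h + SchwartzMap.seminorm ℝ (0 + 2) 0 h) *
      (1 + (p₀.2 + t) ^ 2)⁻¹ := by
  have h1 := schwartz_one_add_sq_mul_le h 0 p.1 (p.2 + t)
  rw [pow_zero, one_mul] at h1
  have h2 : |p.2 - p₀.2| < 1 := by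
    have := (Prod.dist_eq (x := p) (y := p₀)) ▸ (Metric.mem_ball.1 hp)
    exact (le_max_right _ _).trans_lt this
  have h3 : (p.2 - p₀.2) ^ 2 ≤ 1 := by
    rw [← sq_abs]
    exact pow_le_one₀ (abs_nonneg _) h2.le
  have h4 : 1 + (p₀.2 + t) ^ 2 ≤ 3 * (1 + (p.2 + t) ^ 2) := by
    nlinarith [sq_nonneg ((p.2 + t) + (p.2 - p₀.2)), sq_nonneg (p.2 + t)]
  rw [← div_eq_mul_inv, le_div_iff₀ (by positivity)]
  calc ‖h (p.1, p.2 + t)‖ * (1 + (p₀.2 + t) ^ 2)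
      ≤ ‖h (p.1, p.2 + t)‖ * (3 * (1 + (p.2 + t) ^ 2)) := by gcongr
    _ = 3 * ((1 + (p.2 + t) ^ 2) * ‖h (p.1, p.2 + t)‖) := by ring
    _ ≤ _ := by gcongr

theorem integrable_schwartz_shift {F : Type*} [NormedAddCommGroup F] [NormedSpace ℝ F]
    (h : 𝓢(A × ℝ, F)) (p : A × ℝ) : Integrable fun t : ℝ => h (p.1, p.2 + t) :=
  (integrable_schwartz_snd h p.1).comp_add_left p.2

theorem hasFDerivAt_schwartzPrimitive (g : 𝓢(A × ℝ, ℂ)) (p : A × ℝ) :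
    HasFDerivAt (schwartzPrimitive g) (∫ t in Set.Iic (0 : ℝ), fderiv ℝ g (p.1, p.2 + t)) p := by
  have hF : ∀ q : A × ℝ, Integrable (fun t : ℝ => g (q.1, q.2 + t)) :=
    fun q => integrable_schwartz_shift g q
  have hF' : Integrable fun t : ℝ => fderiv ℝ g (p.1, p.2 + t) :=
    integrable_schwartz_shift (SchwartzMap.fderivCLM ℝ (A × ℝ) ℂ g) p
  refine hasFDerivAt_integral_of_dominated_of_fderiv_le (s := Metric.ball p 1)
    (F' := fun q t => fderiv ℝ g (q.1, q.2 + t))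
    (bound := fun t => 3 * (SchwartzMap.seminorm ℝ 0 0 (SchwartzMap.fderivCLM ℝ (A × ℝ) ℂ g) +
      SchwartzMap.seminorm ℝ (0 + 2) 0 (SchwartzMap.fderivCLM ℝ (A × ℝ) ℂ g)) *
      (1 + (p.2 + t) ^ 2)⁻¹) (Metric.ball_mem_nhds p one_pos)
    (Filter.Eventually.of_forall fun q => (hF q).integrableOn.aestronglyMeasurable)
    (hF p).integrableOn hF'.integrableOn.aestronglyMeasurable
    (Filter.Eventually.of_forall fun t q hq =>
      schwartzPrimitive_shift_bound (SchwartzMap.fderivCLM ℝ (A × ℝ) ℂ g) p q hq t)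
    ((integrable_inv_one_add_sq.comp_add_left p.2).const_mul _).integrableOn
    (Filter.Eventually.of_forall fun t q _ => ?_)
  have h1 : HasFDerivAt (fun q : A × ℝ => (q.1, q.2 + t)) (ContinuousLinearMap.id ℝ (A × ℝ)) q := by
    have : (fun q : A × ℝ => (q.1, q.2 + t)) = fun q => q + (0, t) := by
      ext q <;> simp
    rw [this]
    exact (hasFDerivAt_id q).add_const _
  exact (g.hasFDerivAt (q.1, q.2 + t)).comp q h1

theorem fderiv_schwartzPrimitive (g : 𝓢(A × ℝ, ℂ)) (p v : A × ℝ) :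
    fderiv ℝ (schwartzPrimitive g) p v = schwartzPrimitive (∂_{v} g) p := by
  have hF' : Integrable fun t : ℝ => fderiv ℝ g (p.1, p.2 + t) :=
    integrable_schwartz_shift (SchwartzMap.fderivCLM ℝ (A × ℝ) ℂ g) p
  rw [(hasFDerivAt_schwartzPrimitive g p).fderiv,
    ContinuousLinearMap.integral_apply hF'.integrableOn]
  rfl

theorem hasDerivAt_schwartz_shift (g : 𝓢(A × ℝ, ℂ)) (p : A × ℝ) (t : ℝ) :
    HasDerivAt (fun t : ℝ => g (p.1, p.2 + t)) ((∂_{((0, 1) : A × ℝ)} g) (p.1, p.2 + t)) t := by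
  rw [SchwartzMap.lineDerivOp_apply_eq_fderiv]
  have h1 : HasDerivAt (fun t : ℝ => (p.1, p.2 + t)) ((0, 1) : A × ℝ) t :=
    (hasDerivAt_const t p.1).prodMk ((hasDerivAt_id t).const_add p.2)
  exact (g.hasFDerivAt (p.1, p.2 + t)).comp_hasDerivAt t h1

theorem schwartzPrimitive_deriv (g : 𝓢(A × ℝ, ℂ)) (p : A × ℝ) :
    schwartzPrimitive (∂_{((0, 1) : A × ℝ)} g) p = g p := by
  have h0 : Filter.Tendsto (fun t : ℝ => g (p.1, p.2 + t)) Filter.atBot (nhds 0) :=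
    tendsto_zero_of_hasDerivAt_of_integrableOn_Iic (a := 0)
      (fun t _ => hasDerivAt_schwartz_shift g p t)
      (integrable_schwartz_shift (∂_{((0, 1) : A × ℝ)} g) p).integrableOn
      (integrable_schwartz_shift g p).integrableOn
  have := integral_Iic_of_hasDerivAt_of_tendsto' (a := 0)
    (fun t _ => hasDerivAt_schwartz_shift g p t)
    (integrable_schwartz_shift (∂_{((0, 1) : A × ℝ)} g) p).integrableOn h0
  rw [schwartzPrimitive, this]
  simp

variable [FiniteDimensional ℝ A]

variable (A) in
/-- The Schwartz functions with vanishing integral over the last variable. -/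
def zeroMeanSubmodule : Submodule ℂ 𝓢(A × ℝ, ℂ) where
  carrier := {g | ∀ a, partialFourier A ℝ g (a, 0) = 0}
  zero_mem' := fun a => by simp
  add_mem' := fun {f g} hf hg a => by
    rw [map_add, add_apply, hf, hg, add_zero]
  smul_mem' := fun c f hf a => by
    rw [map_smul, smul_apply, hf, smul_zero]

/-- Frequency zero is integration over the last variable. A derivative in that variable integrates
to zero, and a derivative in `A` passes through the integral. -/
theorem partialFourier_lineDeriv_apply_zero (g : 𝓢(A × ℝ, ℂ)) (a : A) (v : A × ℝ) :
    partialFourier A ℝ (∂_{v} g) (a, 0) = fderiv ℝ (partialFourier A ℝ g) (a, 0) (v.1, 0) := by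
  have h1 : ∂_{v} g = ∂_{((v.1, 0) : A × ℝ)} g + ∂_{((0, v.2) : A × ℝ)} g := by
    rw [← LineDeriv.lineDerivOp_left_add]
    simp
  have h2 : partialFourierDeriv (v.1, 0) g = ∂_{((v.1, 0) : A × ℝ)} g := by
    ext q
    rw [partialFourierDeriv_apply, SchwartzMap.lineDerivOp_apply_eq_fderiv]
    simp
  rw [fderiv_partialFourier, h2, h1, map_add, add_apply, partialFourier_lineDeriv]
  simp

theorem lineDeriv_mem_zeroMeanSubmodule {g : 𝓢(A × ℝ, ℂ)} (hg : g ∈ zeroMeanSubmodule A)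
    (v : A × ℝ) : ∂_{v} g ∈ zeroMeanSubmodule A := by
  intro a
  rw [partialFourier_lineDeriv_apply_zero]
  have h1 : HasFDerivAt (fun b : A => partialFourier A ℝ g (b, 0))
      ((fderiv ℝ (partialFourier A ℝ g) (a, 0)).comp (ContinuousLinearMap.inl ℝ A ℝ)) a :=
    ((partialFourier A ℝ g).hasFDerivAt (a, 0)).comp a (hasFDerivAt_prodMk_left a 0)
  have h2 : (fun b : A => partialFourier A ℝ g (b, 0)) = fun _ => 0 := funext hg
  rw [h2] at h1
  exact congrArg (fun L => L v.1) (h1.unique (hasFDerivAt_const 0 a))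

/-- For `s ≤ 0` the integration runs over points with larger absolute value than `s`, so the weight
may be moved under the integral. For `s ≥ 0` mean zero replaces the integral over `(-∞, s]` by minus
the integral over `(s, ∞)`, where the same comparison holds. -/
theorem norm_schwartzPrimitive_le {g : 𝓢(A × ℝ, ℂ)} (hg : g ∈ zeroMeanSubmodule A) (k : ℕ)
    (p : A × ℝ) :
    ‖p‖ ^ k * ‖schwartzPrimitive g p‖ ≤
      Real.pi * (SchwartzMap.seminorm ℝ k 0 g + SchwartzMap.seminorm ℝ (k + 2) 0 g) := by
  obtain ⟨a, s⟩ := p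
  refine le_trans ?_ (integral_schwartz_weighted_le g k a)
  have hint := integrable_schwartz_shift g (a, s)
  have hw : Integrable fun t : ℝ => ‖(a, s + t)‖ ^ k * ‖g (a, s + t)‖ :=
    (integrable_schwartz_weighted g k a).comp_add_left s
  have key : ∀ S : Set ℝ, MeasurableSet S → (∀ t ∈ S, |s| ≤ |s + t|) →
      ‖(a, s)‖ ^ k * ‖∫ t in S, g (a, s + t)‖ ≤ ∫ r : ℝ, ‖(a, r)‖ ^ k * ‖g (a, r)‖ := by
    intro S hS hle
    calc ‖(a, s)‖ ^ k * ‖∫ t in S, g (a, s + t)‖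
        ≤ ‖(a, s)‖ ^ k * ∫ t in S, ‖g (a, s + t)‖ := by
          gcongr
          exact norm_integral_le_integral_norm _
      _ = ∫ t in S, ‖(a, s)‖ ^ k * ‖g (a, s + t)‖ := by rw [integral_const_mul]
      _ ≤ ∫ t in S, ‖(a, s + t)‖ ^ k * ‖g (a, s + t)‖ := by
          refine setIntegral_mono_on (hint.norm.const_mul _).integrableOn hw.integrableOn hS
            fun t ht => ?_
          gcongr ?_ ^ k * _
          exact max_le_max le_rfl (hle t ht)
      _ ≤ ∫ t, ‖(a, s + t)‖ ^ k * ‖g (a, s + t)‖ :=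
          setIntegral_le_integral hw (Filter.Eventually.of_forall fun t => by positivity)
      _ = _ := integral_add_left_eq_self (fun r => ‖(a, r)‖ ^ k * ‖g (a, r)‖) s
  rcases le_total s 0 with hs | hs
  · refine key (Set.Iic 0) measurableSet_Iic fun t (ht : t ≤ 0) => ?_
    rw [abs_of_nonpos hs, abs_of_nonpos (by linarith)]
    linarith
  · have h0 : (∫ t, g (a, s + t)) = 0 := by
      rw [integral_add_left_eq_self (fun r => g (a, r)) s, ← partialFourier_apply_zero]
      exact hg a
    have h1 := integral_add_compl (measurableSet_Iic (a := (0 : ℝ))) hint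
    rw [h0, Set.compl_Iic] at h1
    have h2 : ‖schwartzPrimitive g (a, s)‖ = ‖∫ t in Set.Ioi (0 : ℝ), g (a, s + t)‖ := by
      rw [schwartzPrimitive, eq_neg_of_add_eq_zero_left h1, norm_neg]
    rw [h2]
    refine key (Set.Ioi 0) measurableSet_Ioi fun t (ht : 0 < t) => ?_
    rw [abs_of_nonneg hs, abs_of_nonneg (by linarith)]
    linarith

variable (A) in
theorem exists_primitive : ∃ S : zeroMeanSubmodule A →L[ℂ] 𝓢(A × ℝ, ℂ),
    ∀ g p, S g p = schwartzPrimitive (g : 𝓢(A × ℝ, ℂ)) p := by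
  let T : zeroMeanSubmodule A →ₗ[ℂ] (A × ℝ → ℂ) :=
    { toFun := fun g => schwartzPrimitive (g : 𝓢(A × ℝ, ℂ))
      map_add' := fun f g => by
        ext p
        exact integral_add (integrable_schwartz_shift (f : 𝓢(A × ℝ, ℂ)) p).integrableOn
          (integrable_schwartz_shift (g : 𝓢(A × ℝ, ℂ)) p).integrableOn
      map_smul' := fun c f => by
        ext p
        exact integral_smul c _ }
  let D : A × ℝ → zeroMeanSubmodule A →L[ℂ] zeroMeanSubmodule A := fun v =>
    ((lineDerivOpCLM ℂ 𝓢(A × ℝ, ℂ) v).comp (zeroMeanSubmodule A).subtypeL).codRestrict _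
      fun g => lineDeriv_mem_zeroMeanSubmodule g.2 v
  refine exists_clm_schwartz_of_fderiv_lift T D
    (fun g p => (hasFDerivAt_schwartzPrimitive (g : 𝓢(A × ℝ, ℂ)) p).differentiableAt)
    (fun g p v => fderiv_schwartzPrimitive (g : 𝓢(A × ℝ, ℂ)) p v) fun k => ?_
  obtain ⟨c, hc⟩ : ∃ c : NNReal, (c : ℝ) = Real.pi := ⟨⟨Real.pi, Real.pi_pos.le⟩, rfl⟩
  refine ⟨(c • ((SchwartzMap.seminorm ℂ k 0 + SchwartzMap.seminorm ℂ (k + 2) 0 :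
    Seminorm ℂ 𝓢(A × ℝ, ℂ)))).comp (zeroMeanSubmodule A).subtype, ?_, fun g p => ?_⟩
  · refine Continuous.comp (g := ⇑(c • ((SchwartzMap.seminorm ℂ k 0 +
      SchwartzMap.seminorm ℂ (k + 2) 0 : Seminorm ℂ 𝓢(A × ℝ, ℂ))))) ?_ continuous_subtype_val
    refine Continuous.const_smul ?_ c
    exact ((schwartz_withSeminorms ℂ (A × ℝ) ℂ).continuous_seminorm (k, 0)).add
      ((schwartz_withSeminorms ℂ (A × ℝ) ℂ).continuous_seminorm (k + 2, 0))
  · refine (norm_schwartzPrimitive_le g.2 k p).trans (le_of_eq ?_)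
    rw [← hc]
    rfl

variable (A) in
/-- The primitive in the last variable, as an operator on Schwartz functions of mean zero. -/
def primitiveCLM : zeroMeanSubmodule A →L[ℂ] 𝓢(A × ℝ, ℂ) := (exists_primitive A).choose

theorem primitiveCLM_apply (g : zeroMeanSubmodule A) (p : A × ℝ) :
    primitiveCLM A g p = schwartzPrimitive (g : 𝓢(A × ℝ, ℂ)) p :=
  (exists_primitive A).choose_spec g p

theorem lineDeriv_primitiveCLM (g : zeroMeanSubmodule A) :
    ∂_{((0, 1) : A × ℝ)} (primitiveCLM A g) = (g : 𝓢(A × ℝ, ℂ)) := by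
  ext p
  rw [SchwartzMap.lineDerivOp_apply_eq_fderiv,
    show ⇑(primitiveCLM A g) = schwartzPrimitive (g : 𝓢(A × ℝ, ℂ)) from
      funext (primitiveCLM_apply g), fderiv_schwartzPrimitive, schwartzPrimitive_deriv]

/-- On the Fourier side the primitive is division by `2πiσ`. This is how the factor `1 / |ξ|` of an
angular derivative is absorbed without leaving the Schwartz space. -/
theorem partialFourier_primitiveCLM (g : zeroMeanSubmodule A) (p : A × ℝ) :
    2 * Real.pi * Complex.I * (p.2 : ℂ) * partialFourier A ℝ (primitiveCLM A g) p =
      partialFourier A ℝ (g : 𝓢(A × ℝ, ℂ)) p := by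
  have := partialFourier_lineDeriv (1 : ℝ) (primitiveCLM A g) p
  rw [lineDeriv_primitiveCLM] at this
  rw [this]
  simp

end Primitive

/-! ### Composition with a map followed by a cutoff -/

section CutComposition

open scoped Nat

variable {E E' : Type*} [NormedAddCommGroup E] [NormedSpace ℝ E]
  [NormedAddCommGroup E'] [NormedSpace ℝ E']

/-- Weighted bounds for the derivatives of `χ · (g ∘ Φ)` from those of `g` along `Φ (supp χ)`. -/
theorem cut_comp_bound {Φ : E → E'} (hΦ : Φ.HasTemperateGrowth) {χ : E → ℂ}
    (hχ : χ.HasTemperateGrowth)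
    (hup : ∃ (k : ℕ) (C : ℝ), ∀ x ∈ tsupport χ, ‖x‖ ≤ C * (1 + ‖Φ x‖) ^ k) (K n : ℕ) :
    ∃ (N : ℕ) (C : ℝ), 0 ≤ C ∧ ∀ (g : E' → ℂ) (U : Set E'), IsOpen U → ContDiffOn ℝ ∞ g U →
      (∀ x ∈ tsupport χ, Φ x ∈ U) → ∀ M : ℝ, 0 ≤ M →
      (∀ i ≤ n, ∀ x ∈ tsupport χ, (1 + ‖Φ x‖) ^ N * ‖iteratedFDeriv ℝ i g (Φ x)‖ ≤ M) →
      ∀ x, ‖x‖ ^ K * ‖iteratedFDeriv ℝ n (fun x => χ x * g (Φ x)) x‖ ≤ C * M := by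
  obtain ⟨l, C₁, hC₁, h₁⟩ := hΦ.norm_iteratedFDeriv_le_uniform n
  obtain ⟨l₂, C₂, hC₂, h₂⟩ := hχ.norm_iteratedFDeriv_le_uniform n
  obtain ⟨kg, Cg, hg⟩ := hup
  -- In powers of `1 + ‖x‖`, the weight costs `K`, the derivatives of `χ` cost `l₂`, and up to `n`
  -- factors of derivatives of `Φ` cost `l * n`; the growth condition trades each such power for
  -- `kg` powers of `1 + ‖Φ x‖`.
  refine ⟨kg * (K + l₂ + l * n),
    (1 + |Cg|) ^ (K + l₂ + l * n) * (2 ^ n * (C₂ * (n ! * (C₁ + 1) ^ n))), by positivity, ?_⟩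
  intro g U hU hgU hmaps M hM hb x
  by_cases hx : x ∈ tsupport χ
  swap
  · have h0 : iteratedFDeriv ℝ n (fun x => χ x * g (Φ x)) x = 0 := by
      by_contra hne
      have hs : x ∈ tsupport (fun x => χ x * g (Φ x)) :=
        (support_iteratedFDeriv_subset (𝕜 := ℝ) n) hne
      exact hx (closure_mono (Function.support_mul_subset_left χ _) hs)
    rw [h0, norm_zero, mul_zero]
    positivity
  let S := Φ ⁻¹' U
  have hS : IsOpen S := hU.preimage hΦ.1.continuous
  have hxS : x ∈ S := hmaps x hx
  set w := 1 + ‖x‖ with hw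
  set v := 1 + ‖Φ x‖ with hv
  have hw1 : 1 ≤ w := by simp [hw]
  have hv1 : 1 ≤ v := by simp [hv]
  have hv0 : 0 < v := zero_lt_one.trans_le hv1
  set N := kg * (K + l₂ + l * n) with hN
  have hwv : w ^ (K + l₂ + l * n) ≤ (1 + |Cg|) ^ (K + l₂ + l * n) * v ^ N := by
    rw [hN, pow_mul v, ← mul_pow]
    gcongr
    rw [add_mul, one_mul]
    refine add_le_add (one_le_pow₀ hv1) ((hg x hx).trans ?_)
    gcongr
    exact le_abs_self _
  have hcomp : ∀ j ≤ n, ‖iteratedFDerivWithin ℝ j (g ∘ Φ) S x‖ ≤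
      n ! * (M / v ^ N) * ((C₁ + 1) * w ^ l) ^ n := by
    intro j hj
    -- The chain rule estimate wants the `i`-th derivative of `Φ` bounded by the `i`-th power of one
    -- constant. Enlarging `C₁` to `C₁ + 1` makes that constant at least one, so its first power is
    -- enough.
    have hone : 1 ≤ (C₁ + 1) * w ^ l := by
      have := one_le_pow₀ hw1 (n := l)
      nlinarith
    have := norm_iteratedFDerivWithin_comp_le (𝕜 := ℝ) (n := j) (N := ∞) hgU
      (hΦ.1.contDiffOn (s := S)) (by exact_mod_cast le_top) hU.uniqueDiffOn hS.uniqueDiffOn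
      (fun y hy => hy) hxS (C := M / v ^ N) (D := (C₁ + 1) * w ^ l)
      (fun i hi => by
        rw [iteratedFDerivWithin_of_isOpen i hU hxS, le_div_iff₀ (by positivity), mul_comm]
        exact hb i (hi.trans hj) x hx)
      (fun i hi1 hi => by
        rw [iteratedFDerivWithin_of_isOpen i hS hxS]
        refine (h₁ i (hi.trans hj) x).trans ?_
        calc C₁ * w ^ l ≤ (C₁ + 1) * w ^ l := by gcongr; linarith
          _ ≤ ((C₁ + 1) * w ^ l) ^ i := le_self_pow₀ hone (by omega))
    refine this.trans ?_
    gcongr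
  have hmul := norm_iteratedFDerivWithin_mul_le (𝕜 := ℝ) (N := ∞) (n := n)
    (hχ.1.contDiffOn (s := S)) (hgU.comp (hΦ.1.contDiffOn (s := S)) fun y hy => hy)
    hS.uniqueDiffOn hxS (by exact_mod_cast le_top)
  rw [iteratedFDerivWithin_of_isOpen n hS hxS] at hmul
  have hsum : ‖iteratedFDeriv ℝ n (fun x => χ x * g (Φ x)) x‖ ≤
      2 ^ n * ((C₂ * w ^ l₂) * (n ! * (M / v ^ N) * ((C₁ + 1) * w ^ l) ^ n)) := by
    refine hmul.trans ?_
    have h2n : (2 : ℝ) ^ n = ∑ i ∈ Finset.range (n + 1), (n.choose i : ℝ) := by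
      exact_mod_cast (Nat.sum_range_choose n).symm
    rw [h2n, Finset.sum_mul]
    refine Finset.sum_le_sum fun i hi => ?_
    rw [mul_assoc]
    have hin : i ≤ n := Nat.lt_succ_iff.1 (Finset.mem_range.1 hi)
    gcongr
    · rw [iteratedFDerivWithin_of_isOpen i hS hxS]
      exact h₂ i hin x
    · exact hcomp (n - i) (Nat.sub_le n i)
  calc ‖x‖ ^ K * ‖iteratedFDeriv ℝ n (fun x => χ x * g (Φ x)) x‖
      ≤ w ^ K * (2 ^ n * ((C₂ * w ^ l₂) * (n ! * (M / v ^ N) * ((C₁ + 1) * w ^ l) ^ n))) := by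
        gcongr
        simp [hw]
    _ = w ^ (K + l₂ + l * n) * (2 ^ n * (C₂ * (n ! * (C₁ + 1) ^ n)) * (M / v ^ N)) := by
        rw [mul_pow, ← pow_mul]
        ring
    _ ≤ ((1 + |Cg|) ^ (K + l₂ + l * n) * v ^ N) *
        (2 ^ n * (C₂ * (n ! * (C₁ + 1) ^ n)) * (M / v ^ N)) := by gcongr
    _ = _ := by
        field_simp

theorem contDiff_cut_comp {Φ : E → E'} (hΦ : ContDiff ℝ ∞ Φ) {χ : E → ℂ} (hχ : ContDiff ℝ ∞ χ)
    {g : E' → ℂ} {U : Set E'} (hU : IsOpen U) (hg : ContDiffOn ℝ ∞ g U)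
    (hmaps : ∀ x ∈ tsupport χ, Φ x ∈ U) : ContDiff ℝ ∞ fun x => χ x * g (Φ x) := by
  rw [contDiff_iff_contDiffAt]
  intro x
  by_cases hx : x ∈ tsupport χ
  · exact hχ.contDiffAt.mul
      ((hg.contDiffAt (hU.mem_nhds (hmaps x hx))).comp x hΦ.contDiffAt)
  · have : (fun x => χ x * g (Φ x)) =ᶠ[nhds x] fun _ => 0 := by
      filter_upwards [notMem_tsupport_iff_eventuallyEq.1 hx] with y hy
      simp [hy]
    exact contDiffAt_const.congr_of_eventuallyEq this

/-- The growth condition is imposed only on the support of `χ`, so `Φ` may lose information about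
variables that the cutoff keeps bounded. -/
theorem exists_cut_comp_clm {Φ : E → E'} (hΦ : Φ.HasTemperateGrowth) {χ : E → ℂ}
    (hχ : χ.HasTemperateGrowth)
    (hup : ∃ (k : ℕ) (C : ℝ), ∀ x ∈ tsupport χ, ‖x‖ ≤ C * (1 + ‖Φ x‖) ^ k) :
    ∃ S : 𝓢(E', ℂ) →L[ℂ] 𝓢(E, ℂ), ∀ g x, S g x = χ x * g (Φ x) := by
  let T : 𝓢(E', ℂ) →ₗ[ℂ] (E → ℂ) :=
    { toFun := fun g x => χ x * g (Φ x)
      map_add' := fun f g => by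
        ext x
        exact mul_add _ _ _
      map_smul' := fun c f => by
        ext x
        exact mul_left_comm _ _ _ }
  refine exists_clm_schwartz_of_bound T
    (fun g => contDiff_cut_comp hΦ.1 hχ.1 isOpen_univ (g.smooth ⊤).contDiffOn
      fun _ _ => Set.mem_univ _) fun K n => ?_
  obtain ⟨N, C, hC, h⟩ := cut_comp_bound hΦ hχ hup K n
  obtain ⟨c, hc⟩ : ∃ c : NNReal, (c : ℝ) = C * 2 ^ N := ⟨⟨C * 2 ^ N, by positivity⟩, rfl⟩
  refine ⟨c • (Finset.Iic (N, n)).sup (schwartzSeminormFamily ℂ E' ℂ), ?_, fun g x => ?_⟩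
  · refine Continuous.const_smul ?_ c
    exact Seminorm.continuous_finsetSup fun i _ =>
      (schwartz_withSeminorms ℂ E' ℂ).continuous_seminorm i
  · refine (h g Set.univ isOpen_univ (g.smooth ⊤).contDiffOn (fun _ _ => Set.mem_univ _)
      (2 ^ N * (Finset.Iic (N, n)).sup (schwartzSeminormFamily ℂ E' ℂ) g) (by positivity)
      (fun i hi x _ => SchwartzMap.one_add_le_sup_seminorm_apply (m := (N, n)) le_rfl hi g _)
      x).trans (le_of_eq ?_)
    rw [← mul_assoc, ← hc]
    rfl

end CutComposition

/-! ### Cutoffs near the sphere, radial projection and polar pullback -/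

section Cutoff

variable (V : Type*) [NormedAddCommGroup V] [InnerProductSpace ℝ V] [FiniteDimensional ℝ V]

/-- The difference of two concentric bumps with radii `c, d` and `a, b`; for `‖p‖ ≤ a` both equal
one and cancel. -/
theorem exists_annulus_cutoff {a b c d : ℝ} (ha : 0 < a) (hab : a < b) (hbc : b ≤ c)
    (hcd : c < d) :
    ∃ χ : V → ℝ, ContDiff ℝ ∞ χ ∧ HasCompactSupport χ ∧ (∀ p, b ≤ ‖p‖ → ‖p‖ ≤ c → χ p = 1) ∧
      (∀ p, ‖p‖ ≤ a → χ p = 0) ∧ tsupport χ ⊆ {p | a ≤ ‖p‖ ∧ ‖p‖ ≤ d} := by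
  let b₁ : ContDiffBump (0 : V) := ⟨c, d, by linarith, hcd⟩
  let b₂ : ContDiffBump (0 : V) := ⟨a, b, ha, hab⟩
  have h1 : ∀ p, ‖p‖ ≤ c → b₁ p = 1 := fun p hp =>
    b₁.one_of_mem_closedBall (by simpa using hp)
  have h2 : ∀ p, ‖p‖ ≤ a → b₂ p = 1 := fun p hp =>
    b₂.one_of_mem_closedBall (by simpa using hp)
  have h3 : ∀ p, d ≤ ‖p‖ → b₁ p = 0 := fun p hp => b₁.zero_of_le_dist (by simpa using hp)
  have h4 : ∀ p, b ≤ ‖p‖ → b₂ p = 0 := fun p hp => b₂.zero_of_le_dist (by simpa using hp)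
  have hz : ∀ p, ‖p‖ ≤ a → b₁ p - b₂ p = 0 := fun p hp => by
    rw [h1 p (by linarith), h2 p hp, sub_self]
  refine ⟨fun p => b₁ p - b₂ p, b₁.contDiff.sub b₂.contDiff,
    b₁.hasCompactSupport.sub b₂.hasCompactSupport, fun p hp1 hp2 => by
      simp [h1 p hp2, h4 p hp1], hz, ?_⟩
  refine closure_minimal (fun p hp => ?_) ((isClosed_le continuous_const continuous_norm).inter
    (isClosed_le continuous_norm continuous_const))
  constructor
  · by_contra! hlt
    exact hp (hz p hlt.le)
  · by_contra! hlt
    exact hp (by simp [h3 p hlt.le, h4 p (by linarith)])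

theorem exists_sphere_cutoff : ∃ χ : V → ℝ, ContDiff ℝ ∞ χ ∧ HasCompactSupport χ ∧
    (∀ p, 3 / 4 ≤ ‖p‖ → ‖p‖ ≤ 3 / 2 → χ p = 1) ∧ (∀ p, ‖p‖ ≤ 1 / 2 → χ p = 0) ∧
    tsupport χ ⊆ {p | 1 / 2 ≤ ‖p‖ ∧ ‖p‖ ≤ 2} :=
  exists_annulus_cutoff V (by norm_num) (by norm_num) (by norm_num) (by norm_num)

/-- A smooth function with support in `1/2 ≤ |p| ≤ 2` that is one near the unit sphere. -/
def sphereCutoff (p : V) : ℂ := ((exists_sphere_cutoff V).choose p : ℂ)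

theorem sphereCutoff_eq_one {p : V} (h1 : 3 / 4 ≤ ‖p‖) (h2 : ‖p‖ ≤ 3 / 2) :
    sphereCutoff V p = 1 := by
  rw [sphereCutoff, (exists_sphere_cutoff V).choose_spec.2.2.1 p h1 h2, Complex.ofReal_one]

theorem hasTemperateGrowth_sphereCutoff : (sphereCutoff V).HasTemperateGrowth :=
  Function.HasTemperateGrowth.comp Function.Complex.hasTemperateGrowth_ofReal
    ((exists_sphere_cutoff V).choose_spec.2.1.hasTemperateGrowth
      (exists_sphere_cutoff V).choose_spec.1)

theorem tsupport_sphereCutoff_subset :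
    tsupport (sphereCutoff V) ⊆ {p | 1 / 2 ≤ ‖p‖ ∧ ‖p‖ ≤ 2} := by
  refine subset_trans (closure_mono fun p hp => ?_) (exists_sphere_cutoff V).choose_spec.2.2.2.2
  intro h
  exact hp (by simp [sphereCutoff, h])

/-- A cutoff vanishing near the origin removes the singularity of `p / |p|`, and compact support
gives temperate growth. -/
theorem exists_radialProj : ∃ ρ : V → V, ρ.HasTemperateGrowth ∧
    ∀ p, 1 / 2 ≤ ‖p‖ → ‖p‖ ≤ 2 → ρ p = ‖p‖⁻¹ • p := by
  obtain ⟨χ, hχ, hs, h1, h0, -⟩ := exists_annulus_cutoff V (a := 1 / 4) (b := 1 / 2) (c := 2)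
    (d := 3) (by norm_num) (by norm_num) (by norm_num) (by norm_num)
  refine ⟨fun p => χ p • (‖p‖⁻¹ • p), ?_, fun p hp1 hp2 => by simp [h1 p hp1 hp2]⟩
  refine HasCompactSupport.hasTemperateGrowth hs.smul_right ?_
  rw [contDiff_iff_contDiffAt]
  intro p
  rcases eq_or_ne p 0 with rfl | hp
  · have : (fun p => χ p • (‖p‖⁻¹ • p)) =ᶠ[nhds 0] fun _ => 0 := by
      filter_upwards [Metric.ball_mem_nhds (0 : V) (by norm_num : (0 : ℝ) < 1 / 4)] with q hq
      rw [h0 q (by simpa using (Metric.mem_ball.1 hq).le), zero_smul]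
    exact contDiffAt_const.congr_of_eventuallyEq this
  · exact hχ.contDiffAt.smul
      (((contDiffAt_norm ℝ hp).inv (norm_ne_zero_iff.2 hp)).smul contDiffAt_id)

/-- A compactly supported smooth map equal to `p ↦ p / |p|` for `1/2 ≤ |p| ≤ 2`. -/
def radialProj : V → V := (exists_radialProj V).choose

theorem hasTemperateGrowth_radialProj : (radialProj V).HasTemperateGrowth :=
  (exists_radialProj V).choose_spec.1

theorem radialProj_eq {p : V} (h1 : 1 / 2 ≤ ‖p‖) (h2 : ‖p‖ ≤ 2) : radialProj V p = ‖p‖⁻¹ • p :=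
  (exists_radialProj V).choose_spec.2 p h1 h2

variable (Y : Type*) [NormedAddCommGroup Y] [NormedSpace ℝ Y]

/-- The map `(p, y) ↦ (p / |p|, y)`, modified away from the unit sphere. -/
def radialProjFst (x : V × Y) : V × Y := (radialProj V x.1, x.2)

/-- The cutoff function near the unit sphere in the first variable. -/
def sphereCutoffFst (x : V × Y) : ℂ := sphereCutoff V x.1

theorem hasTemperateGrowth_radialProjFst : (radialProjFst V Y).HasTemperateGrowth := by
  have : radialProjFst V Y = fun x => ContinuousLinearMap.inl ℝ V Y (radialProj V x.1) +
      (ContinuousLinearMap.inr ℝ V Y).comp (ContinuousLinearMap.snd ℝ V Y) x := by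
    ext x <;> simp [radialProjFst]
  rw [this]
  refine Function.HasTemperateGrowth.add ?_ (ContinuousLinearMap.hasTemperateGrowth _)
  exact (ContinuousLinearMap.inl ℝ V Y).hasTemperateGrowth.comp
    ((hasTemperateGrowth_radialProj V).comp (ContinuousLinearMap.fst ℝ V Y).hasTemperateGrowth)

theorem hasTemperateGrowth_sphereCutoffFst : (sphereCutoffFst V Y).HasTemperateGrowth :=
  (hasTemperateGrowth_sphereCutoff V).comp (ContinuousLinearMap.fst ℝ V Y).hasTemperateGrowth

omit [NormedSpace ℝ Y] in
theorem mem_of_mem_tsupport_sphereCutoffFst {x : V × Y} (hx : x ∈ tsupport (sphereCutoffFst V Y)) :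
    1 / 2 ≤ ‖x.1‖ ∧ ‖x.1‖ ≤ 2 :=
  tsupport_sphereCutoff_subset V
    (tsupport_comp_subset_preimage (sphereCutoff V) continuous_fst hx)

omit [NormedSpace ℝ Y] in
theorem norm_le_of_mem_tsupport_sphereCutoffFst {x : V × Y}
    (hx : x ∈ tsupport (sphereCutoffFst V Y)) :
    ‖x‖ ≤ 2 * (1 + ‖radialProjFst V Y x‖) ^ 1 := by
  have h := mem_of_mem_tsupport_sphereCutoffFst V Y hx
  have h2 : ‖x.2‖ ≤ ‖radialProjFst V Y x‖ := le_max_right _ _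
  have h0 := norm_nonneg (radialProjFst V Y x)
  rw [pow_one]
  refine max_le (by linarith) (by linarith)

theorem exists_sphereReextend : ∃ S : 𝓢(V × Y, ℂ) →L[ℂ] 𝓢(V × Y, ℂ),
    ∀ g x, S g x = sphereCutoffFst V Y x * g (radialProjFst V Y x) :=
  exists_cut_comp_clm (hasTemperateGrowth_radialProjFst V Y)
    (hasTemperateGrowth_sphereCutoffFst V Y)
    ⟨1, 2, fun _ => norm_le_of_mem_tsupport_sphereCutoffFst V Y⟩

/-- The operator `g ↦ χ(p) g(p / |p|, y)`. -/
def sphereReextend : 𝓢(V × Y, ℂ) →L[ℂ] 𝓢(V × Y, ℂ) := (exists_sphereReextend V Y).choose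

theorem sphereReextend_apply (g : 𝓢(V × Y, ℂ)) (x : V × Y) :
    sphereReextend V Y g x = sphereCutoffFst V Y x * g (radialProjFst V Y x) :=
  (exists_sphereReextend V Y).choose_spec g x

theorem sphereReextend_eq_of_norm {g : 𝓢(V × Y, ℂ)} {x : V × Y} (h1 : 3 / 4 ≤ ‖x.1‖)
    (h2 : ‖x.1‖ ≤ 3 / 2) : sphereReextend V Y g x = g (‖x.1‖⁻¹ • x.1, x.2) := by
  rw [sphereReextend_apply, sphereCutoffFst, sphereCutoff_eq_one V h1 h2, one_mul, radialProjFst,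
    radialProj_eq V (by linarith) (by linarith)]

theorem sphereReextend_eq_of_norm_one {g : 𝓢(V × Y, ℂ)} {x : V × Y} (h : ‖x.1‖ = 1) :
    sphereReextend V Y g x = g x := by
  rw [sphereReextend_eq_of_norm V Y (by rw [h]; norm_num) (by rw [h]; norm_num), h]
  simp

variable (W : Type*) [NormedAddCommGroup W] [NormedSpace ℝ W]

/-- On the support of the cutoff `‖p‖ ≥ 1/2`, so `|σ| ≤ 2 ‖σ p‖`, and decay in `ξ = σ p` gives decay
in `σ`; the variable `p` itself stays bounded. -/
theorem exists_polarPullback : ∃ S : 𝓢(V × W, ℂ) →L[ℂ] 𝓢((V × W) × ℝ, ℂ),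
    ∀ F x, S F x = sphereCutoff V x.1.1 * F (x.2 • x.1.1, x.1.2) := by
  let χ : (V × W) × ℝ → ℂ := fun x => sphereCutoff V x.1.1
  let Φ : (V × W) × ℝ → V × W := fun x => (x.2 • x.1.1, x.1.2)
  let π₁ : (V × W) × ℝ →L[ℝ] V :=
    (ContinuousLinearMap.fst ℝ V W).comp (ContinuousLinearMap.fst ℝ (V × W) ℝ)
  have hχ : χ.HasTemperateGrowth :=
    (hasTemperateGrowth_sphereCutoff V).comp π₁.hasTemperateGrowth
  have hΦ : Φ.HasTemperateGrowth := by
    have : Φ = fun x => ContinuousLinearMap.inl ℝ V W (x.2 • π₁ x) +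
        (((ContinuousLinearMap.inr ℝ V W).comp (ContinuousLinearMap.snd ℝ V W)).comp
          (ContinuousLinearMap.fst ℝ (V × W) ℝ)) x := by
      ext x <;> simp [Φ, π₁]
    rw [this]
    refine Function.HasTemperateGrowth.add ?_ (ContinuousLinearMap.hasTemperateGrowth _)
    exact (ContinuousLinearMap.inl ℝ V W).hasTemperateGrowth.comp
      ((ContinuousLinearMap.snd ℝ (V × W) ℝ).hasTemperateGrowth.smul π₁.hasTemperateGrowth)
  refine exists_cut_comp_clm hΦ hχ ⟨1, 2, fun x hx => ?_⟩
  have h : 1 / 2 ≤ ‖x.1.1‖ ∧ ‖x.1.1‖ ≤ 2 :=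
    tsupport_sphereCutoff_subset V (tsupport_comp_subset_preimage (sphereCutoff V) π₁.continuous hx)
  have h0 := norm_nonneg (Φ x)
  have h1 : |x.2| * ‖x.1.1‖ ≤ ‖Φ x‖ := by
    rw [← Real.norm_eq_abs, ← norm_smul]
    exact le_max_left _ _
  have h2 : ‖x.1.2‖ ≤ ‖Φ x‖ := le_max_right _ _
  have h3 : ‖x.2‖ ≤ 2 * ‖Φ x‖ := by
    rw [Real.norm_eq_abs]
    nlinarith [abs_nonneg x.2]
  rw [pow_one]
  exact max_le (max_le (by linarith) (by linarith)) (by linarith)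

/-- The operator `F ↦ χ(p) F(σ p, η)`. -/
def polarPullback : 𝓢(V × W, ℂ) →L[ℂ] 𝓢((V × W) × ℝ, ℂ) := (exists_polarPullback V W).choose

theorem polarPullback_apply (F : 𝓢(V × W, ℂ)) (x : (V × W) × ℝ) :
    polarPullback V W F x = sphereCutoff V x.1.1 * F (x.2 • x.1.1, x.1.2) :=
  (exists_polarPullback V W).choose_spec F x

end Cutoff

/-! ### Moments in the last variable -/

section Moments

open LineDeriv FourierTransform

variable (A : Type*) [NormedAddCommGroup A] [NormedSpace ℝ A]

theorem hasTemperateGrowth_snd_pow (m : ℕ) :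
    Function.HasTemperateGrowth fun q : A × ℝ => ((q.2 : ℝ) : ℂ) ^ m := by
  have h : Function.HasTemperateGrowth fun q : A × ℝ => ((q.2 : ℝ) : ℂ) :=
    (Complex.ofRealCLM.comp (ContinuousLinearMap.snd ℝ A ℝ)).hasTemperateGrowth
  induction m with
  | zero => simp [Function.HasTemperateGrowth.const]
  | succ m ih =>
    simp only [pow_succ]
    exact ih.mul h

/-- Multiplication by the `m`-th power of the last variable. -/
def sndPowMul (m : ℕ) : 𝓢(A × ℝ, ℂ) →L[ℂ] 𝓢(A × ℝ, ℂ) :=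
  SchwartzMap.smulLeftCLM (𝕜 := ℂ) ℂ fun q : A × ℝ => ((q.2 : ℝ) : ℂ) ^ m

variable {A}

theorem sndPowMul_apply (m : ℕ) (g : 𝓢(A × ℝ, ℂ)) (q : A × ℝ) :
    sndPowMul A m g q = (q.2 : ℂ) ^ m * g q := by
  rw [sndPowMul, SchwartzMap.smulLeftCLM_apply_apply (hasTemperateGrowth_snd_pow A m), smul_eq_mul]

theorem lineDeriv_sndPowMul (m : ℕ) (g : 𝓢(A × ℝ, ℂ)) (v : A × ℝ) (q : A × ℝ) :
    (∂_{v} (sndPowMul A m g)) q =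
      (q.2 : ℂ) ^ m * (∂_{v} g) q + m * (q.2 : ℂ) ^ (m - 1) * v.2 * g q := by
  rw [SchwartzMap.lineDerivOp_apply_eq_fderiv, SchwartzMap.lineDerivOp_apply_eq_fderiv,
    show ⇑(sndPowMul A m g) = fun q => (q.2 : ℂ) ^ m * g q from funext (sndPowMul_apply m g)]
  have h1 : HasFDerivAt (fun q : A × ℝ => ((q.2 : ℝ) : ℂ))
      (Complex.ofRealCLM.comp (ContinuousLinearMap.snd ℝ A ℝ)) q :=
    (Complex.ofRealCLM.comp (ContinuousLinearMap.snd ℝ A ℝ)).hasFDerivAt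
  have h2 := (HasFDerivAt.pow h1 m).fun_mul (g.hasFDerivAt q)
  rw [h2.fderiv]
  simp
  ring

variable [FiniteDimensional ℝ A]

/-- The moment of order `m` in the last variable. -/
def sndMoment (m : ℕ) (g : 𝓢(A × ℝ, ℂ)) (a : A) : ℂ := partialFourier A ℝ (sndPowMul A m g) (a, 0)

theorem sndMoment_eq_integral (m : ℕ) (g : 𝓢(A × ℝ, ℂ)) (a : A) :
    sndMoment m g a = ∫ s : ℝ, (s : ℂ) ^ m * g (a, s) := by
  rw [sndMoment, partialFourier_apply_zero]
  simp_rw [sndPowMul_apply]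

theorem sndMoment_zero (g : 𝓢(A × ℝ, ℂ)) (a : A) :
    sndMoment 0 g a = partialFourier A ℝ g (a, 0) := by
  rw [sndMoment_eq_integral, partialFourier_apply_zero]
  simp

theorem sndMoment_congr {g₁ g₂ : 𝓢(A × ℝ, ℂ)} {a₁ a₂ : A} (h : ∀ s, g₁ (a₁, s) = g₂ (a₂, s))
    (m : ℕ) : sndMoment m g₁ a₁ = sndMoment m g₂ a₂ := by
  simp_rw [sndMoment_eq_integral, h]

theorem partialFourier_congr {B : Type*} [NormedAddCommGroup B] [InnerProductSpace ℝ B]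
    [FiniteDimensional ℝ B] [MeasurableSpace B] [BorelSpace B] {g₁ g₂ : 𝓢(A × B, ℂ)} {a₁ a₂ : A}
    (h : ∀ s, g₁ (a₁, s) = g₂ (a₂, s)) (s : B) :
    partialFourier A B g₁ (a₁, s) = partialFourier A B g₂ (a₂, s) := by
  have h1 : schwartzSlice a₁ g₁ = schwartzSlice a₂ g₂ := by
    ext t
    exact h t
  rw [partialFourier_apply, partialFourier_apply, h1]

theorem partialFourier_smul_apply {B : Type*} [NormedAddCommGroup B] [InnerProductSpace ℝ B]
    [FiniteDimensional ℝ B] [MeasurableSpace B] [BorelSpace B] {g₁ g₂ : 𝓢(A × B, ℂ)} {a₁ a₂ : A}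
    {c : ℂ} (h : ∀ s, g₁ (a₁, s) = c * g₂ (a₂, s)) (s : B) :
    partialFourier A B g₁ (a₁, s) = c * partialFourier A B g₂ (a₂, s) := by
  have h1 : schwartzSlice a₁ g₁ = c • schwartzSlice a₂ g₂ := by
    ext t
    exact h t
  rw [partialFourier_apply, partialFourier_apply, h1, FourierTransform.fourier_smul]
  rfl

theorem sndMoment_add (m : ℕ) (f g : 𝓢(A × ℝ, ℂ)) (a : A) :
    sndMoment m (f + g) a = sndMoment m f a + sndMoment m g a := by
  rw [sndMoment, map_add, map_add]
  rfl

theorem sndMoment_smul (m : ℕ) (c : ℂ) (g : 𝓢(A × ℝ, ℂ)) (a : A) :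
    sndMoment m (c • g) a = c * sndMoment m g a := by
  rw [sndMoment, map_smul, map_smul]
  rfl

theorem sndMoment_smul_apply {g₁ g₂ : 𝓢(A × ℝ, ℂ)} {a₁ a₂ : A} {c : ℂ}
    (h : ∀ s, g₁ (a₁, s) = c * g₂ (a₂, s)) (m : ℕ) : sndMoment m g₁ a₁ = c * sndMoment m g₂ a₂ := by
  simp_rw [sndMoment_eq_integral, h, mul_left_comm _ c]
  rw [integral_const_mul]

/-- A moment is a partial Fourier transform restricted to frequency zero, hence differentiable; and
a derivative in `A` commutes with multiplication by `s ^ m`. -/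
theorem sndMoment_lineDeriv (m : ℕ) (g : 𝓢(A × ℝ, ℂ)) (a v : A) :
    HasFDerivAt (sndMoment m g) (fderiv ℝ (sndMoment m g) a) a ∧
      sndMoment m (∂_{((v, 0) : A × ℝ)} g) a = fderiv ℝ (sndMoment m g) a v := by
  have h1 : HasFDerivAt (sndMoment m g)
      ((fderiv ℝ (partialFourier A ℝ (sndPowMul A m g)) (a, 0)).comp
        (ContinuousLinearMap.inl ℝ A ℝ)) a :=
    ((partialFourier A ℝ (sndPowMul A m g)).hasFDerivAt (a, 0)).comp a (hasFDerivAt_prodMk_left a 0)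
  have h2 : sndPowMul A m (∂_{((v, 0) : A × ℝ)} g) = ∂_{((v, 0) : A × ℝ)} (sndPowMul A m g) := by
    ext q
    rw [lineDeriv_sndPowMul, sndPowMul_apply]
    simp
  refine ⟨h1.differentiableAt.hasFDerivAt, ?_⟩
  rw [h1.fderiv, sndMoment, h2, partialFourier_lineDeriv_apply_zero]
  rfl

theorem sndMoment_sndPowMul_one (m : ℕ) (g : 𝓢(A × ℝ, ℂ)) (a : A) :
    sndMoment m (sndPowMul A 1 g) a = sndMoment (m + 1) g a := by
  rw [sndMoment, sndMoment]
  congr 2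
  ext q
  simp only [sndPowMul_apply]
  ring

/-- Integration by parts: the `s`-derivative of `s ^ (m + 1)` times the primitive has integral zero.
-/
theorem sndMoment_primitiveCLM (m : ℕ) (h : zeroMeanSubmodule A) (a : A) :
    (m + 1) * sndMoment m (primitiveCLM A h) a = -sndMoment (m + 1) (h : 𝓢(A × ℝ, ℂ)) a := by
  have h1 : ∂_{((0, 1) : A × ℝ)} (sndPowMul A (m + 1) (primitiveCLM A h)) =
      sndPowMul A (m + 1) (h : 𝓢(A × ℝ, ℂ)) + ((m : ℂ) + 1) • sndPowMul A m (primitiveCLM A h) := by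
    ext q
    rw [lineDeriv_sndPowMul, lineDeriv_primitiveCLM, add_apply, smul_apply, sndPowMul_apply,
      sndPowMul_apply]
    simp
    ring
  have h2 := partialFourier_lineDeriv (1 : ℝ) (sndPowMul A (m + 1) (primitiveCLM A h)) (a, 0)
  rw [h1, map_add, map_smul] at h2
  simp only [inner_zero_left, Complex.ofReal_zero, mul_zero, zero_mul] at h2
  rw [eq_neg_iff_add_eq_zero, add_comm]
  exact h2

end Moments

/-! ### Re-extension off the sphere with an additional parameter -/

section Radial

open LineDeriv

variable (V W : Type*) [NormedAddCommGroup V] [InnerProductSpace ℝ V] [FiniteDimensional ℝ V]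
  [NormedAddCommGroup W] [NormedSpace ℝ W]

/-- The operator `g ↦ χ(p) g((p / |p|, η), s)`. -/
def sphereReextendProd : 𝓢((V × W) × ℝ, ℂ) →L[ℂ] 𝓢((V × W) × ℝ, ℂ) :=
  ((SchwartzMap.compCLMOfContinuousLinearEquiv ℂ (ContinuousLinearEquiv.prodAssoc ℝ V W ℝ)).comp
    (sphereReextend V (W × ℝ))).comp
    (SchwartzMap.compCLMOfContinuousLinearEquiv ℂ (ContinuousLinearEquiv.prodAssoc ℝ V W ℝ).symm)

variable {V W}

theorem sphereReextendProd_apply (g : 𝓢((V × W) × ℝ, ℂ)) (p : V) (η : W) (s : ℝ) :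
    sphereReextendProd V W g ((p, η), s) = sphereCutoff V p * g ((radialProj V p, η), s) :=
  sphereReextend_apply V (W × ℝ) _ (p, η, s)

theorem sphereReextendProd_eq_of_norm (g : 𝓢((V × W) × ℝ, ℂ)) {p : V} (h1 : 3 / 4 ≤ ‖p‖)
    (h2 : ‖p‖ ≤ 3 / 2) (η : W) (s : ℝ) :
    sphereReextendProd V W g ((p, η), s) = g ((‖p‖⁻¹ • p, η), s) :=
  sphereReextend_eq_of_norm V (W × ℝ) (x := (p, η, s)) h1 h2

theorem sphereReextendProd_eq_of_norm_one (g : 𝓢((V × W) × ℝ, ℂ)) {p : V} (h : ‖p‖ = 1)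
    (η : W) (s : ℝ) : sphereReextendProd V W g ((p, η), s) = g ((p, η), s) :=
  sphereReextend_eq_of_norm_one V (W × ℝ) (x := (p, η, s)) h

theorem norm_radialProj_of_sphereCutoff_ne_zero {p : V} (h : sphereCutoff V p ≠ 0) :
    ‖radialProj V p‖ = 1 := by
  have hp : 1 / 2 ≤ ‖p‖ ∧ ‖p‖ ≤ 2 := tsupport_sphereCutoff_subset V (subset_tsupport _ h)
  rw [radialProj_eq V hp.1 hp.2, norm_smul, norm_inv, norm_norm, inv_mul_cancel₀]
  intro h0
  rw [h0] at hp
  norm_num at hp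

end Radial

/-! ### Extending a derivative across a hyperplane -/

section DerivativeExtension

variable {E : Type*} [NormedAddCommGroup E] [NormedSpace ℝ E]

theorem dense_ne_zero_of_clm {ℓ : E →L[ℝ] ℝ} (hℓ : ℓ ≠ 0) : Dense {y | ℓ y ≠ 0} := by
  obtain ⟨u, hu⟩ : ∃ u, ℓ u ≠ 0 := by
    by_contra! h
    exact hℓ (ContinuousLinearMap.ext h)
  intro x
  by_cases hx : ℓ x = 0
  · have h1 : Filter.Tendsto (fun t : ℝ => x + t • u) (nhdsWithin 0 {0}ᶜ) (nhds x) := by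
      have : Continuous fun t : ℝ => x + t • u := by fun_prop
      simpa using (this.tendsto 0).mono_left nhdsWithin_le_nhds
    refine mem_closure_of_tendsto h1 ?_
    filter_upwards [self_mem_nhdsWithin] with t ht
    simpa [hx, hu] using ht
  · exact subset_closure hx

/-- The two open half-spaces of `ℓ` are convex, so a derivative with a limit at the boundary is the
derivative within the closed half-space. The two closures cover `E`. -/
theorem hasFDerivAt_of_fderiv_extends {F : E → ℂ} {L : E → E →L[ℝ] ℂ} {ℓ : E →L[ℝ] ℝ} (hℓ : ℓ ≠ 0)
    (hF : Continuous F) (hL : Continuous L) (hd : ∀ y, ℓ y ≠ 0 → HasFDerivAt F (L y) y) (x : E) :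
    HasFDerivAt F (L x) x := by
  have key : ∀ s : Set E, IsOpen s → Convex ℝ s → (∀ y ∈ s, ℓ y ≠ 0) →
      HasFDerivWithinAt F (L x) (closure s) x := fun s ho hc hs =>
    hasFDerivWithinAt_closure_of_tendsto_fderiv
      (fun y hy => (hd y (hs y hy)).differentiableAt.differentiableWithinAt) hc ho
      (fun y _ => hF.continuousWithinAt) <| by
        refine ((hL.tendsto x).mono_left nhdsWithin_le_nhds).congr' ?_
        filter_upwards [self_mem_nhdsWithin] with y hy
        exact (hd y (hs y hy)).fderiv.symm
  have h1 := (key {y | 0 < ℓ y} (isOpen_lt continuous_const ℓ.continuous)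
    (convex_halfSpace_gt ℓ.isLinear 0) fun y hy => ne_of_gt hy).union
    (key {y | ℓ y < 0} (isOpen_lt ℓ.continuous continuous_const)
    (convex_halfSpace_lt ℓ.isLinear 0) fun y hy => ne_of_lt hy)
  have h2 : closure {y | 0 < ℓ y} ∪ closure {y | ℓ y < 0} = Set.univ := by
    rw [← closure_union, ← (dense_ne_zero_of_clm hℓ).closure_eq]
    congr 1
    ext y
    simp [lt_or_lt_iff_ne, ne_comm]
  rwa [h2, hasFDerivWithinAt_univ] at h1

theorem differentiable_of_fderiv_extends [FiniteDimensional ℝ E] {F : E → ℂ} {G : E → E → ℂ}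
    {ℓ : E →L[ℝ] ℝ} (hℓ : ℓ ≠ 0) (hF : Continuous F) (hG : ∀ v, Continuous (G v))
    (hd : ∀ y, ℓ y ≠ 0 → DifferentiableAt ℝ F y)
    (hD : ∀ y, ℓ y ≠ 0 → ∀ v, fderiv ℝ F y v = G v y) :
    Differentiable ℝ F ∧ ∀ y v, fderiv ℝ F y v = G v y := by
  let b := Module.finBasis ℝ E
  let L : E → E →L[ℝ] ℂ := fun y => ∑ i, ContinuousLinearMap.smulRightL ℝ E ℂ
    (LinearMap.toContinuousLinearMap (b.coord i)) (G (b i) y)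
  have hL : Continuous L := continuous_finsetSum _ fun i _ =>
    (ContinuousLinearMap.continuous _).comp (hG _)
  have h1 : ∀ y, HasFDerivAt F (L y) y := by
    refine hasFDerivAt_of_fderiv_extends hℓ hF hL fun y hy => ?_
    have h := fderiv_eq_sum_of_forall_apply b (L := fderiv ℝ F y) fun i => hD y hy (b i)
    exact (hd y hy).hasFDerivAt.congr_fderiv h
  refine ⟨fun y => (h1 y).differentiableAt, fun y v => ?_⟩
  rw [(h1 y).fderiv]
  refine congrFun (Continuous.ext_on (dense_ne_zero_of_clm hℓ) (hL.clm_apply continuous_const)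
    (hG v) fun z hz => ?_) y
  exact (congrArg (fun M => M v) (h1 z).fderiv.symm).trans (hD z hz v)

end DerivativeExtension

/-! ### Homogeneous functions and the moment condition -/

section RadialMoments

open LineDeriv

variable {V W : Type*} [NormedAddCommGroup V] [InnerProductSpace ℝ V] [FiniteDimensional ℝ V]
  [NormedAddCommGroup W] [NormedSpace ℝ W]

omit [FiniteDimensional ℝ V] in
theorem hasFDerivAt_norm_of_ne_zero {x : V} (hx : x ≠ 0) :
    HasFDerivAt (fun y : V => ‖y‖) (‖x‖⁻¹ • innerSL ℝ x) x := by
  have h := ((hasStrictFDerivAt_norm_sq x).hasFDerivAt).sqrt (by simpa using hx)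
  simp only [Real.sqrt_sq (norm_nonneg _)] at h
  refine h.congr_fderiv ?_
  ext v
  simp
  ring

/-- Smooth functions of `(p, η)` that are homogeneous of degree `m` in `p`. -/
def IsHomogeneousFst (m : ℕ) (P : V × W → ℂ) : Prop :=
  ContDiff ℝ ∞ P ∧ ∀ (t : ℝ) (p : V) (η : W), P (t • p, η) = (t : ℂ) ^ m * P (p, η)

omit [FiniteDimensional ℝ V] in
theorem IsHomogeneousFst.add {m : ℕ} {P Q : V × W → ℂ} (hP : IsHomogeneousFst m P)
    (hQ : IsHomogeneousFst m Q) : IsHomogeneousFst m (P + Q) :=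
  ⟨hP.1.add hQ.1, fun t p η => by
    rw [Pi.add_apply, Pi.add_apply, hP.2, hQ.2, mul_add]⟩

omit [FiniteDimensional ℝ V] in
theorem IsHomogeneousFst.smul {m : ℕ} {P : V × W → ℂ} (hP : IsHomogeneousFst m P) (c : ℂ) :
    IsHomogeneousFst m (c • P) :=
  ⟨contDiff_const.smul hP.1, fun t p η => by
    rw [Pi.smul_apply, Pi.smul_apply, hP.2, smul_eq_mul, smul_eq_mul, mul_left_comm]⟩

omit [FiniteDimensional ℝ V] in
theorem IsHomogeneousFst.fderiv_snd {m : ℕ} {P : V × W → ℂ} (hP : IsHomogeneousFst m P) (w : W) :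
    IsHomogeneousFst m fun x => fderiv ℝ P x (0, w) := by
  have hd : Differentiable ℝ P := hP.1.differentiable (by simp)
  refine ⟨(hP.1.fderiv_right (by simp)).clm_apply contDiff_const, fun t p η => ?_⟩
  have h1 : HasFDerivAt (fun ζ : W => P (t • p, ζ)) _ η :=
    (hd (t • p, η)).hasFDerivAt.comp η (hasFDerivAt_prodMk_right (t • p) η)
  have h2 : HasFDerivAt (fun ζ : W => P (p, ζ)) _ η :=
    (hd (p, η)).hasFDerivAt.comp η (hasFDerivAt_prodMk_right p η)
  simp only [hP.2] at h1
  have h3 := congrArg (fun L => L w) (h1.unique (h2.const_mul ((t : ℂ) ^ m)))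
  simpa using h3

-- Differentiating the homogeneity relation in `p` produces a factor `t`, which cancels for `t ≠ 0`;
-- the value at `t = 0` follows by continuity in `t`.
omit [FiniteDimensional ℝ V] in
theorem IsHomogeneousFst.fderiv_fst {m : ℕ} {P : V × W → ℂ} (hP : IsHomogeneousFst (m + 1) P)
    (v : V) : IsHomogeneousFst m fun x => fderiv ℝ P x (v, 0) := by
  have hd : Differentiable ℝ P := hP.1.differentiable (by simp)
  have hcd : ContDiff ℝ ∞ fun x => fderiv ℝ P x (v, 0) :=
    (hP.1.fderiv_right (by simp)).clm_apply contDiff_const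
  refine ⟨hcd, fun t p η => ?_⟩
  have hc := hcd.continuous
  have hc1 : Continuous fun t : ℝ => fderiv ℝ P (t • p, η) (v, 0) :=
    hc.comp (by fun_prop : Continuous fun t : ℝ => (t • p, η))
  have hc2 : Continuous fun t : ℝ => (t : ℂ) ^ m * fderiv ℝ P (p, η) (v, 0) := by fun_prop
  refine congrFun (hc1.ext_on (dense_compl_singleton (0 : ℝ)) hc2 fun t ht => ?_) t
  have h1 : HasFDerivAt (fun q : V => P (t • q, η)) _ p :=
    HasFDerivAt.comp (g := fun q : V => P (q, η)) p
      ((hd (t • p, η)).hasFDerivAt.comp (t • p) (hasFDerivAt_prodMk_left (t • p) η))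
      ((hasFDerivAt_id p).const_smul t)
  have h2 : HasFDerivAt (fun q : V => P (q, η)) _ p :=
    (hd (p, η)).hasFDerivAt.comp p (hasFDerivAt_prodMk_left p η)
  simp only [hP.2] at h1
  have h3 := congrArg (fun L => L v) (h1.unique (h2.const_mul ((t : ℂ) ^ (m + 1))))
  have ht' : (t : ℂ) ≠ 0 := by exact_mod_cast ht
  simp [pow_succ, mul_assoc] at h3
  exact mul_left_cancel₀ ht' (h3.trans (mul_left_comm _ _ _))

variable (V W) in
/-- The Schwartz functions `g` of `((p, η), s)` whose moments in `s` agree, on the unit sphere in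
`p`, with homogeneous functions of the corresponding degree. -/
def radialMomentSubmodule [FiniteDimensional ℝ W] : Submodule ℂ 𝓢((V × W) × ℝ, ℂ) where
  carrier := {g | ∀ m, ∃ P, IsHomogeneousFst m P ∧
    ∀ (p : V) (η : W), ‖p‖ = 1 → sndMoment m g (p, η) = P (p, η)}
  zero_mem' := fun m => ⟨0, ⟨contDiff_const, by simp⟩, fun p η _ => by simp [sndMoment]⟩
  add_mem' := fun {f g} hf hg m => by
    obtain ⟨P, hP, h1⟩ := hf m
    obtain ⟨Q, hQ, h2⟩ := hg m
    exact ⟨P + Q, hP.add hQ, fun p η h => by rw [sndMoment_add, h1 p η h, h2 p η h]; rfl⟩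
  smul_mem' := fun c f hf m => by
    obtain ⟨P, hP, h1⟩ := hf m
    exact ⟨c • P, hP.smul c, fun p η h => by rw [sndMoment_smul, h1 p η h]; rfl⟩

variable [FiniteDimensional ℝ W]

/-- Near the sphere the degree-zero extension has moment `M` with `‖q‖ ^ m M(q, η) = P(q, η)`.
Differentiating this product at `‖p‖ = 1` gives the correction term from the derivative of the norm.
-/
theorem sndMoment_sphereReextendProd_lineDeriv {m : ℕ} {g : 𝓢((V × W) × ℝ, ℂ)} {P : V × W → ℂ}
    (hP : IsHomogeneousFst m P)
    (hg : ∀ (p : V) (η : W), ‖p‖ = 1 → sndMoment m g (p, η) = P (p, η)) {p : V} (hp : ‖p‖ = 1)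
    (η : W) (v : V) :
    sndMoment m (∂_{(((v, 0), 0) : (V × W) × ℝ)} (sphereReextendProd V W g)) (p, η) =
      fderiv ℝ P (p, η) (v, 0) - m * (inner ℝ p v : ℝ) * P (p, η) := by
  have hp0 : p ≠ 0 := by
    rintro rfl
    simp at hp
  obtain ⟨h1, h2⟩ := sndMoment_lineDeriv m (sphereReextendProd V W g) (p, η) ((v, 0) : V × W)
  rw [h2]
  have h3 : HasFDerivAt (fun q => sndMoment m (sphereReextendProd V W g) (q, η)) _ p :=
    HasFDerivAt.comp (g := sndMoment m (sphereReextendProd V W g)) p h1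
      (hasFDerivAt_prodMk_left p η)
  have hd : Differentiable ℝ P := hP.1.differentiable (by simp)
  have h4 : HasFDerivAt (fun q => P (q, η)) _ p :=
    (hd (p, η)).hasFDerivAt.comp p (hasFDerivAt_prodMk_left p η)
  have h5 : HasFDerivAt (fun q : V => ((‖q‖ : ℝ) : ℂ) ^ m) _ p :=
    HasFDerivAt.pow (Complex.ofRealCLM.hasFDerivAt.comp p (hasFDerivAt_norm_of_ne_zero hp0)) m
  have h6 := h5.fun_mul h3
  have h7 : (fun q => ((‖q‖ : ℝ) : ℂ) ^ m * sndMoment m (sphereReextendProd V W g) (q, η))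
      =ᶠ[nhds p] fun q => P (q, η) := by
    have hn : ∀ᶠ q in nhds p, ‖q‖ ∈ Set.Ioo (3 / 4 : ℝ) (3 / 2) :=
      continuous_norm.continuousAt (isOpen_Ioo.mem_nhds (by rw [hp]; norm_num))
    filter_upwards [hn] with q hq
    have hq0 : ‖q‖ ≠ 0 := by linarith [hq.1]
    rw [sndMoment_congr (a₂ := (‖q‖⁻¹ • q, η))
      (fun s => sphereReextendProd_eq_of_norm g hq.1.le hq.2.le η s), hg _ _ (by
        rw [norm_smul, norm_inv, norm_norm, inv_mul_cancel₀ hq0]), ← hP.2, smul_smul,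
      mul_inv_cancel₀ hq0, one_smul]
  have h8 := congrArg (fun L => L v) (h6.unique (h4.congr_of_eventuallyEq h7))
  have h9 : sndMoment m (sphereReextendProd V W g) (p, η) = P (p, η) := by
    rw [← hg p η hp]
    exact sndMoment_congr (fun s => sphereReextendProd_eq_of_norm_one g hp η s) m
  simp [hp, h9] at h8
  rw [← h8]
  ring

end RadialMoments

/-! ### Lifting derivatives in Cartesian frequency to the functions on the sphere -/

section PolarLift

open LineDeriv

variable {V W : Type*} [NormedAddCommGroup V] [InnerProductSpace ℝ V] [FiniteDimensional ℝ V]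
  [NormedAddCommGroup W] [NormedSpace ℝ W] [FiniteDimensional ℝ W]

/-- The derivative of `g((p / |p|, η), s)` in `p`, restricted to the sphere and extended again. -/
def sphereDeriv (v : V) : 𝓢((V × W) × ℝ, ℂ) →L[ℂ] 𝓢((V × W) × ℝ, ℂ) :=
  (sphereReextendProd V W).comp
    ((lineDerivOpCLM ℂ 𝓢((V × W) × ℝ, ℂ) (((v, 0), 0) : (V × W) × ℝ)).comp
      (sphereReextendProd V W))

omit [FiniteDimensional ℝ W] in
theorem sphereDeriv_apply (v : V) (g : 𝓢((V × W) × ℝ, ℂ)) :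
    sphereDeriv v g = sphereReextendProd V W
      (∂_{(((v, 0), 0) : (V × W) × ℝ)} (sphereReextendProd V W g)) := rfl

theorem sndMoment_sphereDeriv {m : ℕ} {g : 𝓢((V × W) × ℝ, ℂ)} {P : V × W → ℂ}
    (hP : IsHomogeneousFst m P)
    (hg : ∀ (p : V) (η : W), ‖p‖ = 1 → sndMoment m g (p, η) = P (p, η)) {p : V} (hp : ‖p‖ = 1)
    (η : W) (v : V) :
    sndMoment m (sphereDeriv v g) (p, η) =
      fderiv ℝ P (p, η) (v, 0) - m * (inner ℝ p v : ℝ) * P (p, η) := by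
  rw [← sndMoment_sphereReextendProd_lineDeriv hP hg hp]
  exact sndMoment_congr (fun s => sphereReextendProd_eq_of_norm_one _ hp η s) m

/-- Homogeneity of degree zero at `t = 0` forces `P` to be constant in `p`, so its derivative
vanishes. For `p` off the sphere, either the cutoff is zero or the radial projection of `p` is a
unit vector. -/
theorem sphereDeriv_mem_zeroMeanSubmodule {g : 𝓢((V × W) × ℝ, ℂ)}
    (hg : g ∈ radialMomentSubmodule V W) (v : V) : sphereDeriv v g ∈ zeroMeanSubmodule (V × W) := by
  rintro ⟨p, η⟩
  obtain ⟨P, hP, h⟩ := hg 0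
  rw [← sndMoment_zero, sphereDeriv_apply, sndMoment_smul_apply (a₂ := (radialProj V p, η))
    (fun s => sphereReextendProd_apply _ p η s)]
  by_cases h0 : sphereCutoff V p = 0
  · rw [h0, zero_mul]
  · rw [sndMoment_sphereReextendProd_lineDeriv hP h
      (norm_radialProj_of_sphereCutoff_ne_zero h0)]
    have h1 : HasFDerivAt (fun q : V => P (q, η)) _ (radialProj V p) :=
      ((hP.1.differentiable (by simp)) (radialProj V p, η)).hasFDerivAt.comp (radialProj V p)
        (hasFDerivAt_prodMk_left (radialProj V p) η)
    have h2 : (fun q : V => P (q, η)) = fun _ => P (0, η) := by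
      ext q
      have := hP.2 0 q η
      rw [zero_smul] at this
      simp [this]
    rw [h2] at h1
    have h3 := congrArg (fun L => L v) (h1.unique (hasFDerivAt_const _ _))
    have h4 : fderiv ℝ P (radialProj V p, η) (v, 0) = 0 := h3
    rw [h4]
    simp

/-- The primitive of `sphereDeriv`. -/
def sphereDerivPrimitive (v : V) : radialMomentSubmodule V W →L[ℂ] 𝓢((V × W) × ℝ, ℂ) :=
  (primitiveCLM (V × W)).comp
    (((sphereDeriv v).comp (radialMomentSubmodule V W).subtypeL).codRestrict
      (zeroMeanSubmodule (V × W)) fun g => sphereDeriv_mem_zeroMeanSubmodule g.2 v)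

theorem sndMoment_sphereDerivPrimitive (v : V) (g : radialMomentSubmodule V W) (m : ℕ)
    (a : V × W) : (m + 1) * sndMoment m (sphereDerivPrimitive v g) a =
      -sndMoment (m + 1) (sphereDeriv v (g : 𝓢((V × W) × ℝ, ℂ))) a :=
  sndMoment_primitiveCLM m _ a

theorem partialFourier_sphereDerivPrimitive (v : V) (g : radialMomentSubmodule V W)
    (x : (V × W) × ℝ) :
    2 * Real.pi * Complex.I * (x.2 : ℂ) * partialFourier (V × W) ℝ (sphereDerivPrimitive v g) x =
      partialFourier (V × W) ℝ (sphereDeriv v (g : 𝓢((V × W) × ℝ, ℂ))) x :=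
  partialFourier_primitiveCLM _ x

omit [FiniteDimensional ℝ V] [FiniteDimensional ℝ W] in
theorem hasTemperateGrowth_inner_fst_fst (v : V) :
    Function.HasTemperateGrowth fun q : (V × W) × ℝ => ((inner ℝ q.1.1 v : ℝ) : ℂ) := by
  have : (fun q : (V × W) × ℝ => ((inner ℝ q.1.1 v : ℝ) : ℂ)) =
      fun q => (Complex.ofRealCLM.comp ((innerSL ℝ v).comp
        ((ContinuousLinearMap.fst ℝ V W).comp (ContinuousLinearMap.fst ℝ (V × W) ℝ)))) q := by
    ext q
    simp [real_inner_comm]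
  rw [this]
  exact ContinuousLinearMap.hasTemperateGrowth _

/-- Multiplication by `⟪p, v⟫`. -/
def innerMul (v : V) : 𝓢((V × W) × ℝ, ℂ) →L[ℂ] 𝓢((V × W) × ℝ, ℂ) :=
  SchwartzMap.smulLeftCLM (𝕜 := ℂ) ℂ fun q : (V × W) × ℝ => ((inner ℝ q.1.1 v : ℝ) : ℂ)

omit [FiniteDimensional ℝ V] [FiniteDimensional ℝ W] in
theorem innerMul_apply (v : V) (g : 𝓢((V × W) × ℝ, ℂ)) (q : (V × W) × ℝ) :
    innerMul v g q = (inner ℝ q.1.1 v : ℝ) * g q := by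
  rw [innerMul, SchwartzMap.smulLeftCLM_apply_apply (hasTemperateGrowth_inner_fst_fst v),
    smul_eq_mul]

/-- The operator that corresponds to the derivative in the direction `v` under
`g ↦ (𝓕 g)((ξ / |ξ|, η), |ξ|)`. -/
def polarLiftAux (v : V × W) : radialMomentSubmodule V W →L[ℂ] 𝓢((V × W) × ℝ, ℂ) :=
  (2 * Real.pi * Complex.I : ℂ) • (sphereDerivPrimitive v.1 -
      ((innerMul v.1).comp (sndPowMul (V × W) 1)).comp (radialMomentSubmodule V W).subtypeL) +
    (lineDerivOpCLM ℂ 𝓢((V × W) × ℝ, ℂ) (((0, v.2), 0) : (V × W) × ℝ)).comp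
      (radialMomentSubmodule V W).subtypeL

theorem polarLiftAux_apply (v : V × W) (g : radialMomentSubmodule V W) :
    polarLiftAux v g = (2 * Real.pi * Complex.I : ℂ) • (sphereDerivPrimitive v.1 g +
        (-1 : ℂ) • innerMul v.1 (sndPowMul (V × W) 1 (g : 𝓢((V × W) × ℝ, ℂ)))) +
      ∂_{(((0, v.2), 0) : (V × W) × ℝ)} (g : 𝓢((V × W) × ℝ, ℂ)) := by
  rw [neg_one_smul, ← sub_eq_add_neg]
  rfl

/-- With `P` and `Q` the homogeneous functions of orders `m + 1` and `m`, the new moment is `-2πi/(m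
+ 1) ∂_v P` plus the `η`-derivative of `Q`. The primitive contributes `⟪p, v⟫ P`, which is not
homogeneous of degree `m`; the term `-⟪p, v⟫ s g` in the operator is exactly what cancels it. -/
theorem polarLiftAux_mem (v : V × W) (g : radialMomentSubmodule V W) :
    polarLiftAux v g ∈ radialMomentSubmodule V W := by
  intro m
  obtain ⟨P, hP, hPm⟩ := g.2 (m + 1)
  obtain ⟨Q, hQ, hQm⟩ := g.2 m
  refine ⟨_, ((hP.fderiv_fst v.1).smul (-(2 * Real.pi * Complex.I : ℂ) / (m + 1))).add
    (hQ.fderiv_snd v.2), fun p η hp => ?_⟩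
  have h1 := sndMoment_sphereDerivPrimitive v.1 g m (p, η)
  rw [sndMoment_sphereDeriv hP hPm hp] at h1
  have h2 : sndMoment m (innerMul v.1 (sndPowMul (V × W) 1 (g : 𝓢((V × W) × ℝ, ℂ)))) (p, η) =
      (inner ℝ p v.1 : ℝ) * P (p, η) := by
    rw [sndMoment_smul_apply (g₂ := sndPowMul (V × W) 1 (g : 𝓢((V × W) × ℝ, ℂ))) (a₂ := (p, η))
      (c := ((inner ℝ p v.1 : ℝ) : ℂ)) (fun s => innerMul_apply v.1 _ ((p, η), s)), sndMoment_sndPowMul_one,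
      hPm p η hp]
  obtain ⟨h3, h4⟩ := sndMoment_lineDeriv m (g : 𝓢((V × W) × ℝ, ℂ)) (p, η) ((0, v.2) : V × W)
  have h5 : HasFDerivAt (fun ζ => sndMoment m (g : 𝓢((V × W) × ℝ, ℂ)) (p, ζ)) _ η :=
    HasFDerivAt.comp (g := sndMoment m (g : 𝓢((V × W) × ℝ, ℂ))) η h3 (hasFDerivAt_prodMk_right p η)
  have h6 : HasFDerivAt (fun ζ => Q (p, ζ)) _ η :=
    ((hQ.1.differentiable (by simp)) (p, η)).hasFDerivAt.comp η (hasFDerivAt_prodMk_right p η)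
  rw [show (fun ζ => sndMoment m (g : 𝓢((V × W) × ℝ, ℂ)) (p, ζ)) = fun ζ => Q (p, ζ) from
    funext fun ζ => hQm p ζ hp] at h5
  have h7 : fderiv ℝ (sndMoment m (g : 𝓢((V × W) × ℝ, ℂ))) (p, η) (0, v.2) =
      fderiv ℝ Q (p, η) (0, v.2) := congrArg (fun L => L v.2) (h5.unique h6)
  have hm : (m : ℂ) + 1 ≠ 0 := by exact_mod_cast m.succ_ne_zero
  rw [polarLiftAux_apply, sndMoment_add, sndMoment_smul, sndMoment_add, sndMoment_smul, h2, h4, h7,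
    Pi.add_apply, Pi.smul_apply, smul_eq_mul]
  push_cast at h1
  have h8 : sndMoment m (sphereDerivPrimitive v.1 g) (p, η) = (inner ℝ p v.1 : ℝ) * P (p, η) -
      fderiv ℝ P (p, η) (v.1, 0) / (m + 1) := by
    field_simp
    rw [mul_comm, h1]
    ring
  rw [h8]
  ring

/-- The operator that corresponds to the derivative in the direction `v` under
`g ↦ (𝓕 g)((ξ / |ξ|, η), |ξ|)`, on the functions that satisfy the moment condition. -/
def polarLift (v : V × W) : radialMomentSubmodule V W →L[ℂ] radialMomentSubmodule V W :=
  (polarLiftAux v).codRestrict _ (polarLiftAux_mem v)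

end PolarLift

/-! ### The inverse of the polar pullback is Schwartz -/

section PolarInverse

open LineDeriv

variable {V W : Type*} [NormedAddCommGroup V] [InnerProductSpace ℝ V] [FiniteDimensional ℝ V]
  [NormedAddCommGroup W] [NormedSpace ℝ W] [FiniteDimensional ℝ W]

open Classical in
/-- The direction of `ξ`, with the value `e` at zero. -/
def unitDir (e ξ : V) : V := if ξ = 0 then e else ‖ξ‖⁻¹ • ξ

omit [FiniteDimensional ℝ V] in
theorem norm_unitDir {e : V} (he : ‖e‖ = 1) (ξ : V) : ‖unitDir e ξ‖ = 1 := by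
  by_cases h : ξ = 0
  · simp [unitDir, h, he]
  · simp [unitDir, h, norm_smul]

omit [FiniteDimensional ℝ V] in
theorem norm_smul_unitDir (e ξ : V) : ‖ξ‖ • unitDir e ξ = ξ := by
  by_cases h : ξ = 0
  · simp [unitDir, h]
  · simp [unitDir, h, smul_smul]

theorem partialFourier_zero_eq {g : 𝓢((V × W) × ℝ, ℂ)} (hg : g ∈ radialMomentSubmodule V W)
    {p q : V} (hp : ‖p‖ = 1) (hq : ‖q‖ = 1) (η : W) :
    partialFourier (V × W) ℝ g ((p, η), 0) = partialFourier (V × W) ℝ g ((q, η), 0) := by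
  obtain ⟨P, hP, h⟩ := hg 0
  have h0 : ∀ p : V, P (p, η) = P (0, η) := fun p => by
    have := hP.2 0 p η
    rw [zero_smul] at this
    simp [this]
  rw [← sndMoment_zero, ← sndMoment_zero, h p η hp, h q η hq, h0 p, h0 q]

/-- The function `(ξ, η) ↦ (𝓕 g)((ξ / |ξ|, η), |ξ|)`. -/
def polarInverseLM (e : V) : radialMomentSubmodule V W →ₗ[ℂ] (V × W → ℂ) where
  toFun g x := partialFourier (V × W) ℝ (g : 𝓢((V × W) × ℝ, ℂ)) ((unitDir e x.1, x.2), ‖x.1‖)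
  map_add' f g := by
    ext x
    change partialFourier (V × W) ℝ ((f : 𝓢((V × W) × ℝ, ℂ)) + (g : 𝓢((V × W) × ℝ, ℂ))) _ = _
    rw [map_add]
    rfl
  map_smul' c f := by
    ext x
    change partialFourier (V × W) ℝ (c • (f : 𝓢((V × W) × ℝ, ℂ))) _ = _
    rw [map_smul]
    rfl

theorem polarInverseLM_apply (e : V) (g : radialMomentSubmodule V W) (x : V × W) :
    polarInverseLM e g x =
      partialFourier (V × W) ℝ (g : 𝓢((V × W) × ℝ, ℂ)) ((unitDir e x.1, x.2), ‖x.1‖) := rfl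

/-- The re-extension has degree zero near the sphere, so the direction may be normalised by the
fixed number `‖x.1‖` instead of `‖y.1‖`; the first argument then depends linearly on `y`. -/
theorem polarInverseLM_eventuallyEq (e : V) (g : radialMomentSubmodule V W) {x : V × W}
    (hx : x.1 ≠ 0) : polarInverseLM e g =ᶠ[nhds x] fun y =>
      partialFourier (V × W) ℝ (sphereReextendProd V W (g : 𝓢((V × W) × ℝ, ℂ)))
        ((‖x.1‖⁻¹ • y.1, y.2), ‖y.1‖) := by
  have hx0 : 0 < ‖x.1‖ := norm_pos_iff.2 hx
  have hc : Continuous fun y : V × W => ‖x.1‖⁻¹ * ‖y.1‖ := by fun_prop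
  have hn : ∀ᶠ y : V × W in nhds x, ‖x.1‖⁻¹ * ‖y.1‖ ∈ Set.Ioo (3 / 4 : ℝ) (3 / 2) :=
    hc.continuousAt (isOpen_Ioo.mem_nhds (by rw [inv_mul_cancel₀ hx0.ne']; norm_num))
  filter_upwards [hn] with y hy
  have hy' : ‖‖x.1‖⁻¹ • y.1‖ = ‖x.1‖⁻¹ * ‖y.1‖ := by rw [norm_smul, norm_inv, norm_norm]
  have hy0 : y.1 ≠ 0 := by
    intro h
    rw [h] at hy
    norm_num at hy
  rw [← hy'] at hy
  rw [polarInverseLM_apply]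
  refine (partialFourier_congr (fun s => ?_) ‖y.1‖).symm
  rw [sphereReextendProd_eq_of_norm _ hy.1.le hy.2.le, hy', unitDir, if_neg hy0, smul_smul]
  congr 4
  field_simp

theorem partialFourier_lineDeriv_fst {A B : Type*} [NormedAddCommGroup A] [NormedSpace ℝ A]
    [FiniteDimensional ℝ A] [NormedAddCommGroup B] [InnerProductSpace ℝ B] [FiniteDimensional ℝ B]
    [MeasurableSpace B] [BorelSpace B] (a : A) (g : 𝓢(A × B, ℂ)) (p : A × B) :
    fderiv ℝ (partialFourier A B g) p (a, 0) =
      partialFourier A B (∂_{((a, 0) : A × B)} g) p := by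
  rw [fderiv_partialFourier]
  congr 2
  ext q
  rw [partialFourierDeriv_apply, SchwartzMap.lineDerivOp_apply_eq_fderiv]
  simp

theorem fderiv_partialFourier_snd {A : Type*} [NormedAddCommGroup A] [NormedSpace ℝ A]
    [FiniteDimensional ℝ A] (g : 𝓢(A × ℝ, ℂ)) (p : A × ℝ) :
    fderiv ℝ (partialFourier A ℝ g) p (0, 1) =
      -(2 * Real.pi * Complex.I) * partialFourier A ℝ (sndPowMul A 1 g) p := by
  rw [fderiv_partialFourier]
  have : partialFourierDeriv ((0, 1) : A × ℝ) g =
      (-(2 * Real.pi * Complex.I) : ℂ) • sndPowMul A 1 g := by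
    ext q
    rw [partialFourierDeriv_apply, smul_apply, sndPowMul_apply]
    simp [← Prod.zero_eq_mk]
    ring
  rw [this, map_smul]
  rfl

/-- The chain rule in polar coordinates. The angular part carries `r⁻¹`, the radial part multiplies
`g` by `-2πi ⟪θ, v⟫ s`, and the parameter part is an ordinary derivative. -/
theorem polarInverseLM_fderiv {e : V} (g : radialMomentSubmodule V W) {x : V × W}
    (hx : x.1 ≠ 0) : DifferentiableAt ℝ (polarInverseLM e g) x ∧
      ∀ v, fderiv ℝ (polarInverseLM e g) x v = polarInverseLM e (polarLift v g) x := by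
  have hx0 : 0 < ‖x.1‖ := norm_pos_iff.2 hx
  set r : ℝ := ‖x.1‖ with hr
  set θ : V := r⁻¹ • x.1 with hθ
  have hθ1 : ‖θ‖ = 1 := by rw [hθ, norm_smul, norm_inv, Real.norm_of_nonneg hx0.le, ← hr,
    inv_mul_cancel₀ hx0.ne']
  set gt := sphereReextendProd V W (g : 𝓢((V × W) × ℝ, ℂ)) with hgt
  have h1 : HasFDerivAt (fun y : V × W => ((r⁻¹ • y.1, y.2), ‖y.1‖))
      (((r⁻¹ • ContinuousLinearMap.fst ℝ V W).prod (ContinuousLinearMap.snd ℝ V W)).prod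
        ((‖x.1‖⁻¹ • innerSL ℝ x.1).comp (ContinuousLinearMap.fst ℝ V W))) x :=
    (((hasFDerivAt_fst (p := x)).const_smul r⁻¹).prodMk hasFDerivAt_snd).prodMk
      ((hasFDerivAt_norm_of_ne_zero hx).comp x hasFDerivAt_fst)
  have h2 := ((partialFourier (V × W) ℝ gt).hasFDerivAt ((θ, x.2), r)).comp x h1
  have h3 := h2.congr_of_eventuallyEq (polarInverseLM_eventuallyEq e g hx)
  refine ⟨h3.differentiableAt, fun v => ?_⟩
  have hu : unitDir e x.1 = θ := by rw [unitDir, if_neg hx]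
  rw [h3.fderiv]
  have h4 : (((r⁻¹ • ContinuousLinearMap.fst ℝ V W).prod (ContinuousLinearMap.snd ℝ V W)).prod
        ((‖x.1‖⁻¹ • innerSL ℝ x.1).comp (ContinuousLinearMap.fst ℝ V W))) v =
      (r⁻¹ • (((v.1, 0), 0) : (V × W) × ℝ) + (((0, v.2), 0) : (V × W) × ℝ)) +
        (inner ℝ θ v.1 : ℝ) • ((0, 1) : (V × W) × ℝ) := by
    ext <;> simp [hθ, hr, inner_smul_left]
  rw [ContinuousLinearMap.comp_apply, h4, map_add, map_add, map_smul, map_smul,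
    partialFourier_lineDeriv_fst, partialFourier_lineDeriv_fst, fderiv_partialFourier_snd,
    polarInverseLM_apply, hu, ← hr]
  change _ = partialFourier (V × W) ℝ (polarLiftAux v g) _
  rw [polarLiftAux_apply, map_add, map_smul, map_add, map_smul]
  -- The factor `r` gained by writing the angular derivative through its primitive cancels the `r⁻¹`
  -- of the chain rule.
  have h5 : partialFourier (V × W) ℝ (∂_{(((v.1, 0), 0) : (V × W) × ℝ)} gt) ((θ, x.2), r) =
      2 * Real.pi * Complex.I * (r : ℂ) *
        partialFourier (V × W) ℝ (sphereDerivPrimitive v.1 g) ((θ, x.2), r) := by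
    rw [partialFourier_sphereDerivPrimitive v.1 g ((θ, x.2), r)]
    exact partialFourier_congr (fun s => (sphereReextendProd_eq_of_norm_one _ hθ1 _ s).symm) r
  have h6 : partialFourier (V × W) ℝ (sndPowMul (V × W) 1 gt) ((θ, x.2), r) =
      partialFourier (V × W) ℝ (sndPowMul (V × W) 1 (g : 𝓢((V × W) × ℝ, ℂ))) ((θ, x.2), r) := by
    refine partialFourier_congr (fun s => ?_) r
    rw [sndPowMul_apply, sndPowMul_apply, hgt, sphereReextendProd_eq_of_norm_one _ hθ1]
  have h7 : partialFourier (V × W) ℝ (innerMul v.1 (sndPowMul (V × W) 1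
      (g : 𝓢((V × W) × ℝ, ℂ)))) ((θ, x.2), r) = (inner ℝ θ v.1 : ℝ) *
      partialFourier (V × W) ℝ (sndPowMul (V × W) 1 (g : 𝓢((V × W) × ℝ, ℂ))) ((θ, x.2), r) :=
    partialFourier_smul_apply (fun s => innerMul_apply v.1 _ ((θ, x.2), s)) r
  have h8 : partialFourier (V × W) ℝ (∂_{(((0, v.2), 0) : (V × W) × ℝ)} gt) ((θ, x.2), r) =
      partialFourier (V × W) ℝ (∂_{(((0, v.2), 0) : (V × W) × ℝ)} (g : 𝓢((V × W) × ℝ, ℂ)))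
        ((θ, x.2), r) := by
    refine partialFourier_congr (fun s => ?_) r
    rw [SchwartzMap.lineDerivOp_apply, SchwartzMap.lineDerivOp_apply, lineDeriv, lineDeriv]
    congr 1
    ext t
    have h9 : (((θ, x.2), s) : (V × W) × ℝ) + t • ((0, v.2), 0) = ((θ, x.2 + t • v.2), s) := by
      simp
    rw [h9, hgt, sphereReextendProd_eq_of_norm_one _ hθ1]
  rw [h5, h6, h8]
  simp only [add_apply, smul_apply, smul_eq_mul, h7, Complex.real_smul]
  have hr0 : (r : ℂ) ≠ 0 := by exact_mod_cast hx0.ne'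
  push_cast
  field_simp
  ring

/-- At `ξ = 0` the value is the moment of order zero, the same for all directions; the mean value
inequality in `σ` bounds the deviation by `C ‖ξ‖`, uniformly in the direction. -/
theorem continuous_polarInverseLM {e : V} (he : ‖e‖ = 1) (g : radialMomentSubmodule V W) :
    Continuous (polarInverseLM e g) := by
  rw [continuous_iff_continuousAt]
  intro x
  by_cases hx : x.1 = 0
  · set G := partialFourier (V × W) ℝ (g : 𝓢((V × W) × ℝ, ℂ)) with hG
    have hc : ContinuousAt (fun y : V × W => G ((e, y.2), 0)) x := by fun_prop
    have h0 : polarInverseLM e g x = G ((e, x.2), 0) := by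
      rw [polarInverseLM_apply, hx, unitDir, if_pos rfl, norm_zero]
    obtain ⟨C, hC⟩ := G.decay 0 1
    have hL : ∀ y : V × W, ‖polarInverseLM e g y - G ((e, y.2), 0)‖ ≤ C * ‖y.1‖ := by
      intro y
      rw [polarInverseLM_apply, ← partialFourier_zero_eq g.2 (norm_unitDir he y.1) he, ← hG]
      have h1 := Convex.norm_image_sub_le_of_norm_fderiv_le (𝕜 := ℝ) (f := G) (C := C)
        (s := Set.univ) (x := ((unitDir e y.1, y.2), 0)) (y := ((unitDir e y.1, y.2), ‖y.1‖))
        (fun z _ => G.differentiableAt) (fun z _ => by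
          have := hC.2 z
          rwa [pow_zero, one_mul, norm_iteratedFDeriv_one] at this) convex_univ (Set.mem_univ _)
        (Set.mem_univ _)
      simpa using h1
    rw [ContinuousAt, h0]
    have h2 : Filter.Tendsto (fun y : V × W => polarInverseLM e g y - G ((e, y.2), 0)) (nhds x)
        (nhds 0) := by
      refine squeeze_zero_norm hL ?_
      have : Continuous fun y : V × W => C * ‖y.1‖ := by fun_prop
      have h3 := this.tendsto x
      rwa [hx, norm_zero, mul_zero] at h3
    have h3 := h2.add hc
    simpa using h3
  · exact (polarInverseLM_fderiv g hx).1.continuousAt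

theorem polarInverseLM_differentiable {e : V} (he : ‖e‖ = 1) (g : radialMomentSubmodule V W) :
    Differentiable ℝ (polarInverseLM e g) ∧
      ∀ x v, fderiv ℝ (polarInverseLM e g) x v = polarInverseLM e (polarLift v g) x := by
  -- The exceptional set `ξ = 0` is enlarged to the hyperplane `⟪e, ξ⟫ = 0`, whose two sides are
  -- convex.
  have hℓ : (innerSL ℝ e).comp (ContinuousLinearMap.fst ℝ V W) ≠ 0 := by
    intro h
    have := congrArg (fun L => L (e, 0)) h
    simp [he] at this
  have h0 : ∀ y : V × W, ((innerSL ℝ e).comp (ContinuousLinearMap.fst ℝ V W)) y ≠ 0 → y.1 ≠ 0 := by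
    intro y hy h
    exact hy (by simp [h])
  exact differentiable_of_fderiv_extends hℓ (continuous_polarInverseLM he g)
    (fun v => continuous_polarInverseLM he (polarLift v g))
    (fun y hy => (polarInverseLM_fderiv g (h0 y hy)).1)
    (fun y hy v => (polarInverseLM_fderiv g (h0 y hy)).2 v)

theorem exists_polarInverse {e : V} (he : ‖e‖ = 1) :
    ∃ S : radialMomentSubmodule V W →L[ℂ] 𝓢(V × W, ℂ), ∀ g x, S g x = polarInverseLM e g x := by
  refine exists_clm_schwartz_of_fderiv_lift (polarInverseLM e) polarLift
    (fun g => (polarInverseLM_differentiable he g).1)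
    (fun g x v => (polarInverseLM_differentiable he g).2 x v) fun k => ?_
  -- Polar coordinates lose no weight: `‖(ξ, η)‖` is at most the norm of the polar argument.
  refine ⟨(SchwartzMap.seminorm ℂ k 0).comp ((partialFourier (V × W) ℝ).comp
    (radialMomentSubmodule V W).subtypeL).toLinearMap, ?_, fun g x => ?_⟩
  · exact ((schwartz_withSeminorms ℂ ((V × W) × ℝ) ℂ).continuous_seminorm (k, 0)).comp
      ((partialFourier (V × W) ℝ).comp (radialMomentSubmodule V W).subtypeL).continuous
  · refine le_trans ?_ (SchwartzMap.norm_pow_mul_le_seminorm ℂ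
      (partialFourier (V × W) ℝ (g : 𝓢((V × W) × ℝ, ℂ))) k ((unitDir e x.1, x.2), ‖x.1‖))
    rw [polarInverseLM_apply]
    gcongr
    refine max_le ?_ ?_
    · exact (le_of_eq (by simp)).trans (le_max_right _ _)
    · exact (le_max_right _ _).trans (le_max_left _ _)

/-- The operator `g ↦ (𝓕 g)((ξ / |ξ|, η), |ξ|)` from the Schwartz functions that satisfy the moment
condition to Schwartz functions. -/
def polarInverse {e : V} (he : ‖e‖ = 1) : radialMomentSubmodule V W →L[ℂ] 𝓢(V × W, ℂ) :=
  (exists_polarInverse he).choose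

theorem polarInverse_apply {e : V} (he : ‖e‖ = 1) (g : radialMomentSubmodule V W) (x : V × W) :
    polarInverse he g x =
      partialFourier (V × W) ℝ (g : 𝓢((V × W) × ℝ, ℂ)) ((unitDir e x.1, x.2), ‖x.1‖) :=
  (exists_polarInverse he).choose_spec g x

end PolarInverse

/-! ### Integrals over parallel hyperplanes and the projection-slice theorem -/

section SliceIntegral

open FourierTransform

variable {V U : Type*} [NormedAddCommGroup V] [InnerProductSpace ℝ V] [FiniteDimensional ℝ V]
  [MeasurableSpace V] [BorelSpace V]
  [NormedAddCommGroup U] [InnerProductSpace ℝ U] [FiniteDimensional ℝ U]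
  [MeasurableSpace U] [BorelSpace U]

/-- Exchange of the two variables of a Schwartz function. -/
def schwartzSwap (A B : Type*) [NormedAddCommGroup A] [NormedSpace ℝ A] [NormedAddCommGroup B]
    [NormedSpace ℝ B] : 𝓢(A × B, ℂ) →L[ℂ] 𝓢(B × A, ℂ) :=
  SchwartzMap.compCLMOfContinuousLinearEquiv ℂ (ContinuousLinearEquiv.prodComm ℝ B A)

/-- Isometric coordinates on `V` with values in `ℝ × U`. -/
abbrev SliceIsometry (U V : Type*) [NormedAddCommGroup U] [InnerProductSpace ℝ U]
    [NormedAddCommGroup V] [InnerProductSpace ℝ V] := WithLp 2 (ℝ × U) ≃ₗᵢ[ℝ] V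

theorem measurePreserving_slice (ι : SliceIsometry U V) :
    MeasurePreserving (fun q : ℝ × U => ι (WithLp.toLp 2 q)) :=
  ι.measurePreserving.comp (WithLp.volume_preserving_toLp ℝ U)

/-- Orthonormal coordinates as a continuous linear equivalence. -/
def sliceCoord (ι : SliceIsometry U V) : (ℝ × U) ≃L[ℝ] V :=
  (WithLp.prodContinuousLinearEquiv 2 ℝ ℝ U).symm.trans ι.toContinuousLinearEquiv

/-- The integrals of a Schwartz function over parallel hyperplanes, as a Schwartz function. -/
def sliceIntegral (ι : SliceIsometry U V) (h : 𝓢(V, ℂ)) : 𝓢(ℝ, ℂ) :=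
  schwartzSlice (0 : U) (schwartzSwap ℝ U (partialFourier ℝ U
    (SchwartzMap.compCLMOfContinuousLinearEquiv ℂ (sliceCoord ι) h)))

omit [FiniteDimensional ℝ V] [MeasurableSpace V] [BorelSpace V] in
theorem sliceIntegral_apply (ι : SliceIsometry U V) (h : 𝓢(V, ℂ)) (s : ℝ) :
    sliceIntegral ι h s = ∫ u : U, h (ι (WithLp.toLp 2 (s, u))) :=
  partialFourier_apply_zero _ s

omit [FiniteDimensional ℝ V] [MeasurableSpace V] [BorelSpace V] in
theorem integrable_slice (ι : SliceIsometry U V) (h : 𝓢(V, ℂ)) (s : ℝ) :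
    Integrable fun u : U => h (ι (WithLp.toLp 2 (s, u))) :=
  (schwartzSlice s (SchwartzMap.compCLMOfContinuousLinearEquiv ℂ (sliceCoord ι) h)).integrable

/-- Fubini, since `κ (⟪θ, x⟫)` is constant on the hyperplanes. An exponential `κ` gives the
projection-slice theorem, a power gives the moments. -/
theorem integral_mul_sliceIntegral (ι : SliceIsometry U V) {θ : V}
    (hι : ∀ q : ℝ × U, inner ℝ θ (ι (WithLp.toLp 2 q)) = q.1) (h : 𝓢(V, ℂ)) {κ : ℝ → ℂ}
    (hκ : Integrable fun x => κ (inner ℝ θ x) * h x) :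
    ∫ s, κ s * sliceIntegral ι h s =
      ∫ x, κ (inner ℝ θ x) * h x := by
  have hmp := measurePreserving_slice ι
  have hemb : MeasurableEmbedding (fun q : ℝ × U => ι (WithLp.toLp 2 q)) :=
    (sliceCoord ι).toHomeomorph.measurableEmbedding
  rw [← hmp.integral_comp hemb]
  rw [← hmp.integrable_comp_emb hemb] at hκ
  simp only [Function.comp_def, hι] at hκ ⊢
  rw [Measure.volume_eq_prod, integral_prod _ hκ]
  simp_rw [integral_const_mul, sliceIntegral_apply]

theorem fourier_sliceIntegral (ι : SliceIsometry U V) {θ : V}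
    (hι : ∀ q : ℝ × U, inner ℝ θ (ι (WithLp.toLp 2 q)) = q.1) (h : 𝓢(V, ℂ)) (σ : ℝ) :
    𝓕 (sliceIntegral ι h) σ = 𝓕 h (σ • θ) := by
  rw [SchwartzMap.fourier_coe, SchwartzMap.fourier_coe, Real.fourier_eq', Real.fourier_eq']
  simp only [smul_eq_mul, inner_smul_right]
  have key := integral_mul_sliceIntegral ι hι h
    (κ := fun s => Complex.exp (↑(-2 * Real.pi * (σ * s)) * Complex.I)) ?_
  · simp_rw [real_inner_comm θ]
    rw [← key]
    refine integral_congr_ae (Filter.Eventually.of_forall fun s => ?_)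
    simp
  · refine h.integrable.norm.mono' ?_ (Filter.Eventually.of_forall fun x => ?_)
    · have : Continuous fun x => Complex.exp (↑(-2 * Real.pi *
          (σ * inner ℝ θ x)) * Complex.I) * h x := by fun_prop
      exact this.aestronglyMeasurable
    · rw [norm_mul, Complex.norm_exp_ofReal_mul_I, one_mul]

/-- The isometry `(s, u) ↦ s θ + u`. -/
def perpCoord {θ : V} (hθ : ‖θ‖ = 1) : SliceIsometry (ℝ ∙ θ)ᗮ V :=
  (LinearIsometryEquiv.withLpProdCongr 2 (LinearIsometryEquiv.toSpanUnitSingleton (𝕜 := ℝ) θ hθ)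
    (LinearIsometryEquiv.refl ℝ (ℝ ∙ θ)ᗮ)).trans
    (Submodule.orthogonalDecomposition (ℝ ∙ θ)).symm

omit [FiniteDimensional ℝ V] [MeasurableSpace V] [BorelSpace V] in
theorem perpCoord_apply {θ : V} (hθ : ‖θ‖ = 1) (q : ℝ × (ℝ ∙ θ)ᗮ) :
    perpCoord hθ (WithLp.toLp 2 q) = q.1 • θ + q.2 := by
  simp [perpCoord]

omit [FiniteDimensional ℝ V] [MeasurableSpace V] [BorelSpace V] in
theorem inner_perpCoord {θ : V} (hθ : ‖θ‖ = 1) (q : ℝ × (ℝ ∙ θ)ᗮ) :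
    inner ℝ θ (perpCoord hθ (WithLp.toLp 2 q)) = q.1 := by
  rw [perpCoord_apply, inner_add_right, inner_smul_right, real_inner_self_eq_norm_sq, hθ,
    Submodule.mem_orthogonal_singleton_iff_inner_right.1 q.2.2]
  ring

end SliceIntegral

/-! ### The transform and its inversion on the ambient Schwartz spaces -/

section KPlane

open FourierTransform

variable (V W : Type*) [NormedAddCommGroup V] [InnerProductSpace ℝ V] [FiniteDimensional ℝ V]
  [MeasurableSpace V] [BorelSpace V]
  [NormedAddCommGroup W] [NormedSpace ℝ W] [FiniteDimensional ℝ W]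

/-- The partial Fourier transform in the first variable. -/
def fstFourier : 𝓢(V × W, ℂ) →L[ℂ] 𝓢(V × W, ℂ) :=
  (schwartzSwap W V).comp ((partialFourier W V).comp (schwartzSwap V W))

/-- The inverse partial Fourier transform in the first variable. -/
def fstFourierInv : 𝓢(V × W, ℂ) →L[ℂ] 𝓢(V × W, ℂ) :=
  (schwartzSwap W V).comp ((partialFourierInv W V).comp (schwartzSwap V W))

variable {V W}

/-- The slice of a Schwartz function in the first variable. -/
def schwartzSliceFst (η : W) (f : 𝓢(V × W, ℂ)) : 𝓢(V, ℂ) := schwartzSlice η (schwartzSwap V W f)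

theorem fstFourier_apply (f : 𝓢(V × W, ℂ)) (ξ : V) (η : W) :
    fstFourier V W f (ξ, η) = 𝓕 (schwartzSliceFst η f) ξ :=
  partialFourier_apply (schwartzSwap V W f) (η, ξ)

theorem fstFourierInv_fstFourier (f : 𝓢(V × W, ℂ)) : fstFourierInv V W (fstFourier V W f) = f :=
  congrArg (schwartzSwap W V) (partialFourierInv_partialFourier (schwartzSwap V W f))

theorem fstFourier_fstFourierInv (f : 𝓢(V × W, ℂ)) : fstFourier V W (fstFourierInv V W f) = f :=
  congrArg (schwartzSwap W V) (partialFourier_partialFourierInv (schwartzSwap V W f))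

variable (V W) in
/-- A Schwartz function of `((p, η), s)` whose values for `|p| = 1` are the integrals of `f` over
the planes `⟪p, x⟫ = s`. -/
def kPlaneLift : 𝓢(V × W, ℂ) →L[ℂ] 𝓢((V × W) × ℝ, ℂ) :=
  (partialFourierInv (V × W) ℝ).comp ((polarPullback V W).comp (fstFourier V W))

omit [MeasurableSpace V] [BorelSpace V] in
theorem sphereCutoff_of_norm_one {p : V} (hp : ‖p‖ = 1) : sphereCutoff V p = 1 :=
  sphereCutoff_eq_one V (by rw [hp]; norm_num) (by rw [hp]; norm_num)

omit [MeasurableSpace V] [BorelSpace V] in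
omit [FiniteDimensional ℝ W] in
theorem polarPullback_of_norm_one (F : 𝓢(V × W, ℂ)) {p : V} (hp : ‖p‖ = 1) (η : W) (σ : ℝ) :
    polarPullback V W F ((p, η), σ) = F (σ • p, η) := by
  rw [polarPullback_apply, sphereCutoff_of_norm_one hp, one_mul]

theorem partialFourier_kPlaneLift (f : 𝓢(V × W, ℂ)) {p : V} (hp : ‖p‖ = 1) (η : W) (σ : ℝ) :
    partialFourier (V × W) ℝ (kPlaneLift V W f) ((p, η), σ) = fstFourier V W f (σ • p, η) := by
  change partialFourier (V × W) ℝ (partialFourierInv (V × W) ℝ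
    (polarPullback V W (fstFourier V W f))) ((p, η), σ) = _
  rw [partialFourier_partialFourierInv, polarPullback_of_norm_one _ hp]

theorem ext_of_partialFourier {A B : Type*} [NormedAddCommGroup A] [NormedSpace ℝ A]
    [FiniteDimensional ℝ A] [NormedAddCommGroup B] [InnerProductSpace ℝ B] [FiniteDimensional ℝ B]
    [MeasurableSpace B] [BorelSpace B] {g : 𝓢(A × B, ℂ)} {h : 𝓢(B, ℂ)} {a : A}
    (H : ∀ b, partialFourier A B g (a, b) = 𝓕 h b) (b : B) : g (a, b) = h b := by
  have h1 : 𝓕 (schwartzSlice a g) = 𝓕 h := by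
    ext b
    rw [← H, partialFourier_apply]
  have h2 := congrArg (fun k : 𝓢(B, ℂ) => 𝓕⁻ k) h1
  simp only [FourierPair.fourierInv_fourier_eq] at h2
  exact congrArg (fun k : 𝓢(B, ℂ) => k b) h2

/-- The lift is defined on the Fourier side; by the projection-slice theorem both sides have the
same Fourier transform in `s`. -/
theorem kPlaneLift_eq_sliceIntegral {U : Type*} [NormedAddCommGroup U] [InnerProductSpace ℝ U]
    [FiniteDimensional ℝ U] [MeasurableSpace U] [BorelSpace U] (ι : SliceIsometry U V)
    {p : V} (hp : ‖p‖ = 1) (hι : ∀ q : ℝ × U, inner ℝ p (ι (WithLp.toLp 2 q)) = q.1)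
    (f : 𝓢(V × W, ℂ)) (η : W) (s : ℝ) :
    kPlaneLift V W f ((p, η), s) = sliceIntegral ι (schwartzSliceFst η f) s := by
  refine ext_of_partialFourier (fun σ => ?_) s
  rw [partialFourier_kPlaneLift f hp, fourier_sliceIntegral ι hι, fstFourier_apply]

omit [MeasurableSpace V] [BorelSpace V] in
theorem partialFourier_neg_neg {g : 𝓢((V × W) × ℝ, ℂ)} {a₁ a₂ : V × W}
    (h : ∀ s, g (a₁, -s) = g (a₂, s)) (σ : ℝ) :
    partialFourier (V × W) ℝ g (a₁, -σ) = partialFourier (V × W) ℝ g (a₂, σ) := by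
  rw [partialFourier_apply, partialFourier_apply, SchwartzMap.fourier_coe, SchwartzMap.fourier_coe,
    Real.fourier_eq', Real.fourier_eq', ← integral_neg_eq_self]
  refine integral_congr_ae (Filter.Eventually.of_forall fun s => ?_)
  simp only [schwartzSlice_apply, h]
  simp

theorem kPlaneLift_neg (f : 𝓢(V × W, ℂ)) {p : V} (hp : ‖p‖ = 1) (η : W) (s : ℝ) :
    kPlaneLift V W f ((-p, η), -s) = kPlaneLift V W f ((p, η), s) := by
  change partialFourier (V × W) ℝ (polarPullback V W (fstFourier V W f)) ((-p, η), - -s) =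
    partialFourier (V × W) ℝ (polarPullback V W (fstFourier V W f)) ((p, η), -s)
  refine partialFourier_neg_neg (fun σ => ?_) (-s)
  rw [polarPullback_of_norm_one _ (by rwa [norm_neg]), polarPullback_of_norm_one _ hp,
    smul_neg, neg_smul, neg_neg]

omit [MeasurableSpace V] [BorelSpace V] in
theorem polarInverse_eq {e : V} (he : ‖e‖ = 1) (g : radialMomentSubmodule V W) (F : 𝓢(V × W, ℂ))
    (h : ∀ (p : V) (η : W) (σ : ℝ), ‖p‖ = 1 →
      partialFourier (V × W) ℝ (g : 𝓢((V × W) × ℝ, ℂ)) ((p, η), σ) = F (σ • p, η)) :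
    polarInverse he g = F := by
  ext x
  rw [polarInverse_apply, h _ _ _ (norm_unitDir he x.1), norm_smul_unitDir]

-- The polar inverse only reads frequencies `|ξ| ≥ 0`. Evenness supplies `σ < 0`, and at `σ = 0` the
-- moment of order zero makes the default direction irrelevant.
omit [MeasurableSpace V] [BorelSpace V] in
theorem polarInverse_smul {e : V} (he : ‖e‖ = 1) (g : radialMomentSubmodule V W)
    (hg : ∀ (p : V) (η : W) (s : ℝ), ‖p‖ = 1 → (g : 𝓢((V × W) × ℝ, ℂ)) ((-p, η), -s) =
      (g : 𝓢((V × W) × ℝ, ℂ)) ((p, η), s)) {p : V} (hp : ‖p‖ = 1) (η : W) (σ : ℝ) :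
    polarInverse he g (σ • p, η) =
      partialFourier (V × W) ℝ (g : 𝓢((V × W) × ℝ, ℂ)) ((p, η), σ) := by
  have hp0 : p ≠ 0 := by
    rintro rfl
    simp at hp
  rw [polarInverse_apply]
  simp only [norm_smul, hp, mul_one, Real.norm_eq_abs]
  rcases lt_trichotomy σ 0 with hσ | rfl | hσ
  · have h1 : unitDir e (σ • p) = -p := by
      rw [unitDir, if_neg (smul_ne_zero hσ.ne hp0), norm_smul, hp, mul_one, Real.norm_eq_abs,
        abs_of_neg hσ, smul_smul, inv_neg, neg_mul, inv_mul_cancel₀ hσ.ne, neg_one_smul]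
    rw [h1, abs_of_neg hσ]
    exact partialFourier_neg_neg (fun s => hg p η s hp) σ
  · rw [abs_zero]
    exact partialFourier_zero_eq g.2 (norm_unitDir he _) hp η
  · have h1 : unitDir e (σ • p) = p := by
      rw [unitDir, if_neg (smul_ne_zero hσ.ne' hp0), norm_smul, hp, mul_one, Real.norm_eq_abs,
        abs_of_pos hσ, smul_smul, inv_mul_cancel₀ hσ.ne', one_smul]
    rw [h1, abs_of_pos hσ]

theorem kPlaneLift_fstFourierInv_polarInverse {e : V} (he : ‖e‖ = 1)
    (g : radialMomentSubmodule V W)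
    (hg : ∀ (p : V) (η : W) (s : ℝ), ‖p‖ = 1 → (g : 𝓢((V × W) × ℝ, ℂ)) ((-p, η), -s) =
      (g : 𝓢((V × W) × ℝ, ℂ)) ((p, η), s)) {p : V} (hp : ‖p‖ = 1) (η : W) (s : ℝ) :
    kPlaneLift V W (fstFourierInv V W (polarInverse he g)) ((p, η), s) =
      (g : 𝓢((V × W) × ℝ, ℂ)) ((p, η), s) := by
  refine ext_of_partialFourier (h := schwartzSlice (p, η) (g : 𝓢((V × W) × ℝ, ℂ))) (fun σ => ?_) s
  rw [partialFourier_kPlaneLift _ hp, fstFourier_fstFourierInv, polarInverse_smul he g hg hp,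
    partialFourier_apply]

end KPlane

/-! ### Comparison of the norms on the parameter space with Schwartz seminorms -/

section ParamSpace

/-- The space `ℝ^{k+1}` of the first `k + 1` coordinates. -/
abbrev FirstSpace (k : ℕ) : Type := EuclideanSpace ℝ (Fin (k + 1))

/-- The space `ℝ^{n-k-1}` of the last `n - k - 1` coordinates. -/
abbrev LastSpace (n k : ℕ) : Type := EuclideanSpace ℝ (Fin (n - k - 1))

variable {n k : ℕ}

/-- The restriction of a function to the parameter space. -/
def restrictParam (G : FirstSpace k × ℝ × LastSpace n k → ℂ) : ParamSpace n k → ℂ :=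
  fun z => G (z.1, z.2)

theorem homExt_restrictParam (G : FirstSpace k × ℝ × LastSpace n k → ℂ)
    {p : FirstSpace k × ℝ × LastSpace n k} (hp : p.1 ≠ 0) :
    homExt (restrictParam G) p = G (‖p.1‖⁻¹ • p.1, p.2) := by
  rw [homExt, dif_neg hp]
  rfl

theorem isOpen_fst_ne_zero : IsOpen {p : FirstSpace k × ℝ × LastSpace n k | p.1 ≠ 0} :=
  isOpen_ne_fun continuous_fst continuous_const

theorem isSmoothParam_restrictParam (G : 𝓢(FirstSpace k × ℝ × LastSpace n k, ℂ)) :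
    IsSmoothParam (restrictParam G) := by
  have h : ContDiffOn ℝ ∞ (fun p : FirstSpace k × ℝ × LastSpace n k => G (‖p.1‖⁻¹ • p.1, p.2))
      {p | p.1 ≠ 0} := by
    intro p hp
    have h1 : ContDiffAt ℝ ∞ (fun p : FirstSpace k × ℝ × LastSpace n k => ‖p.1‖) p :=
      (contDiffAt_norm ℝ hp).comp p contDiffAt_fst
    have h2 : ContDiffAt ℝ ∞
        (fun p : FirstSpace k × ℝ × LastSpace n k => (‖p.1‖⁻¹ • p.1, p.2)) p :=
      ((h1.inv (norm_ne_zero_iff.2 hp)).smul contDiffAt_fst).prodMk contDiffAt_snd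
    exact ((G.smooth ⊤).contDiffAt.comp p h2).contDiffWithinAt
  exact h.congr fun p hp => homExt_restrictParam G hp

/-- Near the unit sphere the degree-zero extension is itself a Schwartz function, so the derivatives
in `θ` are controlled by Schwartz seminorms. -/
theorem derivNorm_restrictParam (G : 𝓢(FirstSpace k × ℝ × LastSpace n k, ℂ)) (i : ℕ)
    (z : ParamSpace n k) :
    derivNorm (restrictParam G) i z =
      ‖iteratedFDeriv ℝ i (sphereReextend (FirstSpace k) (ℝ × LastSpace n k) G)
        ((z.1 : FirstSpace k), z.2)‖ := by
  have h1 : ‖(z.1 : FirstSpace k)‖ = 1 := norm_eq_of_mem_sphere z.1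
  have hc : Continuous fun y : FirstSpace k × ℝ × LastSpace n k => ‖y.1‖ := by fun_prop
  have hn : ∀ᶠ y : FirstSpace k × ℝ × LastSpace n k in nhds ((z.1 : FirstSpace k), z.2),
      ‖y.1‖ ∈ Set.Ioo (3 / 4 : ℝ) (3 / 2) :=
    hc.continuousAt (isOpen_Ioo.mem_nhds (by rw [h1]; norm_num))
  have h2 : homExt (restrictParam G) =ᶠ[nhds ((z.1 : FirstSpace k), z.2)]
      sphereReextend (FirstSpace k) (ℝ × LastSpace n k) G := by
    filter_upwards [hn] with y hy
    have hy0 : y.1 ≠ 0 := by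
      intro h
      rw [h] at hy
      norm_num at hy
    rw [homExt_restrictParam G hy0, sphereReextend_eq_of_norm _ _ hy.1.le hy.2.le]
  rw [derivNorm, (Filter.EventuallyEq.iteratedFDeriv ℝ h2 i).self_of_nhds]

theorem exists_seminorm_restrictParam (n k m : ℕ) :
    ∃ q : Seminorm ℂ 𝓢(FirstSpace k × ℝ × LastSpace n k, ℂ), Continuous q ∧
      ∀ (G : 𝓢(FirstSpace k × ℝ × LastSpace n k, ℂ)) (i : ℕ) (_ : i ≤ m) (z : ParamSpace n k),
        weight z ^ m * derivNorm (restrictParam G) i z ≤ q G := by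
  -- One factor `2 ^ m` comes from comparing the weight with `1 + ‖·‖`, the other from expanding `(1
  -- + ‖·‖) ^ m` into seminorms.
  obtain ⟨c, hc⟩ : ∃ c : NNReal, (c : ℝ) = 2 ^ m * 2 ^ m := ⟨⟨2 ^ m * 2 ^ m, by positivity⟩, rfl⟩
  refine ⟨(c • (Finset.Iic (m, m)).sup (schwartzSeminormFamily ℂ
    (FirstSpace k × ℝ × LastSpace n k) ℂ)).comp
      (sphereReextend (FirstSpace k) (ℝ × LastSpace n k)).toLinearMap, ?_, fun G i hi z => ?_⟩
  · refine Continuous.comp (g := ⇑(c • (Finset.Iic (m, m)).sup (schwartzSeminormFamily ℂ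
      (FirstSpace k × ℝ × LastSpace n k) ℂ))) (Continuous.const_smul ?_ c)
      (sphereReextend (FirstSpace k) (ℝ × LastSpace n k)).continuous
    exact Seminorm.continuous_finsetSup fun i _ =>
      (schwartz_withSeminorms ℂ (FirstSpace k × ℝ × LastSpace n k) ℂ).continuous_seminorm i
  · rw [derivNorm_restrictParam]
    have hw : weight z ≤ 2 * (1 + ‖((z.1 : FirstSpace k), z.2)‖) := by
      have h1 : |z.2.1| ≤ ‖((z.1 : FirstSpace k), z.2)‖ :=
        (le_max_left _ _).trans (le_max_right _ _)
      have h2 : ‖z.2.2‖ ≤ ‖((z.1 : FirstSpace k), z.2)‖ :=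
        (le_max_right _ _).trans (le_max_right _ _)
      rw [weight]
      linarith
    calc weight z ^ m * ‖iteratedFDeriv ℝ i
          (sphereReextend (FirstSpace k) (ℝ × LastSpace n k) G) ((z.1 : FirstSpace k), z.2)‖
        ≤ (2 * (1 + ‖((z.1 : FirstSpace k), z.2)‖)) ^ m * ‖iteratedFDeriv ℝ i
          (sphereReextend (FirstSpace k) (ℝ × LastSpace n k) G) ((z.1 : FirstSpace k), z.2)‖ := by
          gcongr
          exact (weight_pos z).le
      _ = 2 ^ m * ((1 + ‖((z.1 : FirstSpace k), z.2)‖) ^ m * ‖iteratedFDeriv ℝ i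
          (sphereReextend (FirstSpace k) (ℝ × LastSpace n k) G)
            ((z.1 : FirstSpace k), z.2)‖) := by
          rw [mul_pow, mul_assoc]
      _ ≤ 2 ^ m * (2 ^ m * (Finset.Iic (m, m)).sup (schwartzSeminormFamily ℂ
          (FirstSpace k × ℝ × LastSpace n k) ℂ)
            (sphereReextend (FirstSpace k) (ℝ × LastSpace n k) G)) := by
          refine mul_le_mul_of_nonneg_left ?_ (by positivity)
          exact SchwartzMap.one_add_le_sup_seminorm_apply (𝕜 := ℂ) (m := (m, m)) le_rfl hi
            (sphereReextend (FirstSpace k) (ℝ × LastSpace n k) G) _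
      _ = _ := by
          rw [← mul_assoc, ← hc]
          rfl

theorem isRapidlyDecreasing_restrictParam (G : 𝓢(FirstSpace k × ℝ × LastSpace n k, ℂ)) :
    IsRapidlyDecreasing (restrictParam G) := by
  intro m i
  obtain ⟨q, -, hq⟩ := exists_seminorm_restrictParam n k (max m i)
  refine ⟨q G, fun z => le_trans ?_ (hq G i (le_max_right _ _) z)⟩
  have h1 : 1 ≤ weight z := by
    rw [weight]
    linarith [abs_nonneg z.2.1, norm_nonneg z.2.2]
  exact mul_le_mul_of_nonneg_right (pow_le_pow_right₀ h1 (le_max_left _ _))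
    (derivNorm_nonneg _ _ _)

theorem le_evenSchwartzSeminorm (φ : EvenSchwartz n k) {i j m : ℕ} (hi : i ≤ m) (hj : j ≤ m)
    (z : ParamSpace n k) :
    weight z ^ j * derivNorm φ i z ≤ evenSchwartzSeminorm n k m φ := by
  have h1 : 1 ≤ weight z := by
    rw [weight]
    linarith [abs_nonneg z.2.1, norm_nonneg z.2.2]
  refine (mul_le_mul_of_nonneg_right (pow_le_pow_right₀ h1 hj) (derivNorm_nonneg _ _ _)).trans ?_
  exact le_ciSup (φ.bddAbove m) ((⟨i, Nat.lt_succ_of_le hi⟩, z) : Fin (m + 1) × ParamSpace n k)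

theorem evenSchwartzSeminorm_le {φ : EvenSchwartz n k} {m : ℕ} {C : ℝ}
    (h : ∀ i ≤ m, ∀ z, weight z ^ m * derivNorm φ i z ≤ C) : evenSchwartzSeminorm n k m φ ≤ C := by
  have hne : Nonempty (Fin (m + 1) × ParamSpace n k) := by
    have : Nonempty (Metric.sphere (0 : EuclideanSpace ℝ (Fin (k + 1))) 1) :=
      (NormedSpace.sphere_nonempty.mpr zero_le_one).to_subtype
    infer_instance
  exact ciSup_le fun q => h q.1 (Nat.lt_succ_iff.1 q.1.2) q.2

instance (n k : ℕ) : IsTopologicalAddGroup (EvenSchwartz n k) :=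
  (evenSchwartz_withSeminorms n k).topologicalAddGroup

/-- The function `χ(p) φ(p / |p|, s; x'')` as a linear map in `φ`. -/
def extendParamLM (n k : ℕ) :
    EvenSchwartz n k →ₗ[ℂ] (FirstSpace k × ℝ × LastSpace n k → ℂ) where
  toFun φ x := sphereCutoffFst (FirstSpace k) (ℝ × LastSpace n k) x *
    homExt φ (radialProjFst (FirstSpace k) (ℝ × LastSpace n k) x)
  map_add' φ ψ := by
    ext x
    change _ * homExt (φ.1 + ψ.1) _ = _
    rw [homExt_add]
    exact mul_add _ _ _
  map_smul' c φ := by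
    ext x
    change _ * homExt (c • φ.1) _ = _
    rw [homExt_smul]
    exact mul_left_comm _ _ _

/-- On the support of the cutoff the radial projection lands on the unit sphere, exactly where the
norms of `EvenSchwartz` measure the derivatives of `homExt φ`; thus bounds on the sphere alone
suffice. -/
theorem exists_extendParam (n k : ℕ) :
    ∃ S : EvenSchwartz n k →L[ℂ] 𝓢(FirstSpace k × ℝ × LastSpace n k, ℂ),
      ∀ φ x, S φ x = extendParamLM n k φ x := by
  have hχ := hasTemperateGrowth_sphereCutoffFst (FirstSpace k) (ℝ × LastSpace n k)
  have hΦ := hasTemperateGrowth_radialProjFst (FirstSpace k) (ℝ × LastSpace n k)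
  have hn : ∀ x ∈ tsupport (sphereCutoffFst (FirstSpace k) (ℝ × LastSpace n k)),
      ‖(radialProjFst (FirstSpace k) (ℝ × LastSpace n k) x).1‖ = 1 := by
    intro x hx
    obtain ⟨h1, h2⟩ := mem_of_mem_tsupport_sphereCutoffFst _ _ hx
    change ‖radialProj (FirstSpace k) x.1‖ = 1
    rw [radialProj_eq _ h1 h2, norm_smul, norm_inv, norm_norm, inv_mul_cancel₀ (by linarith)]
  have hmaps : ∀ x ∈ tsupport (sphereCutoffFst (FirstSpace k) (ℝ × LastSpace n k)),
      radialProjFst (FirstSpace k) (ℝ × LastSpace n k) x ∈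
        {p : FirstSpace k × ℝ × LastSpace n k | p.1 ≠ 0} := by
    intro x hx h
    have := hn x hx
    rw [h, norm_zero] at this
    exact zero_ne_one this
  refine exists_clm_schwartz_of_bound (extendParamLM n k)
    (fun φ => contDiff_cut_comp hΦ.1 hχ.1 isOpen_fst_ne_zero φ.2.1 hmaps) fun K l => ?_
  obtain ⟨N, C, hC, h⟩ := cut_comp_bound hΦ hχ
    ⟨1, 2, fun _ => norm_le_of_mem_tsupport_sphereCutoffFst _ _⟩ K l
  obtain ⟨c, hc⟩ : ∃ c : NNReal, (c : ℝ) = C * 2 ^ N := ⟨⟨C * 2 ^ N, by positivity⟩, rfl⟩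
  refine ⟨c • evenSchwartzSeminorm n k (max N l), ?_, fun φ x => ?_⟩
  · exact Continuous.const_smul ((evenSchwartz_withSeminorms n k).continuous_seminorm _) c
  · refine (h (homExt φ) _ isOpen_fst_ne_zero φ.2.1 hmaps
      (2 ^ N * evenSchwartzSeminorm n k (max N l) φ)
      (mul_nonneg (by positivity) (apply_nonneg _ _)) (fun i hi x hx => ?_) x).trans (le_of_eq ?_)
    · set y := radialProjFst (FirstSpace k) (ℝ × LastSpace n k) x with hy
      have hy1 : ‖y.1‖ = 1 := hn x hx
      let z : ParamSpace n k := (⟨y.1, by simp [hy1]⟩, y.2)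
      have hw : 1 + ‖y‖ ≤ 2 * weight z := by
        have h1 : ‖y‖ ≤ weight z := by
          have h2 : weight z = 1 + |y.2.1| + ‖y.2.2‖ := rfl
          rw [h2]
          have h3 := abs_nonneg y.2.1
          have h4 := norm_nonneg y.2.2
          refine max_le (by linarith) (max_le ?_ (by linarith))
          rw [Real.norm_eq_abs]
          linarith
        have h2 : 1 ≤ weight z := by
          rw [weight]
          linarith [abs_nonneg z.2.1, norm_nonneg z.2.2]
        linarith
      calc (1 + ‖y‖) ^ N * ‖iteratedFDeriv ℝ i (homExt φ) y‖
          ≤ (2 * weight z) ^ N * ‖iteratedFDeriv ℝ i (homExt φ) y‖ := by gcongr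
        _ = 2 ^ N * (weight z ^ N * derivNorm φ i z) := by
            rw [mul_pow, mul_assoc]
            rfl
        _ ≤ _ := by
            gcongr
            exact le_evenSchwartzSeminorm φ (hi.trans (le_max_right _ _)) (le_max_left _ _) z
    · rw [← mul_assoc, ← hc]
      rfl

/-- The operator `φ ↦ χ(p) φ(p / |p|, s; x'')`. -/
def extendParam (n k : ℕ) : EvenSchwartz n k →L[ℂ] 𝓢(FirstSpace k × ℝ × LastSpace n k, ℂ) :=
  (exists_extendParam n k).choose

theorem extendParam_apply (φ : EvenSchwartz n k) (z : ParamSpace n k) :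
    extendParam n k φ ((z.1 : FirstSpace k), z.2) = φ z := by
  have h1 : ‖(z.1 : FirstSpace k)‖ = 1 := norm_eq_of_mem_sphere z.1
  rw [extendParam, (exists_extendParam n k).choose_spec]
  change sphereCutoff (FirstSpace k) (z.1 : FirstSpace k) *
    homExt φ (radialProj (FirstSpace k) (z.1 : FirstSpace k), z.2) = _
  rw [sphereCutoff_of_norm_one h1, one_mul, radialProj_eq _ (by rw [h1]; norm_num)
    (by rw [h1]; norm_num), h1, inv_one, one_smul]
  exact homExt_apply φ z

end ParamSpace

/-! ### The moment subspace and the isomorphism -/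

section MomentSubspace

variable {n k : ℕ}

theorem joinCoord_of_lt (x' : FirstSpace k) (x'' : LastSpace n k) {i : Fin n}
    (h : (i : ℕ) < k + 1) : joinCoord n k x' x'' i = x' ⟨i, h⟩ := dif_pos h

theorem joinCoord_of_not_lt (x' : FirstSpace k) (x'' : LastSpace n k) {i : Fin n}
    (h : ¬(i : ℕ) < k + 1) : joinCoord n k x' x'' i = x'' ⟨i - (k + 1), by omega⟩ := dif_neg h

/-- The linear map `(x', x'') ↦ joinCoord x' x''`. -/
def joinCoordLM (n k : ℕ) : FirstSpace k × LastSpace n k →ₗ[ℝ] EuclideanSpace ℝ (Fin n) where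
  toFun x := joinCoord n k x.1 x.2
  map_add' x y := by
    ext i
    rw [PiLp.add_apply]
    by_cases h : (i : ℕ) < k + 1
    · simp only [joinCoord_of_lt _ _ h]
      rfl
    · simp only [joinCoord_of_not_lt _ _ h]
      rfl
  map_smul' c x := by
    ext i
    rw [RingHom.id_apply, PiLp.smul_apply]
    by_cases h : (i : ℕ) < k + 1
    · simp only [joinCoord_of_lt _ _ h]
      rfl
    · simp only [joinCoord_of_not_lt _ _ h]
      rfl

theorem joinCoordLM_injective (hkn : k < n) : Function.Injective (joinCoordLM n k) := by
  rw [← LinearMap.ker_eq_bot, LinearMap.ker_eq_bot']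
  intro x hx
  have h : ∀ i, joinCoord n k x.1 x.2 i = 0 := fun i => congrArg (fun y => y i) hx
  refine Prod.ext ?_ ?_
  · ext i
    have := h ⟨i, by omega⟩
    rwa [joinCoord_of_lt (n := n) _ _ i.2] at this
  · ext i
    have := h ⟨k + 1 + i, by omega⟩
    rw [joinCoord_of_not_lt _ _ (by simp only; omega)] at this
    simpa using this

/-- The linear isomorphism `(x', x'') ↦ joinCoord x' x''`. -/
def joinCoordEquiv (hkn : k < n) :
    (FirstSpace k × LastSpace n k) ≃L[ℝ] EuclideanSpace ℝ (Fin n) :=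
  (LinearMap.linearEquivOfInjective (joinCoordLM n k) (joinCoordLM_injective hkn) (by
    simp
    omega)).toContinuousLinearEquiv

/-- The isomorphism of Schwartz spaces induced by a linear isomorphism. -/
def schwartzCongr {E F : Type*} [NormedAddCommGroup E] [NormedSpace ℝ E] [NormedAddCommGroup F]
    [NormedSpace ℝ F] (e : E ≃L[ℝ] F) : 𝓢(F, ℂ) ≃L[ℂ] 𝓢(E, ℂ) :=
  ContinuousLinearEquiv.equivOfInverse (SchwartzMap.compCLMOfContinuousLinearEquiv ℂ e)
    (SchwartzMap.compCLMOfContinuousLinearEquiv ℂ e.symm)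
    (fun f => by
      ext x
      exact congrArg f (e.apply_symm_apply x))
    (fun f => by
      ext x
      exact congrArg f (e.symm_apply_apply x))

variable (n k) in
/-- The permutation `(p, s, η) ↦ ((p, η), s)`. -/
def paramPerm : (FirstSpace k × ℝ × LastSpace n k) ≃L[ℝ] (FirstSpace k × LastSpace n k) × ℝ :=
  ((ContinuousLinearEquiv.refl ℝ (FirstSpace k)).prodCongr
    (ContinuousLinearEquiv.prodComm ℝ ℝ (LastSpace n k))).trans
    (ContinuousLinearEquiv.prodAssoc ℝ (FirstSpace k) (LastSpace n k) ℝ).symm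

variable (n k) in
/-- Exchange of variables of Schwartz functions along `paramPerm`. -/
def paramSwap : 𝓢((FirstSpace k × LastSpace n k) × ℝ, ℂ) ≃L[ℂ]
    𝓢(FirstSpace k × ℝ × LastSpace n k, ℂ) := schwartzCongr (paramPerm n k)

theorem norm_coe_sphere (θ : Metric.sphere (0 : EuclideanSpace ℝ (Fin (k + 1))) 1) :
    ‖(θ : FirstSpace k)‖ = 1 := norm_eq_of_mem_sphere θ

variable (n k) in
/-- The restriction of `kPlaneLift f` to the parameter space. -/
def kPlaneParamLM : 𝓢(FirstSpace k × LastSpace n k, ℂ) →ₗ[ℂ] EvenSchwartz n k where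
  toFun f := ⟨restrictParam (paramSwap n k (kPlaneLift (FirstSpace k) (LastSpace n k) f)),
    isSmoothParam_restrictParam _, isRapidlyDecreasing_restrictParam _,
    fun θ s η => kPlaneLift_neg f (norm_coe_sphere θ) η s⟩
  map_add' f g := Subtype.ext (by
    simp only [map_add]
    rfl)
  map_smul' c f := Subtype.ext (by
    simp only [map_smul]
    rfl)

theorem kPlaneParamLM_apply (f : 𝓢(FirstSpace k × LastSpace n k, ℂ)) (z : ParamSpace n k) :
    kPlaneParamLM n k f z =
      kPlaneLift (FirstSpace k) (LastSpace n k) f (((z.1 : FirstSpace k), z.2.2), z.2.1) := rfl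

theorem kPlaneParamLM_eq_sliceIntegral (f : 𝓢(FirstSpace k × LastSpace n k, ℂ))
    (z : ParamSpace n k) :
    kPlaneParamLM n k f z = sliceIntegral (perpCoord (norm_coe_sphere z.1))
      (schwartzSliceFst z.2.2 f) z.2.1 := by
  rw [kPlaneParamLM_apply]
  exact kPlaneLift_eq_sliceIntegral (perpCoord (norm_coe_sphere z.1))
    (norm_coe_sphere z.1) (inner_perpCoord (norm_coe_sphere z.1)) f z.2.2 z.2.1

theorem continuous_kPlaneParamLM : Continuous (kPlaneParamLM n k) := by
  refine (evenSchwartz_withSeminorms n k).continuous_of_continuous_comp (kPlaneParamLM n k)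
    fun m => ?_
  obtain ⟨q, hq, h⟩ := exists_seminorm_restrictParam n k m
  let L : 𝓢(FirstSpace k × LastSpace n k, ℂ) →L[ℂ] 𝓢(FirstSpace k × ℝ × LastSpace n k, ℂ) :=
    ((paramSwap n k : _ →L[ℂ] _)).comp (kPlaneLift (FirstSpace k) (LastSpace n k))
  have hqL : Continuous (q.comp L.toLinearMap) := hq.comp L.continuous
  exact Seminorm.continuous_of_le hqL fun f => evenSchwartzSeminorm_le fun i hi z => h (L f) i hi z

theorem hasTemperateGrowth_monomial (α : Fin (k + 1) → ℕ) :
    Function.HasTemperateGrowth fun q : LastSpace n k × FirstSpace k =>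
      ∏ i, ((q.2 i : ℝ) : ℂ) ^ α i := by
  have h : ∀ (i : Fin (k + 1)) (m : ℕ), Function.HasTemperateGrowth
      fun q : LastSpace n k × FirstSpace k => ((q.2 i : ℝ) : ℂ) ^ m := by
    intro i m
    have h1 : Function.HasTemperateGrowth
        fun q : LastSpace n k × FirstSpace k => ((q.2 i : ℝ) : ℂ) :=
      (Complex.ofRealCLM.comp ((EuclideanSpace.proj (𝕜 := ℝ) i).comp
        (ContinuousLinearMap.snd ℝ (LastSpace n k) (FirstSpace k)))).hasTemperateGrowth
    induction m with
    | zero => simp [Function.HasTemperateGrowth.const]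
    | succ m ih =>
      simp only [pow_succ]
      exact ih.mul h1
  induction (Finset.univ : Finset (Fin (k + 1))) using Finset.induction_on with
  | empty => simp [Function.HasTemperateGrowth.const]
  | insert i s hi ih =>
    simp only [Finset.prod_insert hi]
    exact (h i (α i)).mul ih

/-- The function `x'' ↦ ∫ x'^α f(x', x'') dx'`. -/
def monomialMoment (f : 𝓢(FirstSpace k × LastSpace n k, ℂ)) (α : Fin (k + 1) → ℕ) :
    𝓢(LastSpace n k, ℂ) :=
  schwartzSliceFst (0 : FirstSpace k) (partialFourier (LastSpace n k) (FirstSpace k)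
    (SchwartzMap.smulLeftCLM (𝕜 := ℂ) ℂ
      (fun q : LastSpace n k × FirstSpace k => ∏ i, ((q.2 i : ℝ) : ℂ) ^ α i)
      (schwartzSwap (FirstSpace k) (LastSpace n k) f)))

theorem monomialMoment_apply (f : 𝓢(FirstSpace k × LastSpace n k, ℂ)) (α : Fin (k + 1) → ℕ)
    (η : LastSpace n k) : monomialMoment f α η =
      ∫ x : FirstSpace k, (∏ i, ((x i : ℝ) : ℂ) ^ α i) * schwartzSliceFst η f x ∧
      Integrable fun x : FirstSpace k => (∏ i, ((x i : ℝ) : ℂ) ^ α i) * schwartzSliceFst η f x := by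
  have h : ∀ x : FirstSpace k, SchwartzMap.smulLeftCLM (𝕜 := ℂ) ℂ
      (fun q : LastSpace n k × FirstSpace k => ∏ i, ((q.2 i : ℝ) : ℂ) ^ α i)
      (schwartzSwap (FirstSpace k) (LastSpace n k) f) (η, x) =
      (∏ i, ((x i : ℝ) : ℂ) ^ α i) * schwartzSliceFst η f x := fun x => by
    rw [SchwartzMap.smulLeftCLM_apply_apply (hasTemperateGrowth_monomial α)]
    rfl
  refine ⟨(partialFourier_apply_zero _ η).trans (by simp_rw [h]), ?_⟩
  simp_rw [← h]
  exact (schwartzSlice η _).integrable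

theorem inner_pow_eq_sum (θ x : FirstSpace k) (m : ℕ) :
    ((inner ℝ θ x : ℝ) : ℂ) ^ m = ∑ α ∈ Finset.piAntidiag (Finset.univ : Finset (Fin (k + 1))) m,
      (Nat.multinomial Finset.univ α : ℂ) * (∏ i, ((θ i : ℝ) : ℂ) ^ α i) *
        ∏ i, ((x i : ℝ) : ℂ) ^ α i := by
  have h : ((inner ℝ θ x : ℝ) : ℂ) = ∑ i, ((θ i : ℝ) : ℂ) * ((x i : ℝ) : ℂ) := by
    rw [PiLp.inner_apply]
    simp [mul_comm]
  rw [h, Finset.sum_pow_eq_sum_piAntidiag]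
  refine Finset.sum_congr rfl fun α _ => ?_
  simp_rw [mul_pow, Finset.prod_mul_distrib, mul_assoc]

/-- The moment of order `m` is the integral of `⟪θ, x'⟫ ^ m f`; the multinomial expansion gives as
coefficients multinomial numbers times the monomial moments of `f`, which are Schwartz in `x''`. -/
theorem kPlaneParamLM_mem (f : 𝓢(FirstSpace k × LastSpace n k, ℂ)) :
    kPlaneParamLM n k f ∈ momentSubspace n k := by
  intro m
  refine ⟨fun α => (Nat.multinomial Finset.univ α : ℂ) • monomialMoment f α, fun θ η => ?_⟩
  have hsum : ∀ x : FirstSpace k, ((inner ℝ (θ : FirstSpace k) x : ℝ) : ℂ) ^ m *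
      schwartzSliceFst η f x = ∑ α ∈ Finset.piAntidiag (Finset.univ : Finset (Fin (k + 1))) m,
      (Nat.multinomial Finset.univ α : ℂ) * (∏ i, (((θ : FirstSpace k) i : ℝ) : ℂ) ^ α i) *
        ((∏ i, ((x i : ℝ) : ℂ) ^ α i) * schwartzSliceFst η f x) := fun x => by
    rw [inner_pow_eq_sum, Finset.sum_mul]
    exact Finset.sum_congr rfl fun α _ => mul_assoc _ _ _
  have hint : ∀ α : Fin (k + 1) → ℕ, Integrable fun x : FirstSpace k =>
      (Nat.multinomial Finset.univ α : ℂ) * (∏ i, (((θ : FirstSpace k) i : ℝ) : ℂ) ^ α i) *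
        ((∏ i, ((x i : ℝ) : ℂ) ^ α i) * schwartzSliceFst η f x) := fun α =>
    (monomialMoment_apply f α η).2.const_mul _
  have key := integral_mul_sliceIntegral (perpCoord (norm_coe_sphere θ))
    (inner_perpCoord (norm_coe_sphere θ)) (schwartzSliceFst η f) (κ := fun s => (s : ℂ) ^ m) (by
      simp_rw [hsum]
      exact integrable_finsetSum _ fun α _ => hint α)
  simp_rw [hsum] at key
  rw [integral_finsetSum _ fun α _ => hint α] at key
  simp_rw [integral_const_mul, ← (monomialMoment_apply f _ η).1] at key
  calc ∫ s : ℝ, kPlaneParamLM n k f (θ, s, η) * (s : ℂ) ^ m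
      = ∫ s : ℝ, (s : ℂ) ^ m * sliceIntegral (perpCoord (norm_coe_sphere θ))
          (schwartzSliceFst η f) s := by
        refine integral_congr_ae (Filter.Eventually.of_forall fun s => ?_)
        have h := kPlaneParamLM_eq_sliceIntegral f ((θ, s, η) : ParamSpace n k)
        simp only at h ⊢
        rw [h, mul_comm]
    _ = _ := key
    _ = _ := Finset.sum_congr rfl fun α _ => by
        rw [smul_apply, smul_eq_mul]
        ring

variable (n k) in
/-- The restricted `k`-plane transform as a continuous linear map into the moment subspace. -/
def kPlaneParam : 𝓢(FirstSpace k × LastSpace n k, ℂ) →L[ℂ] momentSubspace n k :=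
  ContinuousLinearMap.codRestrict ⟨kPlaneParamLM n k, continuous_kPlaneParamLM⟩ (momentSubspace n k)
    kPlaneParamLM_mem

theorem isHomogeneousFst_sum (m : ℕ) (c : (Fin (k + 1) → ℕ) → 𝓢(LastSpace n k, ℂ)) :
    IsHomogeneousFst m fun x : FirstSpace k × LastSpace n k =>
      ∑ α ∈ Finset.piAntidiag (Finset.univ : Finset (Fin (k + 1))) m,
        c α x.2 * ∏ i, ((x.1 i : ℝ) : ℂ) ^ α i := by
  refine ⟨ContDiff.sum fun α _ => ?_, fun t p η => ?_⟩
  · refine (((c α).smooth ⊤).comp contDiff_snd).mul (contDiff_prod fun i _ => ContDiff.pow ?_ _)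
    exact (Complex.ofRealCLM.comp ((EuclideanSpace.proj (𝕜 := ℝ) i).comp
      (ContinuousLinearMap.fst ℝ (FirstSpace k) (LastSpace n k)))).contDiff
  · rw [Finset.mul_sum]
    refine Finset.sum_congr rfl fun α hα => ?_
    have h : ∑ i, α i = m := (Finset.mem_piAntidiag.1 hα).1
    have h1 : ∀ i, (((t • p) i : ℝ) : ℂ) = (t : ℂ) * ((p i : ℝ) : ℂ) := fun i => by simp
    simp_rw [h1, mul_pow, Finset.prod_mul_distrib, Finset.prod_pow_eq_pow_sum, h]
    ring

theorem paramSwap_symm_extendParam_apply (φ : EvenSchwartz n k) {p : FirstSpace k} (hp : ‖p‖ = 1)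
    (η : LastSpace n k) (s : ℝ) : (paramSwap n k).symm (extendParam n k φ) ((p, η), s) =
      φ (⟨p, by simp [hp]⟩, s, η) :=
  extendParam_apply φ (⟨p, by simp [hp]⟩, s, η)

theorem paramSwap_symm_extendParam_mem (φ : momentSubspace n k) :
    (paramSwap n k).symm (extendParam n k (φ : EvenSchwartz n k)) ∈
      radialMomentSubmodule (FirstSpace k) (LastSpace n k) := by
  intro m
  obtain ⟨c, hc⟩ := φ.2 m
  refine ⟨_, isHomogeneousFst_sum m c, fun p η hp => ?_⟩
  rw [sndMoment_eq_integral]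
  refine Eq.trans ?_ (hc ⟨p, by simp [hp]⟩ η)
  refine integral_congr_ae (Filter.Eventually.of_forall fun s => ?_)
  simp only [paramSwap_symm_extendParam_apply _ hp]
  exact mul_comm _ _

variable (n k) in
/-- The extension of the functions in the moment subspace off the sphere. -/
def extendMoment : momentSubspace n k →L[ℂ] radialMomentSubmodule (FirstSpace k) (LastSpace n k) :=
  (((paramSwap n k).symm : _ →L[ℂ] _).comp
    ((extendParam n k).comp (momentSubspace n k).subtypeL)).codRestrict _
    paramSwap_symm_extendParam_mem

theorem extendMoment_apply (φ : momentSubspace n k) {p : FirstSpace k} (hp : ‖p‖ = 1)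
    (η : LastSpace n k) (s : ℝ) :
    (extendMoment n k φ : 𝓢((FirstSpace k × LastSpace n k) × ℝ, ℂ)) ((p, η), s) =
      (φ : EvenSchwartz n k) (⟨p, by simp [hp]⟩, s, η) :=
  paramSwap_symm_extendParam_apply _ hp η s

theorem extendMoment_neg (φ : momentSubspace n k) {p : FirstSpace k} (hp : ‖p‖ = 1)
    (η : LastSpace n k) (s : ℝ) :
    (extendMoment n k φ : 𝓢((FirstSpace k × LastSpace n k) × ℝ, ℂ)) ((-p, η), -s) =
      (extendMoment n k φ : 𝓢((FirstSpace k × LastSpace n k) × ℝ, ℂ)) ((p, η), s) := by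
  rw [extendMoment_apply φ hp, extendMoment_apply φ (by rwa [norm_neg])]
  exact φ.1.2.2.2 ⟨p, by simp [hp]⟩ s η

/-- Supplies the default direction at `ξ = 0`; its choice does not affect the inverse. -/
theorem norm_single_zero : ‖(EuclideanSpace.single 0 1 : FirstSpace k)‖ = 1 := by simp

variable (n k) in
/-- The inverse of the restricted `k`-plane transform. -/
def kPlaneParamInv : momentSubspace n k →L[ℂ] 𝓢(FirstSpace k × LastSpace n k, ℂ) :=
  (fstFourierInv (FirstSpace k) (LastSpace n k)).comp
    ((polarInverse norm_single_zero).comp (extendMoment n k))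

/-- The extension of the transform need not equal `kPlaneLift f` off the sphere, but the polar
inverse only uses unit vectors, where the two agree. -/
theorem kPlaneParamInv_kPlaneParam (f : 𝓢(FirstSpace k × LastSpace n k, ℂ)) :
    kPlaneParamInv n k (kPlaneParam n k f) = f := by
  have h : polarInverse norm_single_zero (extendMoment n k (kPlaneParam n k f)) =
      fstFourier (FirstSpace k) (LastSpace n k) f := by
    refine polarInverse_eq _ _ _ fun p η σ hp => ?_
    rw [← partialFourier_kPlaneLift f hp]
    exact partialFourier_congr (fun s => extendMoment_apply _ hp η s) σ
  change fstFourierInv (FirstSpace k) (LastSpace n k) (polarInverse norm_single_zero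
    (extendMoment n k (kPlaneParam n k f))) = f
  rw [h, fstFourierInv_fstFourier]

theorem kPlaneParam_kPlaneParamInv (φ : momentSubspace n k) :
    kPlaneParam n k (kPlaneParamInv n k φ) = φ := by
  refine Subtype.ext (Subtype.ext (funext fun z => ?_))
  have h := kPlaneLift_fstFourierInv_polarInverse norm_single_zero (extendMoment n k φ)
    (fun p η s hp => extendMoment_neg φ hp η s) (norm_coe_sphere z.1) z.2.2 z.2.1
  rw [extendMoment_apply φ (norm_coe_sphere z.1)] at h
  exact h

variable (n k) in
/-- The restricted `k`-plane transform as an isomorphism onto the moment subspace. -/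
def kPlaneParamEquiv : 𝓢(FirstSpace k × LastSpace n k, ℂ) ≃L[ℂ] momentSubspace n k :=
  ContinuousLinearEquiv.equivOfInverse (kPlaneParam n k) (kPlaneParamInv n k)
    kPlaneParamInv_kPlaneParam kPlaneParam_kPlaneParamInv

theorem schwartzSliceFst_joinCoord (hkn : k < n) (f : 𝓢(EuclideanSpace ℝ (Fin n), ℂ))
    (z : ParamSpace n k) (s : ℝ) (u : (ℝ ∙ (z.1 : FirstSpace k))ᗮ) :
    schwartzSliceFst z.2.2 (schwartzCongr (joinCoordEquiv hkn) f)
      (perpCoord (norm_coe_sphere z.1) (WithLp.toLp 2 (s, u))) =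
      f (joinCoord n k (s • (z.1 : FirstSpace k) + u) z.2.2) := by
  rw [perpCoord_apply]
  rfl

theorem integrable_restrictedKPlane (hkn : k < n) (f : 𝓢(EuclideanSpace ℝ (Fin n), ℂ))
    (z : ParamSpace n k) :
    Integrable (fun u : (ℝ ∙ (z.1 : EuclideanSpace ℝ (Fin (k + 1))))ᗮ =>
      f (joinCoord n k (z.2.1 • (z.1 : EuclideanSpace ℝ (Fin (k + 1))) + u) z.2.2))
      (perpVolume (z.1 : EuclideanSpace ℝ (Fin (k + 1)))) := by
  have h := integrable_slice (perpCoord (norm_coe_sphere z.1))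
    (schwartzSliceFst z.2.2 (schwartzCongr (joinCoordEquiv hkn) f)) z.2.1
  simp_rw [schwartzSliceFst_joinCoord hkn f z] at h
  -- The `volume` that the inner product induces on the orthogonal complement unfolds to
  -- `perpVolume`.
  exact h

theorem kPlaneParamLM_eq_restrictedKPlane (hkn : k < n) (f : 𝓢(EuclideanSpace ℝ (Fin n), ℂ))
    (z : ParamSpace n k) :
    kPlaneParamLM n k (schwartzCongr (joinCoordEquiv hkn) f) z = restrictedKPlane f z := by
  rw [kPlaneParamLM_eq_sliceIntegral, sliceIntegral_apply]
  simp_rw [schwartzSliceFst_joinCoord hkn f z]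
  rfl

end MomentSubspace

end

theorem mainTheorem1 (n k : ℕ) (hk : 1 ≤ k) (hkn : k < n) :
    (∀ (f : 𝓢(EuclideanSpace ℝ (Fin n), ℂ)) (z : ParamSpace n k),
      Integrable
        (fun u : (ℝ ∙ (z.1 : EuclideanSpace ℝ (Fin (k + 1))))ᗮ =>
          f (joinCoord n k (z.2.1 • (z.1 : EuclideanSpace ℝ (Fin (k + 1))) + u) z.2.2))
        (perpVolume (z.1 : EuclideanSpace ℝ (Fin (k + 1))))) ∧
    ∃ T : 𝓢(EuclideanSpace ℝ (Fin n), ℂ) ≃L[ℂ] momentSubspace n k,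
      ∀ (f : 𝓢(EuclideanSpace ℝ (Fin n), ℂ)) (z : ParamSpace n k),
        (T f : EvenSchwartz n k) z = restrictedKPlane f z :=
  ⟨integrable_restrictedKPlane hkn,
    (schwartzCongr (joinCoordEquiv hkn)).trans (kPlaneParamEquiv n k),
    kPlaneParamLM_eq_restrictedKPlane hkn⟩
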